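/- **Model.** Let $n\ge 1$, $q\in(0,1/2]$, $\lambda\in[0,1-q]$, $k\in\{1,\dots,n\}$, and let $\Theta\in[0,\lambda]^{n\times n}$ be symmetric. A latent assignment $z\in[n]^n$ is drawn either with i.i.d. uniform coordinates (independent sampling) or as a uniform permutation of $[n]$ (permutation sampling). Given $z$, the $Y^\star_{ij}$, $i<j$, are independent Bernoulli variables with parameter $q+\Theta_{z_iz_j}$; put $Y_{ij}=Y_{ji}=Y^\star_{ij}-q$, $\bar q=q(1-q)$, $p=q+\lambda$, $\bar p=p(1-q)^2+(1-p)q^2$. $\mathbb E$ is the expectation under the sampling scheme considered and $\widetilde{\mathbb E}$ the one under independent sampling. **Graphs.** A template is a finite simple graph $G=(V,E)$ without isolated nodes and with $1\le|E|\le D$; $\#\mathrm{CC}_G$ is its number of connected components. For an injective $\pi:V\to[n]$ let $P_{G,\pi}=\prod_{(u,v)\in E}Y_{\pi(u)\pi(v)}$, and let $G[\pi]$ be $G$ relabeled by $\pi$. For templates $G^{(1)},G^{(2)}$ and labelings $\pi^{(1)},\pi^{(2)}$, nodes $v^{(1)},v^{(2)}$ are matched if $\pi^{(1)}(v^{(1)})=\pi^{(2)}(v^{(2)})$;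 the matching is perfect if all nodes of both graphs are matched and all edges are matched to edges. $E_\cap$ and $E_\Delta$ are the intersection and the symmetric difference of the edge sets of $G^{(1)}[\pi^{(1)}]$ and $G^{(2)}[\pi^{(2)}]$; $G_\Delta=(V_\Delta,E_\Delta)$ has as nodes the endpoints of the edges in $E_\Delta$ and has $\#\mathrm{CC}_\Delta$ connected components, of which $\#\mathrm{CC}_{\mathrm{pure}}$ are pure, i.e. consist only of unmatched nodes of $G^{(1)}$ or only of unmatched nodes of $G^{(2)}$. $\mathcal A$ is the event that the following graph is connected: its vertices are the pure components and, if there are any, one vertex $\omega_0$ for all the remaining nodes of $G^{(1)}[\pi^{(1)}]\cup G^{(2)}[\pi^{(2)}]$; two vertices are adjacent if they contain nodes $a$, $b$ with $z_a=z_b$. **Conditions** (all templates with at most $D$ edges, all labelings). * C-Signal, with $c_s>1$: $\Theta_{ij}\in[0,\lambda]$ and $\frac kn\vee\frac{\lambda k}{\sqrt{nq}}\vee\frac\lambda q\le D^{-8c_s}$. * C-Moment, with $c_m\ge0$: $|\mathbb E[P_{G,\pi}]|\le(D^{c_m}\lambda)^{|E|}(D^{c_m}k/n)^{|V|-\#\mathrm{CC}_G}$.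 * C-Variance, with $c_{v,1},c_{v,2},c_{v,3}\ge0$ and $c_{v,4}\ge1$: for every non-perfect matching, $|\mathbb E[P_{G^{(1)},\pi^{(1)}}P_{G^{(2)},\pi^{(2)}}]|\le c_{v,2}(D^{c_{v,1}}\lambda)^{|E_\Delta|}\bar p^{|E_\cap|}(D^{c_{v,1}}k/n)^{|V_\Delta|-\#\mathrm{CC}_\Delta}$; and $|\mathbb E[P_{G,\pi}^2]-\bar q^{|E|}|\le c_{v,3}D^{-c_{v,4}}\bar q^{|E|}$. * C-Variance-Permutation, with $c_{vd,1},c_{vd,2}\ge0$: for every non-perfect matching, $$|\widetilde{\mathbb E}[\mathbf 1\{\mathcal A\}P_{G^{(1)},\pi^{(1)}}P_{G^{(2)},\pi^{(2)}}]|\le c_{vd,2}D^{c_{vd,1}}(D^{c_{vd,1}}\lambda)^{|E_\Delta|}\bar p^{|E_\cap|}\Big(D^{c_{vd,1}}\frac kn\Big)^{|V_\Delta|-\#\mathrm{CC}_\Delta}\Big(c_{vd,2}\frac{D^{c_{vd,1}}}{\sqrt n}\Big)^{\#\mathrm{CC}_{\mathrm{pure}}}.$$ **Rooted basis.** A rooted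 template is a finite simple graph $G=(V,E)$ with two distinguished distinct nodes $v_1,v_2$, in which no node other than $v_1,v_2$ is isolated. Two of them are equivalent if there is a graph isomorphism mapping $v_1$ to $v_1$ and $v_2$ to $v_2$. $\mathcal G^{(1,2)}_{\le D}$ is a maximal collection of pairwise non-equivalent rooted templates with $1\le|E|\le D$. For $G$ in it, with connected components that contain an edge $G_1,\dots,G_c$, put $$\Psi^{(1,2)}_G=\frac1{\sqrt{\mathbb V^{(1,2)}(G)}}\sum_{\pi:\ \pi(v_1)=1,\ \pi(v_2)=2}\ \prod_{l=1}^c\big(P_{G_l,\pi}-\mathbb E[P_{G_l,\pi}]\big),\qquad\mathbb V^{(1,2)}(G)=\frac{(n-2)!}{(n-|V|)!}\,|\mathrm{Aut}^{(1,2)}(G)|\,\bar q^{|E|},$$ where $\pi$ ranges over the injections $V\to[n]$ and $\mathrm{Aut}^{(1,2)}(G)$ is the set of automorphisms of $G$ fixing $v_1$ and $v_2$. **Theorem.** Let $D\ge2$ be an integer. Assume either independent sampling with C-Signal, C-Moment and C-Variance, or permutation sampling with C-Signal, C-Moment, C-Variance and C-Variance-Permutation, where $c_s$ is larger than a threshold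 (itself larger than $1$) depending only on the other constants of the assumed conditions. Then, for all $\alpha=(\alpha_\emptyset,(\alpha_G)_{G\in\mathcal G^{(1,2)}_{\le D}})$, $$(1-cD^{-c_s/2})\|\alpha\|_2^2\ \le\ \mathbb E\Big[\Big(\alpha_\emptyset+\sum_{G\in\mathcal G^{(1,2)}_{\le D}}\alpha_G\Psi^{(1,2)}_G\Big)^2\Big]\ \le\ (1+cD^{-c_s/2})\|\alpha\|_2^2,$$ where $c>0$ depends only on the constants of the assumed conditions other than $c_s$. -/

import Mathlib

open scoped symmDiff

noncomputable section

namespace LatentGraph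

/-! ## The random graph model -/

/-- The two sampling schemes for the latent assignment `z : Fin n → Fin n`: either the `z i` are
i.i.d. uniform, or `z` is a uniform permutation. -/
inductive Sampling
  | independent
  | permutation

open scoped Classical in
/-- The probability of the latent assignment `z` under a sampling scheme. -/
def latentProb {n : ℕ} (s : Sampling) (z : Fin n → Fin n) : ℝ :=
  match s with
  | .independent => 1 / (n : ℝ) ^ n
  | .permutation => if Function.Bijective z then 1 / (n.factorial : ℝ) else 0

open scoped Classical in
/-- The conditional probability, given `z`, that the observed graph is `A`: the pairs `i < j` are
edges independently of each other, with probability `q + Θ (z i) (z j)`. -/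
def graphProb {n : ℕ} (q : ℝ) (Θ : Matrix (Fin n) (Fin n) ℝ) (z : Fin n → Fin n)
    (A : SimpleGraph (Fin n)) : ℝ :=
  ∏ p : Fin n × Fin n with p.1 < p.2,
    if A.Adj p.1 p.2 then q + Θ (z p.1) (z p.2) else 1 - (q + Θ (z p.1) (z p.2))

open scoped Classical in
/-- Expectation of a function of the latent assignment and of the observed graph. -/
def expect {n : ℕ} (s : Sampling) (q : ℝ) (Θ : Matrix (Fin n) (Fin n) ℝ)
    (f : (Fin n → Fin n) → SimpleGraph (Fin n) → ℝ) : ℝ :=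
  ∑ z : Fin n → Fin n, ∑ A : SimpleGraph (Fin n), latentProb s z * graphProb q Θ z A * f z A

open scoped Classical in
/-- The centred adjacency `Y = Y* - q`, as a function on unordered pairs of nodes. -/
def centeredAdj {n : ℕ} (q : ℝ) (A : SimpleGraph (Fin n)) (e : Sym2 (Fin n)) : ℝ :=
  (if e ∈ A.edgeSet then 1 else 0) - q

open scoped Classical in
/-- `P_{G,π}(Y) = ∏_{(u,v) ∈ E} Y_{π(u),π(v)}`. -/
def monomial {n : ℕ} {V : Type} [Fintype V] (q : ℝ) (G : SimpleGraph V) (π : V ↪ Fin n)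
    (A : SimpleGraph (Fin n)) : ℝ :=
  ∏ e ∈ G.edgeFinset, centeredAdj q A (e.map π)

/-! ## Templates, matchings and merged graphs -/

/-- `G` has no isolated node and between `1` and `D` edges. -/
def IsTemplate {V : Type} (D : ℕ) (G : SimpleGraph V) : Prop :=
  (∀ v, ∃ w, G.Adj v w) ∧ 1 ≤ G.edgeSet.ncard ∧ G.edgeSet.ncard ≤ D

/-- A set of pairs of nodes in which no node appears twice. -/
def IsMatching {V₁ V₂ : Type} (M : Set (V₁ × V₂)) : Prop :=
  ∀ a ∈ M, ∀ b ∈ M, a.1 = b.1 ∨ a.2 = b.2 → a = b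

/-- The labelings `π₁`, `π₂` identify exactly the pairs of nodes in `M`. -/
def Compatible {n : ℕ} {V₁ V₂ : Type} (M : Set (V₁ × V₂)) (π₁ : V₁ ↪ Fin n) (π₂ : V₂ ↪ Fin n) :
    Prop :=
  ∀ v₁ v₂, π₁ v₁ = π₂ v₂ ↔ (v₁, v₂) ∈ M

/-- All nodes of both graphs are perfectly matched: they are matched, and all their incident edges
are matched. -/
def IsPerfect {V₁ V₂ : Type} (G₁ : SimpleGraph V₁) (G₂ : SimpleGraph V₂) (M : Set (V₁ × V₂)) :
    Prop :=
  (∀ v₁, ∃ v₂, (v₁, v₂) ∈ M) ∧ (∀ v₂, ∃ v₁, (v₁, v₂) ∈ M) ∧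
    ∀ a ∈ M, ∀ b ∈ M, G₁.Adj a.1 b.1 ↔ G₂.Adj a.2 b.2

section Merged

variable {n : ℕ} {V₁ V₂ : Type}

/-- The intersection of the labelled graphs `G₁[π₁]` and `G₂[π₂]`. -/
def interGraph (G₁ : SimpleGraph V₁) (π₁ : V₁ ↪ Fin n) (G₂ : SimpleGraph V₂) (π₂ : V₂ ↪ Fin n) :
    SimpleGraph (Fin n) :=
  G₁.map π₁ ⊓ G₂.map π₂

/-- The symmetric difference of the labelled graphs `G₁[π₁]` and `G₂[π₂]`. Its node set is
understood to be its support, that is the set of endpoints of its edges. -/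
def diffGraph (G₁ : SimpleGraph V₁) (π₁ : V₁ ↪ Fin n) (G₂ : SimpleGraph V₂) (π₂ : V₂ ↪ Fin n) :
    SimpleGraph (Fin n) :=
  (G₁.map π₁) ∆ (G₂.map π₂)

/-- The number of edges of a labelled graph. -/
def numEdges (H : SimpleGraph (Fin n)) : ℕ := H.edgeSet.ncard

/-- The number of non-isolated nodes of a labelled graph. -/
def numNodes (H : SimpleGraph (Fin n)) : ℕ := H.support.ncard

/-- The number of connected components of a labelled graph, isolated nodes being discarded. -/
def numCC (H : SimpleGraph (Fin n)) : ℕ := Nat.card (H.induce H.support).ConnectedComponent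

/-- A connected component of the symmetric difference graph is pure if it is made only of
unmatched nodes of `G₁`, or only of unmatched nodes of `G₂`. -/
def IsPure (G₁ : SimpleGraph V₁) (π₁ : V₁ ↪ Fin n) (G₂ : SimpleGraph V₂) (π₂ : V₂ ↪ Fin n)
    (c : (diffGraph G₁ π₁ G₂ π₂).ConnectedComponent) : Prop :=
  c.supp ⊆ Set.range π₁ \ Set.range π₂ ∨ c.supp ⊆ Set.range π₂ \ Set.range π₁

/-- The number of pure connected components. -/
def numPure (G₁ : SimpleGraph V₁) (π₁ : V₁ ↪ Fin n) (G₂ : SimpleGraph V₂) (π₂ : V₂ ↪ Fin n) : ℕ :=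
  Nat.card {c : (diffGraph G₁ π₁ G₂ π₂).ConnectedComponent // IsPure G₁ π₁ G₂ π₂ c}

open scoped Classical in
/-- The block of a node of the merged graph: its component if that is pure, and otherwise `none`,
which stands for the common block `ω₀` of all the remaining nodes. -/
def block (G₁ : SimpleGraph V₁) (π₁ : V₁ ↪ Fin n) (G₂ : SimpleGraph V₂) (π₂ : V₂ ↪ Fin n)
    (a : ↥(Set.range π₁ ∪ Set.range π₂)) :
    Option (diffGraph G₁ π₁ G₂ π₂).ConnectedComponent :=
  if IsPure G₁ π₁ G₂ π₂ ((diffGraph G₁ π₁ G₂ π₂).connectedComponentMk a.1) then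
    some ((diffGraph G₁ π₁ G₂ π₂).connectedComponentMk a.1)
  else none

/-- The graph `𝒩[z; G_∪]` on the non-empty blocks, two blocks being adjacent when they contain two
nodes with the same latent assignment. -/
def latentLinkGraph (G₁ : SimpleGraph V₁) (π₁ : V₁ ↪ Fin n) (G₂ : SimpleGraph V₂) (π₂ : V₂ ↪ Fin n)
    (z : Fin n → Fin n) : SimpleGraph ↥(Set.range (block G₁ π₁ G₂ π₂)) :=
  SimpleGraph.fromRel fun x y =>
    ∃ a b, block G₁ π₁ G₂ π₂ a = x.1 ∧ block G₁ π₁ G₂ π₂ b = y.1 ∧ z a.1 = z b.1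

end Merged

/-! ## The conditions -/

/-- Signal condition. -/
structure CSignal {n : ℕ} (cs : ℝ) (D k : ℕ) (q lam : ℝ) (Θ : Matrix (Fin n) (Fin n) ℝ) : Prop where
  one_lt : 1 < cs
  mem_Icc : ∀ i j, Θ i j ∈ Set.Icc 0 lam
  bound : max (max ((k : ℝ) / n) (lam * k / √((n : ℝ) * q))) (lam / q) ≤ (D : ℝ) ^ (-(8 * cs))

/-- First-moment condition. -/
def CMoment {n : ℕ} (s : Sampling) (cm : ℝ) (D k : ℕ) (q lam : ℝ)
    (Θ : Matrix (Fin n) (Fin n) ℝ) : Prop :=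
  ∀ (V : Type) [Fintype V] (G : SimpleGraph V), IsTemplate D G → ∀ π : V ↪ Fin n,
    |expect s q Θ (fun _ A => monomial q G π A)| ≤
      ((D : ℝ) ^ cm * lam) ^ G.edgeSet.ncard *
        ((D : ℝ) ^ cm * ((k : ℝ) / n)) ^ (Fintype.card V - Nat.card G.ConnectedComponent)

/-- `p̄ = p (1 - q)² + (1 - p) q²` with `p = λ + q`. -/
def pBar (q lam : ℝ) : ℝ := (lam + q) * (1 - q) ^ 2 + (1 - (lam + q)) * q ^ 2

/-- `q̄ = q (1 - q)`. -/
def qBar (q : ℝ) : ℝ := q * (1 - q)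

/-- Covariance and variance condition. -/
structure CVariance {n : ℕ} (s : Sampling) (cv₁ cv₂ cv₃ cv₄ : ℝ) (D k : ℕ) (q lam : ℝ)
    (Θ : Matrix (Fin n) (Fin n) ℝ) : Prop where
  covariance : ∀ (V₁ V₂ : Type) [Fintype V₁] [Fintype V₂]
    (G₁ : SimpleGraph V₁) (G₂ : SimpleGraph V₂), IsTemplate D G₁ → IsTemplate D G₂ →
    ∀ M : Set (V₁ × V₂), IsMatching M → ¬ IsPerfect G₁ G₂ M →
    ∀ (π₁ : V₁ ↪ Fin n) (π₂ : V₂ ↪ Fin n), Compatible M π₁ π₂ →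
      |expect s q Θ (fun _ A => monomial q G₁ π₁ A * monomial q G₂ π₂ A)| ≤
        cv₂ * ((D : ℝ) ^ cv₁ * lam) ^ numEdges (diffGraph G₁ π₁ G₂ π₂) *
          pBar q lam ^ numEdges (interGraph G₁ π₁ G₂ π₂) *
          ((D : ℝ) ^ cv₁ * ((k : ℝ) / n)) ^
            (numNodes (diffGraph G₁ π₁ G₂ π₂) - numCC (diffGraph G₁ π₁ G₂ π₂))
  variance : ∀ (V : Type) [Fintype V] (G : SimpleGraph V), IsTemplate D G → ∀ π : V ↪ Fin n,
    |expect s q Θ (fun _ A => monomial q G π A ^ 2) - qBar q ^ G.edgeSet.ncard| ≤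
      cv₃ * (D : ℝ) ^ (-cv₄) * qBar q ^ G.edgeSet.ncard

open scoped Classical in
/-- Additional covariance condition for permutation sampling. The expectation in it is taken under
independent sampling, and the indicator is that of the event that `𝒩[z; G_∪]` is connected. -/
def CVariancePermutation {n : ℕ} (cvd₁ cvd₂ : ℝ) (D k : ℕ) (q lam : ℝ)
    (Θ : Matrix (Fin n) (Fin n) ℝ) : Prop :=
  ∀ (V₁ V₂ : Type) [Fintype V₁] [Fintype V₂]
    (G₁ : SimpleGraph V₁) (G₂ : SimpleGraph V₂), IsTemplate D G₁ → IsTemplate D G₂ →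
    ∀ M : Set (V₁ × V₂), IsMatching M → ¬ IsPerfect G₁ G₂ M →
    ∀ (π₁ : V₁ ↪ Fin n) (π₂ : V₂ ↪ Fin n), Compatible M π₁ π₂ →
      |expect .independent q Θ (fun z A =>
          (if (latentLinkGraph G₁ π₁ G₂ π₂ z).Connected then 1 else 0) *
            (monomial q G₁ π₁ A * monomial q G₂ π₂ A))| ≤
        cvd₂ * (D : ℝ) ^ cvd₁ *
          ((D : ℝ) ^ cvd₁ * lam) ^ numEdges (diffGraph G₁ π₁ G₂ π₂) *
          pBar q lam ^ numEdges (interGraph G₁ π₁ G₂ π₂) *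
          ((D : ℝ) ^ cvd₁ * ((k : ℝ) / n)) ^
            (numNodes (diffGraph G₁ π₁ G₂ π₂) - numCC (diffGraph G₁ π₁ G₂ π₂)) *
          (cvd₂ * ((D : ℝ) ^ cvd₁ / √(n : ℝ))) ^ numPure G₁ π₁ G₂ π₂

/-! ## The rooted estimation basis -/

/-- A rooted template: a graph with nodes `v₁ = 0`, `v₂ = 1`, `v₃, …`, in which no node is isolated
except possibly `v₁` and `v₂`. -/
structure RootedTemplate where
  m : ℕ
  graph : SimpleGraph (Fin (m + 2))
  no_isolated : ∀ v, v ≠ 0 → v ≠ 1 → ∃ w, graph.Adj v w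

namespace RootedTemplate

/-- Number of edges. -/
def edges (G : RootedTemplate) : ℕ := G.graph.edgeSet.ncard

/-- Equivalence: a graph isomorphism that maps roots to roots, in order. -/
def Equivalent (G H : RootedTemplate) : Prop :=
  ∃ σ : G.graph ≃g H.graph, σ 0 = 0 ∧ σ 1 = 1

/-- The number of automorphisms that fix both roots. -/
def autCard (G : RootedTemplate) : ℕ :=
  Nat.card {σ : G.graph ≃g G.graph // σ 0 = 0 ∧ σ 1 = 1}

/-- The labeling sends `v₁` and `v₂` to the first and to the second node. -/
def IsRooted {n : ℕ} (G : RootedTemplate) (π : Fin (G.m + 2) ↪ Fin n) : Prop :=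
  (π 0 : ℕ) = 0 ∧ (π 1 : ℕ) = 1

open scoped Classical in
/-- `P̄_{G,π}`: the product of the centred monomials of the non-trivial connected components. -/
def centeredMonomial {n : ℕ} (s : Sampling) (q : ℝ) (Θ : Matrix (Fin n) (Fin n) ℝ)
    (G : RootedTemplate) (π : Fin (G.m + 2) ↪ Fin n) (A : SimpleGraph (Fin n)) : ℝ :=
  ∏ c : G.graph.ConnectedComponent with c.supp.Nontrivial,
    (monomial q (G.graph.induce c.supp) ((Function.Embedding.subtype _).trans π) A -
      expect s q Θ (fun _ B =>
        monomial q (G.graph.induce c.supp) ((Function.Embedding.subtype _).trans π) B))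

/-- The variance proxy `(n-2)! / (n-|V|)! * |Aut^{(1,2)}(G)| * q̄ ^ |E|`. -/
def varianceProxy (n : ℕ) (q : ℝ) (G : RootedTemplate) : ℝ :=
  ((n - 2).factorial : ℝ) / ((n - (G.m + 2)).factorial : ℝ) * (G.autCard : ℝ) * qBar q ^ G.edges

open scoped Classical in
/-- The basis element `Ψ_G^{(1,2)}`. -/
def psi {n : ℕ} (s : Sampling) (q : ℝ) (Θ : Matrix (Fin n) (Fin n) ℝ)
    (G : RootedTemplate) (A : SimpleGraph (Fin n)) : ℝ :=
  (∑ π : Fin (G.m + 2) ↪ Fin n with G.IsRooted π, G.centeredMonomial s q Θ π A) /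
    √(G.varianceProxy n q)

end RootedTemplate

/-- `C` is a maximal collection of pairwise non-equivalent rooted templates with at least one and
at most `D` edges. -/
structure IsRootedCollection (D : ℕ) (C : Finset RootedTemplate) : Prop where
  edges_mem : ∀ G ∈ C, 1 ≤ G.edges ∧ G.edges ≤ D
  pairwise : ∀ G ∈ C, ∀ H ∈ C, G.Equivalent H → G = H
  maximal : ∀ G : RootedTemplate, 1 ≤ G.edges → G.edges ≤ D → ∃ H ∈ C, G.Equivalent H

/-- For every coefficient vector `α = (α_∅, (α_G))`, the second moment of
`α_∅ + ∑ α_G Ψ_G^{(1,2)}` lies between `(1 - ε) ‖α‖²` and `(1 + ε) ‖α‖²`. -/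
def NearlyOrthonormal {n : ℕ} (s : Sampling) (q : ℝ) (Θ : Matrix (Fin n) (Fin n) ℝ)
    (C : Finset RootedTemplate) (ε : ℝ) : Prop :=
  ∀ (α₀ : ℝ) (α : RootedTemplate → ℝ),
    (1 - ε) * (α₀ ^ 2 + ∑ G ∈ C, α G ^ 2) ≤
        expect s q Θ (fun _ A => (α₀ + ∑ G ∈ C, α G * G.psi s q Θ A) ^ 2) ∧
      expect s q Θ (fun _ A => (α₀ + ∑ G ∈ C, α G * G.psi s q Θ A) ^ 2) ≤
        (1 + ε) * (α₀ ^ 2 + ∑ G ∈ C, α G ^ 2)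

end LatentGraph

end

/-! After orbit counting, the basis element of a template is the normalized sum of the products
`normProd` over its labelled copies with the roots at the first two nodes. Inequivalent templates
have disjoint sets of copies, so the coefficient vector α becomes, isometrically, a vector β indexed
by the labelled graphs with at most `D` edges (`nearlyOrthonormal_of_regime`). It therefore suffices
that all the `normProd H`, without any symmetrization, are nearly orthonormal
(`abs_expect_sum_normProd_sq_sub_le`).

Correlations: for H ≠ H' with node sets V and V', the correlation is at most a constant times
ξ^|E_Δ| n^(-|V Δ V'|/2), where ξ is a negative power of `D`. The factors 1/√n have two sources. The
first is the signal: with A a power of `D`, a product of connection parameters over an edge set F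
has mean at most (Aλ)^|F| (Ak/n)^(rank F), the rank being nodes minus components (`lat_thProd_le`),
and the smallness of λk/√(nq) turns each unit of rank into a 1/√n. The second is centring: a
component of one graph that avoids the other graph is kept centred and yields 1/√n up to powers of
`D`, while the remaining centred factors are expanded. The two sources suffice because |V Δ V'| ≤
rank(H Δ H') + number of such components (`card_symmDiff_support_le`).

Gain from centring: under independent sampling a term with such a component vanishes. Under
permutation sampling the blocks interact only through injectivity. Each mean is realized by a fresh
copy of its block; exchanging copies turns the product of differences into an alternating sum of
injectivity indicators, which is zero unless every block collides with another one (`decoupling`,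
`abs_sum_blockSwap_le`). For r blocks this takes at least r/2 collisions, each of probability of
order 1/n. Collisions also merge nodes and may lower the rank, but a count of components shows that
this loss is paid for by the collisions (`grank_add_card_le_of_touched`, `pow_grank_le`).

Summation: a Schur test with weights √n^|V| replaces n^(-|V Δ V'|/2) by n^(-|V' \ V|), which cancels
the choices of the new nodes. The edge sets E_Δ with m edges then cost (8D)^(2m), and ξ^m beats
this. -/

open scoped symmDiff

noncomputable section

namespace LatentGraph

/-! ### Rank of a graph in its graphic matroid. -/

section Rank

open SimpleGraph

variable {V W : Type*}

/-- The span of the differences of endpoints of the edges of a graph. -/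
def boundarySpace (G : SimpleGraph V) : Submodule ℝ (V →₀ ℝ) :=
  Submodule.span ℝ {x | ∃ u v, G.Adj u v ∧ x = Finsupp.single u 1 - Finsupp.single v 1}

/-- The rank of a graph in its graphic matroid: the number of nodes minus the number of connected
components. -/
def grank (G : SimpleGraph V) : ℕ := Module.finrank ℝ (boundarySpace G)

lemma boundarySpace_of_reachable {G : SimpleGraph V} {u v : V} (h : G.Reachable u v) :
    (Finsupp.single u 1 - Finsupp.single v 1 : V →₀ ℝ) ∈ boundarySpace G := by
  obtain ⟨p⟩ := h
  induction p with
  | nil => simp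
  | cons h p ih =>
    have := Submodule.add_mem (boundarySpace G) (Submodule.subset_span ⟨_, _, h, rfl⟩) ih
    rwa [sub_add_sub_cancel] at this

/-- Pushing a vector to chosen representatives of the components changes it by an element of the
boundary space, and a vector whose component sums vanish is pushed to zero. Rank-nullity then gives
`grank_add_card`. -/
lemma boundarySpace_eq_ker (G : SimpleGraph V) :
    boundarySpace G = LinearMap.ker (Finsupp.lmapDomain ℝ ℝ G.connectedComponentMk) := by
  apply le_antisymm
  · refine Submodule.span_le.2 ?_
    rintro x ⟨u, v, h, rfl⟩
    have : G.connectedComponentMk u = G.connectedComponentMk v :=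
      ConnectedComponent.sound h.reachable
    rw [SetLike.mem_coe, LinearMap.mem_ker, map_sub, Finsupp.lmapDomain_apply,
      Finsupp.lmapDomain_apply, Finsupp.mapDomain_single, Finsupp.mapDomain_single, this, sub_self]
  · intro x hx
    have hs : ∀ x : V →₀ ℝ, x - Finsupp.mapDomain (fun v => (G.connectedComponentMk v).out) x
        ∈ boundarySpace G := by
      intro x
      induction x using Finsupp.induction_linear with
      | zero => simp
      | add f g hf hg =>
        have := Submodule.add_mem _ hf hg
        rw [Finsupp.mapDomain_add]
        convert this using 1
        abel
      | single v r =>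
        have h : G.Reachable v (G.connectedComponentMk v).out :=
          ConnectedComponent.exact (Quot.out_eq (G.connectedComponentMk v)).symm
        have := Submodule.smul_mem _ r (boundarySpace_of_reachable h)
        simpa [smul_sub, Finsupp.mapDomain_single] using this
    have h0 : Finsupp.mapDomain (fun v => (G.connectedComponentMk v).out) x = 0 := by
      have h1 : Finsupp.mapDomain G.connectedComponentMk x = 0 := hx
      have := Finsupp.mapDomain_comp (f := G.connectedComponentMk) (g := fun c => c.out) (v := x)
      rw [h1, Finsupp.mapDomain_zero] at this
      exact this
    have := hs x
    rwa [h0, sub_zero] at this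

lemma grank_add_card [Fintype V] (G : SimpleGraph V) :
    grank G + Nat.card G.ConnectedComponent = Fintype.card V := by
  have hsurj : Function.Surjective (Finsupp.lmapDomain ℝ ℝ G.connectedComponentMk) :=
    Finsupp.mapDomain_surjective Quot.mk_surjective
  have : Finite G.ConnectedComponent := Finite.of_surjective _ Quot.mk_surjective
  have : Fintype G.ConnectedComponent := Fintype.ofFinite _
  have h := LinearMap.finrank_range_add_finrank_ker (Finsupp.lmapDomain ℝ ℝ G.connectedComponentMk)
  rw [LinearMap.range_eq_top.2 hsurj, finrank_top, ← boundarySpace_eq_ker,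
    Module.finrank_finsupp_self, Module.finrank_finsupp_self] at h
  rw [grank, Nat.card_eq_fintype_card]
  omega

lemma grank_mono [Finite V] {G H : SimpleGraph V} (h : G ≤ H) : grank G ≤ grank H := by
  refine Submodule.finrank_mono (Submodule.span_mono ?_)
  rintro x ⟨u, v, huv, rfl⟩
  exact ⟨u, v, h huv, rfl⟩

lemma grank_sup_le [Finite V] (G H : SimpleGraph V) : grank (G ⊔ H) ≤ grank G + grank H := by
  refine le_trans (Submodule.finrank_mono ?_) (Submodule.finrank_add_le_finrank_add_finrank _ _)
  refine Submodule.span_le.2 ?_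
  rintro x ⟨u, v, huv | huv, rfl⟩
  · exact Submodule.mem_sup_left (Submodule.subset_span ⟨u, v, huv, rfl⟩)
  · exact Submodule.mem_sup_right (Submodule.subset_span ⟨u, v, huv, rfl⟩)

lemma grank_map_le [Finite V] [Finite W] (f : V → W) (G : SimpleGraph V) :
    grank (G.map f) ≤ grank G := by
  refine le_trans (Submodule.finrank_mono ?_)
    (Submodule.finrank_map_le (Finsupp.lmapDomain ℝ ℝ f) (boundarySpace G))
  refine Submodule.span_le.2 ?_
  rintro x ⟨u, v, h, rfl⟩
  rw [SimpleGraph.map_adj'] at h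
  obtain ⟨-, a, b, hab, rfl, rfl⟩ := h
  exact ⟨_, Submodule.subset_span ⟨a, b, hab, rfl⟩, by
    rw [map_sub, Finsupp.lmapDomain_apply, Finsupp.lmapDomain_apply, Finsupp.mapDomain_single,
      Finsupp.mapDomain_single]⟩

/-- The graph with edge set `F`, loops discarded. -/
abbrev edgeGraph (F : Finset (Sym2 V)) : SimpleGraph V := SimpleGraph.fromEdgeSet (F : Set (Sym2 V))

lemma grank_edgeGraph_le_card [Finite V] (F : Finset (Sym2 V)) : grank (edgeGraph F) ≤ F.card := by
  classical
  have h : boundarySpace (edgeGraph F) ≤ Submodule.span ℝ (F.image fun e : Sym2 V =>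
      (Finsupp.single e.out.1 1 - Finsupp.single e.out.2 1 : V →₀ ℝ) : Finset (V →₀ ℝ)) := by
    refine Submodule.span_le.2 ?_
    rintro x ⟨u, v, huv, rfl⟩
    have he : s(u, v) ∈ F := by simpa using huv.1
    have h2 : s((s(u, v) : Sym2 V).out.1, (s(u, v) : Sym2 V).out.2) = s(u, v) := Quot.out_eq _
    have hm : (Finsupp.single (s(u, v) : Sym2 V).out.1 1 -
        Finsupp.single (s(u, v) : Sym2 V).out.2 1 : V →₀ ℝ) ∈ Submodule.span ℝ
          (F.image fun e : Sym2 V =>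
      (Finsupp.single e.out.1 1 - Finsupp.single e.out.2 1 : V →₀ ℝ) : Set (V →₀ ℝ)) :=
      Submodule.subset_span (by
        rw [Finset.mem_coe]
        exact Finset.mem_image_of_mem (fun e : Sym2 V =>
          (Finsupp.single e.out.1 1 - Finsupp.single e.out.2 1 : V →₀ ℝ)) he)
    rcases Sym2.eq_iff.1 h2 with ⟨h3, h4⟩ | ⟨h3, h4⟩
    · rw [h3, h4] at hm; exact hm
    · rw [h3, h4] at hm
      have := Submodule.neg_mem _ hm
      rwa [neg_sub] at this
  exact (Submodule.finrank_mono h).trans ((finrank_span_finset_le_card _).trans Finset.card_image_le)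

/-- Count fibre by fibre: a fibre that contains some `c i` has at least two points, and at least as
many points as marked ones. -/
lemma card_image_add_card_le {X Y ι : Type*} [Fintype X] [DecidableEq Y] [Fintype ι] (f : X → Y)
    (c : ι → X) (hc : Function.Injective c) (h : ∀ i, ∃ x, x ≠ c i ∧ f x = f (c i)) :
    2 * (Finset.univ.image f).card + Fintype.card ι ≤ 2 * Fintype.card X := by
  classical
  have h1 : Fintype.card X = ∑ y ∈ Finset.univ.image f, (Finset.univ.filter fun x => f x = y).card :=
    Finset.card_eq_sum_card_image f Finset.univ
  have h2 : Fintype.card ι = ∑ y ∈ Finset.univ.image f,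
      ((Finset.univ.image c).filter fun x => f x = y).card := by
    rw [← Finset.card_univ, ← Finset.card_image_of_injective _ hc]
    exact Finset.card_eq_sum_card_fiberwise fun x _ => Finset.mem_image_of_mem f (Finset.mem_univ x)
  rw [h1, h2, Finset.mul_sum, mul_comm, ← smul_eq_mul, ← Finset.sum_const, ← Finset.sum_add_distrib]
  refine Finset.sum_le_sum fun y hy => ?_
  have hsub : ((Finset.univ.image c).filter fun x => f x = y) ⊆
      (Finset.univ.filter fun x => f x = y) :=
    Finset.filter_subset_filter _ (Finset.subset_univ _)
  rcases Finset.eq_empty_or_nonempty ((Finset.univ.image c).filter fun x => f x = y) with h0 | ⟨x, hx⟩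
  · obtain ⟨x, -, hx⟩ := Finset.mem_image.1 hy
    have : 0 < (Finset.univ.filter fun x => f x = y).card :=
      Finset.card_pos.2 ⟨x, by simpa using hx⟩
    rw [h0, Finset.card_empty]
    omega
  · simp only [Finset.mem_filter, Finset.mem_image, Finset.mem_univ, true_and] at hx
    obtain ⟨⟨i, rfl⟩, hy'⟩ := hx
    obtain ⟨x', hne, hx'⟩ := h i
    have : 1 < (Finset.univ.filter fun x => f x = y).card :=
      Finset.one_lt_card.2 ⟨x', by simp [hx', hy'], c i, by simp [hy'], hne⟩
    have := Finset.card_le_card hsub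
    omega

/-- Merging nodes of a graph lowers its rank by at most the number of merged nodes; if nodes of
several components are merged, by less. -/
lemma grank_add_card_le_grank_map [Fintype V] [Fintype W] [DecidableEq W] {ι : Type*} [Fintype ι]
    (G : SimpleGraph V) (f : V → W) (c : ι → V)
    (hc : ∀ i j, G.Reachable (c i) (c j) → i = j)
    (h : ∀ i, ∃ v, ¬ G.Reachable v (c i) ∧ f v = f (c i)) :
    2 * grank G + Fintype.card ι + 2 * (Finset.univ.image f).card ≤
      2 * grank (G.map f) + 2 * Fintype.card V := by
  classical
  have : Finite G.ConnectedComponent := Finite.of_surjective _ Quot.mk_surjective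
  have : Fintype G.ConnectedComponent := Fintype.ofFinite _
  have : Finite (G.map f).ConnectedComponent := Finite.of_surjective _ Quot.mk_surjective
  have : Fintype (G.map f).ConnectedComponent := Fintype.ofFinite _
  have hreach : ∀ u v, G.Reachable u v → (G.map f).Reachable (f u) (f v) := by
    rintro u v ⟨p⟩
    induction p with
    | nil => exact Reachable.refl _
    | @cons a b _ h p ih =>
      refine Reachable.trans ?_ ih
      by_cases hab : f a = f b
      · rw [hab]
      · exact Adj.reachable ((SimpleGraph.map_adj' ..).2 ⟨hab, a, b, h, rfl, rfl⟩)
  let Φ : G.ConnectedComponent → (G.map f).ConnectedComponent :=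
    ConnectedComponent.lift (fun v => (G.map f).connectedComponentMk (f v))
      fun u v p _ => ConnectedComponent.sound (hreach u v p.reachable)
  have h1 := card_image_add_card_le Φ (fun i => G.connectedComponentMk (c i))
    (fun i j hij => hc i j (ConnectedComponent.exact hij)) (fun i => by
      obtain ⟨v, hv, hfv⟩ := h i
      refine ⟨G.connectedComponentMk v, fun he => hv (ConnectedComponent.exact he), ?_⟩
      change (G.map f).connectedComponentMk (f v) = (G.map f).connectedComponentMk (f (c i))
      rw [hfv])
  -- A component of the image graph is either hit by `Φ` or is the component of a vertex outside the
  -- range of `f`.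
  have h2 : Fintype.card (G.map f).ConnectedComponent ≤
      (Finset.univ.image Φ).card + (Fintype.card W - (Finset.univ.image f).card) := by
    rw [← Finset.card_univ, ← Finset.card_compl]
    refine le_trans (Finset.card_le_card (t := Finset.univ.image Φ ∪
      ((Finset.univ.image f)ᶜ).image (G.map f).connectedComponentMk) ?_)
      ((Finset.card_union_le _ _).trans (Nat.add_le_add_left Finset.card_image_le _))
    intro y _
    induction y using ConnectedComponent.ind with
    | h w =>
      by_cases hw : w ∈ Finset.univ.image f
      · obtain ⟨v, -, rfl⟩ := Finset.mem_image.1 hw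
        exact Finset.mem_union_left _ (Finset.mem_image.2 ⟨G.connectedComponentMk v, by simp, rfl⟩)
      · exact Finset.mem_union_right _ (Finset.mem_image_of_mem _ (by simpa using hw))
  have h3 := grank_add_card G
  have h4 := grank_add_card (G.map f)
  rw [Nat.card_eq_fintype_card] at h3 h4
  have h5 : (Finset.univ.image f).card ≤ Fintype.card W := Finset.card_le_univ _
  omega

end Rank

/-! ### Conditional moments of edge products given the latent assignment. -/

section Moments

variable {n : ℕ}

/-- Expectation of a function of the latent assignment. -/
def lat (s : Sampling) (f : (Fin n → Fin n) → ℝ) : ℝ := ∑ z, latentProb s z * f z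

/-- Conditional expectation of a function of the graph given the latent assignment. -/
def condE (q : ℝ) (Θ : Matrix (Fin n) (Fin n) ℝ) (z : Fin n → Fin n)
    (X : SimpleGraph (Fin n) → ℝ) : ℝ := by
  classical exact ∑ A, graphProb q Θ z A * X A

lemma expect_eq_lat (s : Sampling) (q : ℝ) (Θ : Matrix (Fin n) (Fin n) ℝ)
    (f : (Fin n → Fin n) → SimpleGraph (Fin n) → ℝ) :
    expect s q Θ f = lat s fun z => condE q Θ z (f z) := by
  simp only [expect, lat, condE, Finset.mul_sum, mul_assoc]

lemma lat_permutation (f : (Fin n → Fin n) → ℝ) :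
    lat .permutation f = 1 / (n.factorial : ℝ) * ∑ σ : Equiv.Perm (Fin n), f σ := by
  classical
  have h : ∀ z : Fin n → Fin n, latentProb .permutation z * f z =
      if Function.Bijective z then 1 / (n.factorial : ℝ) * f z else 0 := by
    intro z
    simp only [latentProb]
    split_ifs <;> simp
  simp only [lat, h]
  rw [← Finset.sum_filter, Finset.mul_sum]
  symm
  refine Finset.sum_bij (fun σ _ => (σ : Fin n → Fin n)) ?_ ?_ ?_ ?_
  · intro σ _; exact Finset.mem_filter.2 ⟨Finset.mem_univ _, σ.bijective⟩
  · intro σ _ τ _ h; exact Equiv.coe_fn_injective h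
  · intro z hz
    exact ⟨Equiv.ofBijective z (by simpa using hz), Finset.mem_univ _, rfl⟩
  · intro σ _; rfl

lemma lat_independent (f : (Fin n → Fin n) → ℝ) :
    lat .independent f = 1 / (n : ℝ) ^ n * ∑ z, f z := by
  simp only [lat, latentProb, Finset.mul_sum]

lemma latentProb_nonneg (s : Sampling) (z : Fin n → Fin n) : 0 ≤ latentProb s z := by
  cases s <;> simp only [latentProb]
  · positivity
  · split_ifs <;> positivity

lemma lat_one (hn : n ≠ 0) (s : Sampling) : lat (n := n) s (fun _ => 1) = 1 := by
  cases s
  · rw [lat_independent]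
    have : (n : ℝ) ≠ 0 := by exact_mod_cast hn
    simp [this]
  · rw [lat_permutation]
    have : (n.factorial : ℝ) ≠ 0 := by exact_mod_cast n.factorial_ne_zero
    simp [Fintype.card_perm, this]

lemma lat_mono (s : Sampling) {f g : (Fin n → Fin n) → ℝ} (h : ∀ z, f z ≤ g z) :
    lat s f ≤ lat s g :=
  Finset.sum_le_sum fun z _ => mul_le_mul_of_nonneg_left (h z) (latentProb_nonneg s z)

lemma lat_nonneg (s : Sampling) {f : (Fin n → Fin n) → ℝ} (h : ∀ z, 0 ≤ f z) : 0 ≤ lat s f :=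
  Finset.sum_nonneg fun z _ => mul_nonneg (latentProb_nonneg s z) (h z)

lemma lat_const_mul (s : Sampling) (c : ℝ) (f : (Fin n → Fin n) → ℝ) :
    lat s (fun z => c * f z) = c * lat s f := by
  simp only [lat, Finset.mul_sum]
  exact Finset.sum_congr rfl fun z _ => by ring

lemma lat_sum {ι : Type*} (s : Sampling) (S : Finset ι) (f : ι → (Fin n → Fin n) → ℝ) :
    lat s (fun z => ∑ i ∈ S, f i z) = ∑ i ∈ S, lat s (f i) := by
  simp only [lat, Finset.mul_sum]
  exact Finset.sum_comm

lemma condE_sum {ι : Type*} (q : ℝ) (Θ : Matrix (Fin n) (Fin n) ℝ) (z : Fin n → Fin n)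
    (S : Finset ι) (f : ι → SimpleGraph (Fin n) → ℝ) :
    condE q Θ z (fun A => ∑ i ∈ S, f i A) = ∑ i ∈ S, condE q Θ z (f i) := by
  simp only [condE, Finset.mul_sum]
  exact Finset.sum_comm

lemma condE_const_mul (q : ℝ) (Θ : Matrix (Fin n) (Fin n) ℝ) (z : Fin n → Fin n) (c : ℝ)
    (f : SimpleGraph (Fin n) → ℝ) : condE q Θ z (fun A => c * f A) = c * condE q Θ z f := by
  simp only [condE, Finset.mul_sum]
  exact Finset.sum_congr rfl fun z _ => by ring

lemma condE_sub (q : ℝ) (Θ : Matrix (Fin n) (Fin n) ℝ) (z : Fin n → Fin n)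
    (f g : SimpleGraph (Fin n) → ℝ) :
    condE q Θ z (fun A => f A - g A) = condE q Θ z f - condE q Θ z g := by
  simp only [condE, mul_sub, Finset.sum_sub_distrib]

/-- The value of a symmetric matrix at an unordered pair. -/
def symVal (Θ : Matrix (Fin n) (Fin n) ℝ) (e : Sym2 (Fin n)) : ℝ := Θ e.out.1 e.out.2

lemma symVal_mk {Θ : Matrix (Fin n) (Fin n) ℝ} (hΘ : Θ.IsSymm) (a b : Fin n) :
    symVal Θ s(a, b) = Θ a b := by
  have h2 : s((s(a, b) : Sym2 (Fin n)).out.1, (s(a, b) : Sym2 (Fin n)).out.2) = s(a, b) :=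
    Quot.out_eq _
  rw [symVal]
  rcases Sym2.eq_iff.1 h2 with ⟨h3, h4⟩ | ⟨h3, h4⟩
  · rw [h3, h4]
  · rw [h3, h4, hΘ.apply]

/-- The product of the connection parameters over a set of edges. -/
def thProd (Θ : Matrix (Fin n) (Fin n) ℝ) (F : Finset (Sym2 (Fin n))) (z : Fin n → Fin n) : ℝ :=
  ∏ e ∈ F, symVal Θ (e.map z)

/-- The set of all possible edges. -/
def allEdges (n : ℕ) : Finset (Sym2 (Fin n)) := Finset.univ.filter fun e => ¬ e.IsDiag

lemma sum_graph_eq_sum_powerset (f : Finset (Sym2 (Fin n)) → ℝ) [Fintype (SimpleGraph (Fin n))]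
    [∀ A : SimpleGraph (Fin n), Fintype A.edgeSet] :
    ∑ A : SimpleGraph (Fin n), f A.edgeFinset = ∑ t ∈ (allEdges n).powerset, f t := by
  classical
  refine Finset.sum_bij (fun A _ => A.edgeFinset) ?_ ?_ ?_ ?_
  · intro A _
    rw [Finset.mem_powerset]
    intro e he
    simp only [allEdges, Finset.mem_filter, Finset.mem_univ, true_and]
    exact A.not_isDiag_of_mem_edgeSet (by simpa using he)
  · intro A _ B _ h
    exact SimpleGraph.edgeFinset_inj.1 h
  · intro t ht
    refine ⟨SimpleGraph.fromEdgeSet (t : Set (Sym2 (Fin n))), Finset.mem_univ _, ?_⟩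
    ext e
    simp only [SimpleGraph.mem_edgeFinset, SimpleGraph.edgeSet_fromEdgeSet, Set.mem_sdiff,
      Finset.mem_coe]
    have := Finset.mem_powerset.1 ht
    constructor
    · exact fun h => h.1
    · intro h
      exact ⟨h, by simpa [allEdges] using this h⟩
  · intro A _; rfl

open scoped Classical in
lemma graphProb_eq_prod {Θ : Matrix (Fin n) (Fin n) ℝ} (hΘ : Θ.IsSymm) (q : ℝ)
    (z : Fin n → Fin n) (A : SimpleGraph (Fin n)) :
    graphProb q Θ z A = ∏ e ∈ allEdges n,
      if e ∈ A.edgeFinset then q + symVal Θ (e.map z) else 1 - (q + symVal Θ (e.map z)) := by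
  rw [graphProb]
  refine Finset.prod_bij (fun p _ => s(p.1, p.2)) ?_ ?_ ?_ ?_
  · intro p hp
    have : p.1 < p.2 := by simpa using hp
    simp [allEdges, this.ne]
  · intro p hp p' hp' h
    have h1 : p.1 < p.2 := by simpa using hp
    have h2 : p'.1 < p'.2 := by simpa using hp'
    rcases Sym2.eq_iff.1 h with ⟨h3, h4⟩ | ⟨h3, h4⟩
    · exact Prod.ext h3 h4
    · rw [h3, h4] at h1
      exact absurd h1 h2.asymm
  · intro e he
    induction e using Sym2.ind with
    | _ a b =>
      have hab : a ≠ b := by simpa [allEdges] using he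
      rcases lt_or_gt_of_ne hab with h | h
      · exact ⟨(a, b), by simpa using h, rfl⟩
      · exact ⟨(b, a), by simpa using h, Sym2.eq_swap⟩
  · intro p hp
    simp [symVal_mk hΘ]

-- Edges are independent given `z`. Expanding the product of sums, each choice of a subset of edges
-- is the edge set of exactly one graph.
open scoped Classical in
lemma condE_prod {Θ : Matrix (Fin n) (Fin n) ℝ} (hΘ : Θ.IsSymm) (q : ℝ) (z : Fin n → Fin n)
    (u v : Sym2 (Fin n) → ℝ) :
    condE q Θ z (fun A => ∏ e ∈ allEdges n, if e ∈ A.edgeFinset then u e else v e) =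
      ∏ e ∈ allEdges n, ((q + symVal Θ (e.map z)) * u e + (1 - (q + symVal Θ (e.map z))) * v e) := by
  simp only [condE, graphProb_eq_prod hΘ, ← Finset.prod_mul_distrib]
  rw [Finset.prod_add]
  rw [← sum_graph_eq_sum_powerset (fun t => (∏ i ∈ t, (q + symVal Θ (Sym2.map z i)) * u i) *
    ∏ i ∈ allEdges n \ t, (1 - (q + symVal Θ (Sym2.map z i))) * v i)]
  refine Finset.sum_congr rfl fun A _ => ?_
  have hsub : A.edgeFinset ⊆ allEdges n := by
    intro e he
    simp only [allEdges, Finset.mem_filter, Finset.mem_univ, true_and]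
    exact A.not_isDiag_of_mem_edgeSet (by simpa using he)
  rw [← Finset.prod_sdiff hsub, mul_comm]
  congr 1
  · exact Finset.prod_congr rfl fun e he => by simp only [if_pos he]
  · refine Finset.prod_congr rfl fun e he => ?_
    simp only [if_neg (Finset.mem_sdiff.1 he).2]

/-- The product of the centred adjacencies over a set of edges. -/
def edgeMonomial (q : ℝ) (F : Finset (Sym2 (Fin n))) (A : SimpleGraph (Fin n)) : ℝ :=
  ∏ e ∈ F, centeredAdj q A e

/-- The `j`-th moment of a Bernoulli variable of parameter `q + θ` centred at `q`. -/
def bernMoment (q : ℝ) (j : ℕ) (θ : ℝ) : ℝ := (q + θ) * (1 - q) ^ j + (1 - (q + θ)) * (-q) ^ j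

@[simp] lemma bernMoment_zero (q θ : ℝ) : bernMoment q 0 θ = 1 := by
  simp [bernMoment]

@[simp] lemma bernMoment_one (q θ : ℝ) : bernMoment q 1 θ = θ := by
  simp [bernMoment]; ring

lemma bernMoment_two (q θ : ℝ) : bernMoment q 2 θ = qBar q + (1 - 2 * q) * θ := by
  simp [bernMoment, qBar]; ring

open scoped Classical in
/-- The multiplicity of an edge in a family of sets of edges. -/
def edgeMult {ι : Type*} (T : ι → Finset (Sym2 (Fin n))) (J : Finset ι) (e : Sym2 (Fin n)) : ℕ :=
  (J.filter fun i => e ∈ T i).card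

lemma condE_prod_edgeMonomial {Θ : Matrix (Fin n) (Fin n) ℝ} (hΘ : Θ.IsSymm) (q : ℝ)
    (z : Fin n → Fin n) {ι : Type*} (T : ι → Finset (Sym2 (Fin n))) (J : Finset ι)
    (hT : ∀ i ∈ J, T i ⊆ allEdges n) :
    condE q Θ z (fun A => ∏ i ∈ J, edgeMonomial q (T i) A) =
      ∏ e ∈ allEdges n, bernMoment q (edgeMult T J e) (symVal Θ (e.map z)) := by
  classical
  simp only [bernMoment]
  rw [← condE_prod hΘ]
  congr 1
  funext A
  have h1 : ∀ i ∈ J, edgeMonomial q (T i) A =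
      ∏ e ∈ allEdges n, if e ∈ T i then centeredAdj q A e else 1 := by
    intro i hi
    rw [Finset.prod_ite_mem, Finset.inter_eq_right.2 (hT i hi), edgeMonomial]
  rw [Finset.prod_congr rfl h1, Finset.prod_comm]
  refine Finset.prod_congr rfl fun e _ => ?_
  rw [Finset.prod_ite, Finset.prod_const, Finset.prod_const_one, mul_one]
  simp only [centeredAdj, edgeMult, SimpleGraph.mem_edgeFinset]
  split_ifs <;> simp

/-- Each edge of `T l` occurs only once, so it contributes its conditional mean, the connection
parameter; all other edges keep their multiplicity. -/
lemma edgeMonomial_insert_edge {Θ : Matrix (Fin n) (Fin n) ℝ} (hΘ : Θ.IsSymm) (q : ℝ)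
    (z : Fin n → Fin n) {ι : Type*} [DecidableEq ι] (T : ι → Finset (Sym2 (Fin n))) (J : Finset ι)
    (hT : ∀ i, T i ⊆ allEdges n) (l : ι) (hd : ∀ i ∈ J, Disjoint (T l) (T i)) :
    condE q Θ z (fun A => ∏ i ∈ insert l J, edgeMonomial q (T i) A) =
      thProd Θ (T l) z * condE q Θ z (fun A => ∏ i ∈ J, edgeMonomial q (T i) A) := by
  classical
  rw [condE_prod_edgeMonomial hΘ q z T _ fun i _ => hT i,
    condE_prod_edgeMonomial hΘ q z T _ fun i _ => hT i]
  have h1 : thProd Θ (T l) z =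
      ∏ e ∈ allEdges n, if e ∈ T l then symVal Θ (e.map z) else 1 := by
    rw [Finset.prod_ite_mem, Finset.inter_eq_right.2 (hT l), thProd]
  rw [h1, ← Finset.prod_mul_distrib]
  refine Finset.prod_congr rfl fun e _ => ?_
  by_cases he : e ∈ T l
  · have h0 : (J.filter fun i => e ∈ T i) = ∅ := by
      refine Finset.filter_eq_empty_iff.2 fun i hi hei => ?_
      exact Finset.disjoint_left.1 (hd i hi) he hei
    simp [edgeMult, Finset.filter_insert, he, h0]
  · simp [edgeMult, Finset.filter_insert, he]

/-- Centred factors on edges that appear in no other factor are integrated separately. -/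
lemma condE_prod_sub {Θ : Matrix (Fin n) (Fin n) ℝ} (hΘ : Θ.IsSymm) (q : ℝ)
    (z : Fin n → Fin n) {ι : Type*} [DecidableEq ι] (T : ι → Finset (Sym2 (Fin n)))
    (hT : ∀ i, T i ⊆ allEdges n) (μ : ι → ℝ) (L J : Finset ι) (hLJ : Disjoint L J)
    (hd : ∀ l ∈ L, ∀ i ∈ L ∪ J, i ≠ l → Disjoint (T l) (T i)) :
    condE q Θ z (fun A => (∏ i ∈ J, edgeMonomial q (T i) A) *
        ∏ l ∈ L, (edgeMonomial q (T l) A - μ l)) =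
      condE q Θ z (fun A => ∏ i ∈ J, edgeMonomial q (T i) A) *
        ∏ l ∈ L, (thProd Θ (T l) z - μ l) := by
  classical
  induction L using Finset.induction_on generalizing J with
  | empty => simp
  | insert l L hl ih =>
    have hlJ : l ∉ J := Finset.disjoint_left.1 hLJ (Finset.mem_insert_self _ _)
    have hLJ' : Disjoint L J := hLJ.mono_left (Finset.subset_insert _ _)
    have e1 : ∀ A, (∏ i ∈ J, edgeMonomial q (T i) A) *
        ∏ l ∈ insert l L, (edgeMonomial q (T l) A - μ l) =
        (∏ i ∈ insert l J, edgeMonomial q (T i) A) * ∏ l ∈ L, (edgeMonomial q (T l) A - μ l) -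
        μ l * ((∏ i ∈ J, edgeMonomial q (T i) A) * ∏ l ∈ L, (edgeMonomial q (T l) A - μ l)) := by
      intro A
      rw [Finset.prod_insert hl, Finset.prod_insert hlJ]
      ring
    simp only [e1]
    rw [condE_sub, condE_const_mul, ih J hLJ', ih (insert l J),
      edgeMonomial_insert_edge hΘ q z T J hT l, Finset.prod_insert hl]
    · ring
    · intro i hi
      exact hd l (Finset.mem_insert_self _ _) i (Finset.mem_union_right _ hi)
        (fun h => hlJ (h ▸ hi))
    · rw [Finset.disjoint_insert_right]
      exact ⟨hl, hLJ'⟩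
    · intro m hm i hi hne
      refine hd m (Finset.mem_insert_of_mem hm) i ?_ hne
      simp only [Finset.mem_union, Finset.mem_insert] at hi ⊢
      tauto
    · intro m hm i hi hne
      refine hd m (Finset.mem_insert_of_mem hm) i ?_ hne
      simp only [Finset.mem_union, Finset.mem_insert] at hi ⊢
      tauto

lemma expect_edgeMonomial {Θ : Matrix (Fin n) (Fin n) ℝ} (hΘ : Θ.IsSymm) (s : Sampling) (q : ℝ)
    (F : Finset (Sym2 (Fin n))) (hF : F ⊆ allEdges n) :
    expect s q Θ (fun _ A => edgeMonomial q F A) = lat s (thProd Θ F) := by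
  rw [expect_eq_lat]
  congr 1
  funext z
  have h := edgeMonomial_insert_edge hΘ q z (fun _ : Unit => F) ∅ (fun _ => hF) () (by simp)
  have h0 := condE_prod_edgeMonomial hΘ q z (fun _ : Unit => F) ∅ (by simp)
  simp only [Finset.prod_singleton, insert_empty_eq, Finset.prod_empty] at h h0
  rw [h, h0]
  simp [edgeMult]

end Moments

/-! ### Moment bound for products of connection parameters. -/

section Star

variable {n : ℕ}

/-- The template of a set of edges: its graph, on the endpoints of the edges. -/
abbrev supportGraph (F : Finset (Sym2 (Fin n))) : SimpleGraph (edgeGraph F).support :=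
  (edgeGraph F).induce (edgeGraph F).support

lemma map_subtype_supportGraph (F : Finset (Sym2 (Fin n))) :
    (supportGraph F).map (Function.Embedding.subtype (· ∈ (edgeGraph F).support)) = edgeGraph F := by
  ext a b
  rw [SimpleGraph.map_adj]
  constructor
  · rintro ⟨u, v, h, rfl, rfl⟩
    exact h
  · intro h
    exact ⟨⟨a, b, h⟩, ⟨b, a, h.symm⟩, h, rfl, rfl⟩

lemma edgeSet_edgeGraph {F : Finset (Sym2 (Fin n))} (hF : F ⊆ allEdges n) :
    (edgeGraph F).edgeSet = F := by
  rw [SimpleGraph.edgeSet_fromEdgeSet]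
  refine sdiff_eq_left.2 (Set.disjoint_left.2 fun e he hd => ?_)
  have := hF he
  simp only [allEdges, Finset.mem_filter] at this
  exact this.2 hd

lemma ncard_edgeSet_supportGraph {F : Finset (Sym2 (Fin n))} (hF : F ⊆ allEdges n) :
    (supportGraph F).edgeSet.ncard = F.card := by
  rw [← Set.ncard_coe_finset, ← edgeSet_edgeGraph hF]
  conv_rhs => rw [← map_subtype_supportGraph F, SimpleGraph.edgeSet_map]
  rw [Set.ncard_image_of_injective _ (Function.Embedding.injective _)]

lemma isTemplate_supportGraph {D : ℕ} {F : Finset (Sym2 (Fin n))} (hF : F ⊆ allEdges n)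
    (h1 : 1 ≤ F.card) (hD : F.card ≤ D) : IsTemplate D (supportGraph F) := by
  refine ⟨?_, ?_, ?_⟩
  · rintro ⟨a, b, h⟩
    have h' : (edgeGraph F).Adj a b := h
    exact ⟨⟨b, a, h'.symm⟩, h'⟩
  · rwa [ncard_edgeSet_supportGraph hF]
  · rwa [ncard_edgeSet_supportGraph hF]

lemma monomial_eq_edgeMonomial {V : Type} [Fintype V] (q : ℝ) (G : SimpleGraph V) (π : V ↪ Fin n)
    (A : SimpleGraph (Fin n)) {F : Finset (Sym2 (Fin n))} (hF : (G.map π).edgeSet = F) :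
    monomial q G π A = edgeMonomial q F A := by
  classical
  have : F = G.edgeFinset.map π.sym2Map := by
    rw [← Finset.coe_inj, ← hF, Finset.coe_map, SimpleGraph.coe_edgeFinset, SimpleGraph.edgeSet_map]
  rw [monomial, edgeMonomial, this, Finset.prod_map]
  rfl

/-- The right side is the exponent of k/n in the conditions. This direction suffices: the base there
is at most 1, so the exponent may be lowered to the rank. -/
lemma grank_le_supportGraph (F : Finset (Sym2 (Fin n))) [Fintype (edgeGraph F).support] :
    grank (edgeGraph F) ≤ Fintype.card (edgeGraph F).support -
      Nat.card (supportGraph F).ConnectedComponent := by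
  have h := grank_add_card (supportGraph F)
  have h2 := grank_map_le (Function.Embedding.subtype (· ∈ (edgeGraph F).support)) (supportGraph F)
  rw [map_subtype_supportGraph] at h2
  omega

/-- The conditions bound the expectation of every product of at most `2 D` connection
parameters. -/
lemma lat_thProd_le {s : Sampling} {cm cv₁ cv₂ cv₃ cv₄ a q lam : ℝ} {D k : ℕ}
    {Θ : Matrix (Fin n) (Fin n) ℝ} (hΘ : Θ.IsSymm) (hn : n ≠ 0) (hD : 2 ≤ D) (hlam : 0 ≤ lam)
    (hm : CMoment s cm D k q lam Θ) (hv : CVariance s cv₁ cv₂ cv₃ cv₄ D k q lam Θ)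
    (hcv₂ : 0 ≤ cv₂) (ha : cm ≤ a) (ha' : cv₁ + cv₂ ≤ a)
    (hy : (D : ℝ) ^ a * ((k : ℝ) / n) ≤ 1) (F : Finset (Sym2 (Fin n))) (hF : F ⊆ allEdges n)
    (hFD : F.card ≤ 2 * D) :
    lat s (thProd Θ F) ≤
      ((D : ℝ) ^ a * lam) ^ F.card * ((D : ℝ) ^ a * ((k : ℝ) / n)) ^ grank (edgeGraph F) := by
  classical
  have hD2 : (2 : ℝ) ≤ D := by exact_mod_cast hD
  have hD1 : (1 : ℝ) ≤ D := by linarith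
  have hD0 : (0 : ℝ) < D := by linarith
  have hkn : (0 : ℝ) ≤ (k : ℝ) / n := by positivity
  have hpow : ∀ b, b ≤ a → (D : ℝ) ^ b ≤ (D : ℝ) ^ a := fun b hb =>
    Real.rpow_le_rpow_of_exponent_le hD1 hb
  have hcmp : ∀ b, b ≤ a → ∀ r, grank (edgeGraph F) ≤ r →
      ((D : ℝ) ^ b * ((k : ℝ) / n)) ^ r ≤
        ((D : ℝ) ^ a * ((k : ℝ) / n)) ^ grank (edgeGraph F) := by
    intro b hb r hr
    calc ((D : ℝ) ^ b * ((k : ℝ) / n)) ^ r ≤ ((D : ℝ) ^ a * ((k : ℝ) / n)) ^ r := by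
          gcongr
      _ ≤ _ := pow_le_pow_of_le_one (by positivity) hy hr
  rcases Nat.eq_zero_or_pos F.card with h0 | h1
  · rw [Finset.card_eq_zero] at h0
    subst h0
    have : (thProd Θ ∅ : (Fin n → Fin n) → ℝ) = fun _ => 1 := by funext z; simp [thProd]
    have h0 : grank (edgeGraph (∅ : Finset (Sym2 (Fin n)))) = 0 :=
      Nat.le_zero.1 (grank_edgeGraph_le_card ∅)
    rw [this, lat_one hn, h0]
    simp
  rcases le_or_gt F.card D with hle | hgt
  · have h := hm _ (supportGraph F) (isTemplate_supportGraph hF h1 hle)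
      (Function.Embedding.subtype (· ∈ (edgeGraph F).support))
    have he : ∀ A, monomial q (supportGraph F)
        (Function.Embedding.subtype (· ∈ (edgeGraph F).support)) A = edgeMonomial q F A :=
      fun A => monomial_eq_edgeMonomial q _ _ A
        (by rw [map_subtype_supportGraph, edgeSet_edgeGraph hF])
    simp only [he] at h
    rw [expect_edgeMonomial hΘ s q F hF, ncard_edgeSet_supportGraph hF] at h
    refine (le_abs_self _).trans (h.trans ?_)
    gcongr ?_ * ?_
    · gcongr
    · exact hcmp _ ha _ (grank_le_supportGraph F)
  -- More than `D` edges: cut `F` into two edge-disjoint templates of at most `D` edges. Their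
  -- symmetric difference is `F` and their intersection is empty, so the covariance condition bounds
  -- the same expectation.
  · obtain ⟨F₁, hF₁, hc₁⟩ := Finset.exists_subset_card_eq hgt.le
    set F₂ := F \ F₁ with hF₂
    have hc₂ : F₂.card = F.card - D := by rw [hF₂, Finset.card_sdiff_of_subset hF₁, hc₁]
    have hs₁ : F₁ ⊆ allEdges n := hF₁.trans hF
    have hs₂ : F₂ ⊆ allEdges n := Finset.sdiff_subset.trans hF
    have hdisj : Disjoint F₁ F₂ := Finset.disjoint_sdiff
    have hun : F₁ ∪ F₂ = F := Finset.union_sdiff_of_subset hF₁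
    let π₁ := Function.Embedding.subtype (· ∈ (edgeGraph F₁).support)
    let π₂ := Function.Embedding.subtype (· ∈ (edgeGraph F₂).support)
    -- A perfect matching would make an edge of `F₁` also an edge of `F₂`.
    have hnp : ¬ IsPerfect (supportGraph F₁) (supportGraph F₂)
        {p : (edgeGraph F₁).support × (edgeGraph F₂).support | p.1.1 = p.2.1} := by
      rintro ⟨hp1, -, hp3⟩
      obtain ⟨e, he⟩ : F₁.Nonempty := Finset.card_pos.1 (by omega)
      induction e using Sym2.ind with
      | _ u v =>
        have huv : (edgeGraph F₁).Adj u v := by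
          rw [← SimpleGraph.mem_edgeSet, edgeSet_edgeGraph hs₁]; exact he
        obtain ⟨u', hu'⟩ := hp1 ⟨u, v, huv⟩
        obtain ⟨v', hv'⟩ := hp1 ⟨v, u, huv.symm⟩
        have h3 := (hp3 _ hu' _ hv').1 huv
        simp only [Set.mem_ofPred_eq] at hu' hv'
        have h4 : (edgeGraph F₂).Adj u'.1 v'.1 := h3
        rw [← hu', ← hv', ← SimpleGraph.mem_edgeSet, edgeSet_edgeGraph hs₂] at h4
        exact Finset.disjoint_left.1 hdisj he h4
    have h := hv.covariance _ _ (supportGraph F₁) (supportGraph F₂)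
      (isTemplate_supportGraph hs₁ (by omega) (by omega))
      (isTemplate_supportGraph hs₂ (by omega) (by omega)) {p | p.1.1 = p.2.1}
      (by
        rintro ⟨a1, a2⟩ ha ⟨b1, b2⟩ hb hab
        simp only [Set.mem_ofPred_eq] at ha hb hab
        rw [Prod.mk.injEq, Subtype.ext_iff, Subtype.ext_iff]
        rw [Subtype.ext_iff, Subtype.ext_iff] at hab
        rcases hab with h | h
        · exact ⟨h, ha ▸ hb ▸ h⟩
        · exact ⟨ha.trans (h.trans hb.symm), h⟩)
      hnp π₁ π₂ (fun v₁ v₂ => Iff.rfl)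
    have he : ∀ A, monomial q (supportGraph F₁) π₁ A * monomial q (supportGraph F₂) π₂ A =
        edgeMonomial q F A := by
      intro A
      rw [monomial_eq_edgeMonomial q _ _ A (F := F₁)
        (by rw [map_subtype_supportGraph, edgeSet_edgeGraph hs₁]),
        monomial_eq_edgeMonomial q _ _ A (F := F₂)
        (by rw [map_subtype_supportGraph, edgeSet_edgeGraph hs₂]), ← hun, edgeMonomial,
        edgeMonomial, edgeMonomial, Finset.prod_union hdisj]
    simp only [he] at h
    have hadj : ∀ (G : Finset (Sym2 (Fin n))) (u v : Fin n), G ⊆ allEdges n →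
        ((edgeGraph G).Adj u v ↔ s(u, v) ∈ G) := by
      intro G u v hG
      rw [← SimpleGraph.mem_edgeSet, edgeSet_edgeGraph hG]; rfl
    have hdiff : diffGraph (supportGraph F₁) π₁ (supportGraph F₂) π₂ = edgeGraph F := by
      rw [diffGraph, map_subtype_supportGraph, map_subtype_supportGraph]
      ext u v
      rw [hadj F u v hF, ← hun, Finset.mem_union, symmDiff_def]
      simp only [SimpleGraph.sup_adj, SimpleGraph.sdiff_adj, hadj F₁ u v hs₁, hadj F₂ u v hs₂]
      have h3 : s(u, v) ∈ F₁ → s(u, v) ∉ F₂ := fun h => Finset.disjoint_left.1 hdisj h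
      tauto
    have hint : interGraph (supportGraph F₁) π₁ (supportGraph F₂) π₂ = ⊥ := by
      rw [interGraph, map_subtype_supportGraph, map_subtype_supportGraph]
      ext u v
      simp only [SimpleGraph.inf_adj, hadj F₁ u v hs₁, hadj F₂ u v hs₂, SimpleGraph.bot_adj,
        iff_false]
      rintro ⟨h1, h2⟩
      exact Finset.disjoint_left.1 hdisj h1 h2
    rw [hdiff, hint, expect_edgeMonomial hΘ s q F hF] at h
    have hne : numEdges (edgeGraph F) = F.card := by
      rw [numEdges, edgeSet_edgeGraph hF, Set.ncard_coe_finset]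
    have hnb : numEdges (⊥ : SimpleGraph (Fin n)) = 0 := by simp [numEdges]
    rw [hne, hnb, pow_zero, mul_one] at h
    refine (le_abs_self _).trans (h.trans ?_)
    -- The constant `cv₂` is absorbed into the base of the edge factor, by x ≤ 2^x and `2 ≤ D`; as
    -- `F` has an edge, one power is enough. This is why `a` has to exceed `cv₁ + cv₂`.
    have hcv : cv₂ ≤ (D : ℝ) ^ cv₂ := by
      calc cv₂ ≤ (2 : ℝ) ^ cv₂ := by
            have h2 := one_add_mul_self_le_rpow_one_add (s := 1) (p := max cv₂ 1)
              (by norm_num) (le_max_right _ _)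
            rcases le_or_gt cv₂ 1 with hc | hc
            · exact hc.trans (Real.one_le_rpow (by norm_num) hcv₂)
            · rw [max_eq_left hc.le] at h2
              norm_num at h2
              linarith
        _ ≤ _ := Real.rpow_le_rpow (by norm_num) hD2 hcv₂
    have hE : cv₂ * ((D : ℝ) ^ cv₁ * lam) ^ F.card ≤ ((D : ℝ) ^ a * lam) ^ F.card := by
      calc cv₂ * ((D : ℝ) ^ cv₁ * lam) ^ F.card
          ≤ ((D : ℝ) ^ cv₂) ^ F.card * ((D : ℝ) ^ cv₁ * lam) ^ F.card := by
            gcongr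
            exact hcv.trans (le_self_pow₀ (Real.one_le_rpow hD1 hcv₂) (by omega))
        _ = ((D : ℝ) ^ (cv₁ + cv₂) * lam) ^ F.card := by
            rw [← mul_pow, Real.rpow_add hD0]; ring
        _ ≤ _ := by gcongr
    refine mul_le_mul hE (hcmp _ (by linarith) _ ?_) (by positivity) (by positivity)
    have := grank_le_supportGraph F
    rwa [← Nat.card_eq_fintype_card] at this

end Star

/-! ### Collisions of uniform functions, and the passage to uniform permutations. -/

section Collisions

open Finset

variable {n : ℕ}

/-- Resampling one coordinate preserves the uniform measure: exchanging the coordinate at `w` with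
an extra value is an involution. -/
lemma sum_sum_update {X : Type*} [Fintype X] [DecidableEq X] (w : X) (G : (X → Fin n) → ℝ) :
    ∑ ζ : X → Fin n, ∑ a : Fin n, G (Function.update ζ w a) = n * ∑ ζ, G ζ := by
  let e : (X → Fin n) × Fin n ≃ (X → Fin n) × Fin n :=
    { toFun := fun p => (Function.update p.1 w p.2, p.1 w)
      invFun := fun p => (Function.update p.1 w p.2, p.1 w)
      left_inv := fun p => by simp
      right_inv := fun p => by simp }
  have h := Equiv.sum_comp e fun p => G p.1
  rw [Fintype.sum_prod_type, Fintype.sum_prod_type] at h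
  rw [show ∑ ζ : X → Fin n, ∑ a : Fin n, G (Function.update ζ w a) =
    ∑ x : X → Fin n, ∑ y : Fin n, G (e (x, y)).1 from rfl, h]
  simp [mul_sum]

/-- Exponential moment of the number of collisions among the coordinates in `W` of a uniform
function. -/
lemma sum_pow_collisions_le {X : Type*} [Fintype X] [DecidableEq X] (hn : n ≠ 0) {Q : ℝ}
    (hQ : 1 ≤ Q) (W : Finset X) :
    ∑ ζ : X → Fin n, Q ^ (W.card - (W.image ζ).card) ≤
      (n : ℝ) ^ Fintype.card X * (1 + Q * W.card / n) ^ W.card := by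
  have hn0 : (0 : ℝ) < n := by exact_mod_cast Nat.pos_of_ne_zero hn
  -- The base must not change along the induction, so the cardinality inside it is replaced by a
  -- fixed upper bound `m`.
  suffices h : ∀ m : ℕ, W.card ≤ m →
      ∑ ζ : X → Fin n, Q ^ (W.card - (W.image ζ).card) ≤
      (n : ℝ) ^ Fintype.card X * (1 + Q * m / n) ^ W.card from h _ le_rfl
  intro m
  induction W using Finset.induction_on with
  | empty => simp
  | insert w W hw ih =>
    intro hm
    rw [card_insert_of_notMem hw] at hm ⊢
    have h1 : ∀ ζ : X → Fin n, ∑ a : Fin n,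
        Q ^ (W.card + 1 - ((insert w W).image (Function.update ζ w a)).card) ≤
        Q ^ (W.card - (W.image ζ).card) * (n + Q * m) := by
      intro ζ
      have himg : ∀ a, (insert w W).image (Function.update ζ w a) = insert a (W.image ζ) := by
        intro a
        rw [image_insert, Function.update_self]
        congr 1
        refine image_congr fun x hx => ?_
        exact Function.update_of_ne (ne_of_mem_of_not_mem (mem_coe.1 hx) hw) _ _
      have hle : (W.image ζ).card ≤ W.card := card_image_le
      -- The new coordinate either takes one of the at most `m` values already present, which adds a
      -- collision and a factor `Q`, or a new value, at no cost.
      have h2 : ∀ a, Q ^ (W.card + 1 - ((insert w W).image (Function.update ζ w a)).card) ≤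
          Q ^ (W.card - (W.image ζ).card) * (1 + if a ∈ W.image ζ then Q else 0) := by
        intro a
        rw [himg]
        split_ifs with ha
        · rw [insert_eq_of_mem ha, show W.card + 1 - (W.image ζ).card =
            W.card - (W.image ζ).card + 1 by omega, pow_succ]
          gcongr
          linarith
        · rw [card_insert_of_notMem ha, Nat.add_sub_add_right]
          simp
      refine (sum_le_sum fun a _ => h2 a).trans ?_
      rw [← mul_sum, sum_add_distrib, ← sum_filter]
      have h3 : (filter (fun a => a ∈ W.image ζ) univ).card ≤ m := by
        rw [filter_mem_eq_inter, univ_inter]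
        omega
      have h4 : ((filter (fun a => a ∈ W.image ζ) univ).card : ℝ) ≤ m := by exact_mod_cast h3
      have : (n : ℝ) + (filter (fun a => a ∈ W.image ζ) univ).card * Q ≤ n + Q * m := by
        nlinarith
      simp only [sum_const, card_univ, Fintype.card_fin, nsmul_eq_mul, mul_one]
      gcongr
    have h5 := sum_sum_update w fun ζ : X → Fin n =>
      Q ^ (W.card + 1 - ((insert w W).image ζ).card)
    have h6 : (n : ℝ) * ∑ ζ : X → Fin n, Q ^ (W.card + 1 - ((insert w W).image ζ).card) ≤
        (n : ℝ) * ((n : ℝ) ^ Fintype.card X * (1 + Q * m / n) ^ (W.card + 1)) := by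
      rw [← h5]
      refine (sum_le_sum fun ζ _ => h1 ζ).trans ?_
      rw [← sum_mul]
      have h7 : (n : ℝ) + Q * m = n * (1 + Q * m / n) := by field_simp
      rw [h7]
      have := ih (by omega)
      calc _ ≤ ((n : ℝ) ^ Fintype.card X * (1 + Q * m / n) ^ W.card) * (n * (1 + Q * m / n)) := by
            gcongr
        _ = _ := by ring
    exact le_of_mul_le_mul_left h6 hn0

/-- With base n/A and |W|² ≤ A, the bound of `sum_pow_collisions_le` is (1 + |W|/A)^|W| ≤ e ≤ 3.
Each collision may thus be charged A/n at the price of a constant. -/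
lemma sum_pow_collisions_le_three {X : Type*} [Fintype X] [DecidableEq X] {A : ℝ}
    (hA : 1 ≤ A) (hAn : A ≤ n) (W : Finset X) (hW : (W.card : ℝ) ^ 2 ≤ A) :
    ∑ ζ : X → Fin n, ((n : ℝ) / A) ^ (W.card - (W.image ζ).card) ≤
      (n : ℝ) ^ Fintype.card X * 3 := by
  have hn0 : (0 : ℝ) < n := by linarith
  have hA0 : (0 : ℝ) < A := by linarith
  have hn : n ≠ 0 := by rintro rfl; simp at hn0
  refine (sum_pow_collisions_le hn ((one_le_div hA0).2 hAn) W).trans ?_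
  gcongr
  have h1 : (n : ℝ) / A * W.card / n = W.card / A := by field_simp
  rw [h1]
  calc (1 + (W.card : ℝ) / A) ^ W.card ≤ (Real.exp (W.card / A)) ^ W.card := by
        gcongr
        rw [add_comm]
        exact Real.add_one_le_exp _
    _ = Real.exp (W.card ^ 2 / A) := by
        rw [← Real.exp_nat_mul]; congr 1; ring
    _ ≤ Real.exp 1 := Real.exp_le_exp.2 ((div_le_one hA0).2 hW)
    _ ≤ 3 := Real.exp_one_lt_three.le

/-- The number of functions that are injective on `B`. -/
def injCount (B : Finset (Fin n)) : ℝ := by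
  classical exact ∑ z : Fin n → Fin n, if Set.InjOn z B then 1 else 0

/-- Markov's inequality: a function that is not injective on `B` contributes at least n/A ≥ 6 to a
sum bounded by 3 n^n, so these functions are at most half of all. -/
lemma half_le_injCount {A : ℝ} (hA : 1 ≤ A) (hAn : 6 * A ≤ n) (B : Finset (Fin n))
    (hB : (B.card : ℝ) ^ 2 ≤ A) : (n : ℝ) ^ n / 2 ≤ injCount B := by
  classical
  have hA0 : (0 : ℝ) < A := by linarith
  have h := sum_pow_collisions_le_three (X := Fin n) hA (by linarith) B hB
  have h6 : 6 ≤ (n : ℝ) / A := by rw [le_div_iff₀ hA0]; exact hAn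
  have h1 : ∑ z : Fin n → Fin n, 6 * (1 - if Set.InjOn z (B : Set (Fin n)) then (1 : ℝ) else 0) ≤
      ∑ z : Fin n → Fin n, ((n : ℝ) / A) ^ (B.card - (B.image z).card) := by
    refine sum_le_sum fun z _ => ?_
    split_ifs with hz
    · simp only [sub_self, mul_zero]; positivity
    · have : (B.image z).card < B.card :=
        lt_of_le_of_ne card_image_le fun h => hz (card_image_iff.1 h)
      rw [sub_zero, mul_one]
      exact h6.trans (le_self_pow₀ (by linarith) (by omega))
  rw [← mul_sum, sum_sub_distrib] at h1
  simp only [sum_const, card_univ, Fintype.card_fin, Fintype.card_pi, prod_const, nsmul_eq_mul,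
    mul_one] at h1 h
  push_cast at h1
  have h2 : (6 : ℝ) * ((n : ℝ) ^ n - injCount B) ≤ (n : ℝ) ^ n * 3 := by
    rw [injCount]
    exact h1.trans h
  linarith

lemma sum_comp_perm {X : Type*} [Fintype X] [DecidableEq X] (τ : Equiv.Perm (Fin n))
    (G : (X → Fin n) → ℝ) : ∑ ζ : X → Fin n, G (τ ∘ ζ) = ∑ ζ, G ζ :=
  Equiv.sum_comp ((Equiv.refl X).arrowCongr τ) G

/-- The weight `I` sees only the pattern of coincidences, so the values may be shuffled by a uniform
permutation. This lets the moment bounds for permutations apply to a function with a prescribed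
collision pattern. -/
lemma sum_eq_lat_perm {X : Type*} [Fintype X] [DecidableEq X]
    (I : (X → Fin n) → ℝ) (hI : ∀ (τ : Equiv.Perm (Fin n)) ζ, I (τ ∘ ζ) = I ζ)
    (h : (X → Fin n) → ℝ) :
    ∑ ζ, I ζ * h ζ = ∑ ζ, I ζ * lat .permutation fun σ => h (σ ∘ ζ) := by
  have hf : (n.factorial : ℝ) ≠ 0 := by exact_mod_cast n.factorial_ne_zero
  have h1 : ∀ τ : Equiv.Perm (Fin n), ∑ ζ, I ζ * h ζ = ∑ ζ, I ζ * h (τ ∘ ζ) := by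
    intro τ
    rw [← sum_comp_perm τ]
    simp only [hI]
  have h2 : (n.factorial : ℝ) * ∑ ζ, I ζ * h ζ =
      ∑ τ : Equiv.Perm (Fin n), ∑ ζ, I ζ * h (τ ∘ ζ) := by
    rw [← sum_congr rfl fun τ _ => h1 τ]
    simp [Fintype.card_perm]
  simp only [lat_permutation]
  rw [sum_comm] at h2
  have h3 : ∑ ζ, I ζ * (1 / (n.factorial : ℝ) * ∑ σ : Equiv.Perm (Fin n), h (σ ∘ ζ)) =
      1 / (n.factorial : ℝ) * ∑ ζ, ∑ τ : Equiv.Perm (Fin n), I ζ * h (τ ∘ ζ) := by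
    rw [mul_sum]
    refine sum_congr rfl fun ζ _ => ?_
    rw [← mul_sum]
    ring
  rw [h3, ← h2]
  field_simp

open scoped Classical in
/-- The law of a uniform permutation on `B` is that of a uniform function conditioned to be
injective on `B`. -/
lemma sum_injOn_mul (B : Finset (Fin n)) (h : (Fin n → Fin n) → ℝ)
    (hB : ∀ z z', (∀ v ∈ B, z v = z' v) → h z = h z') :
    ∑ z : Fin n → Fin n, (if Set.InjOn z B then 1 else 0) * h z =
      injCount B * lat .permutation h := by
  rw [sum_eq_lat_perm (fun z : Fin n → Fin n => if Set.InjOn z B then (1 : ℝ) else 0), injCount,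
    sum_mul]
  · refine sum_congr rfl fun z _ => ?_
    split_ifs with hz
    · congr 1
      -- A function injective on `B` agrees there with a permutation `ρ`, which right multiplication
      -- absorbs into the uniform one.
      obtain ⟨g, hg⟩ := Finset.exists_equiv_extend_of_card_eq (α := Fin n) (t := Finset.univ)
        (by simp) (s := B) (f := z) (by simp) hz
      let ρ : Equiv.Perm (Fin n) := g.trans (Equiv.subtypeUnivEquiv (by simp))
      have hρ : ∀ v ∈ B, ρ v = z v := hg
      rw [lat_permutation, lat_permutation]
      congr 1
      rw [← Equiv.sum_comp (Equiv.mulRight ρ) fun σ : Equiv.Perm (Fin n) => h σ]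
      refine sum_congr rfl fun σ _ => hB _ _ fun v hv => ?_
      simp [hρ v hv]
    · simp
  · intro τ ζ
    have : Set.InjOn (τ ∘ ζ) (B : Set (Fin n)) ↔ Set.InjOn ζ (B : Set (Fin n)) :=
      ⟨fun h => Set.InjOn.of_comp h, fun h => τ.injective.comp_injOn h⟩
    simp only [this]

end Collisions

/-! ### Decoupling of centred block functions under a uniform permutation. -/

section Decoupling

open Finset

variable {n : ℕ} {ι : Type*} [DecidableEq ι]

/-- The block `o` if it is selected by `S`. -/
def activeBlock (S : Finset ι) (o : Option ι) : Option ι := o.filter (· ∈ S)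

@[simp] lemma activeBlock_none (S : Finset ι) : activeBlock S none = none := rfl

/-- The exchange of the two copies of the blocks selected by `S`. -/
def blockSwap (b : Fin n → Option ι) (S : Finset ι) (x : Option ι × Fin n) : Option ι × Fin n :=
  (Equiv.swap none (activeBlock S (b x.2)) x.1, x.2)

lemma activeBlock_some (S : Finset ι) (l : ι) :
    activeBlock S (some l) = if l ∈ S then some l else none := by
  simp [activeBlock, Option.filter]

lemma blockSwap_involutive (b : Fin n → Option ι) (S : Finset ι) :
    Function.Involutive (blockSwap b S) := fun x => by simp [blockSwap]

lemma blockSwap_symmDiff (b : Fin n → Option ι) (S : Finset ι) (l : ι) (x : Option ι × Fin n) :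
    blockSwap b (S ∆ {l}) x = blockSwap b S (blockSwap b {l} x) := by
  simp only [blockSwap]
  rcases hb : b x.2 with _ | m
  · simp
  · simp only [activeBlock_some, mem_symmDiff, mem_singleton]
    by_cases h1 : m = l
    · subst h1
      by_cases h2 : m ∈ S <;> simp [h2]
    · by_cases h2 : m ∈ S <;> simp [h1, h2]

/-- The coordinates in `B` and the fresh copies of the coordinates of the blocks. -/
def coords [Fintype ι] (B : Finset (Fin n)) (b : Fin n → Option ι) : Finset (Option ι × Fin n) :=
  univ.filter fun x => x.2 ∈ B ∧ (x.1 = none ∨ x.1 = b x.2)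

/-- Some coordinate of the block `l` collides with a coordinate of another block. -/
def Touched [Fintype ι] (B : Finset (Fin n)) (b : Fin n → Option ι) (ζ : Option ι × Fin n → Fin n)
    (l : ι) : Prop :=
  ∃ x ∈ coords B b, ∃ y ∈ coords B b, b x.2 = some l ∧ b y.2 ≠ some l ∧ ζ y = ζ x

/-- The assignment is injective on `B`, and the fresh copies are injective on their blocks. -/
def BlockInj (B : Finset (Fin n)) (b : Fin n → Option ι) (ζ : Option ι × Fin n → Fin n) : Prop :=
  Set.InjOn (fun v => ζ (none, v)) B ∧
    ∀ l, Set.InjOn (fun v => ζ (some l, v)) {v | b v = some l}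

lemma blockSwap_mem_coords [Fintype ι] (B : Finset (Fin n)) (b : Fin n → Option ι) (S : Finset ι)
    {x : Option ι × Fin n} (hx : x ∈ coords B b) : blockSwap b S x ∈ coords B b := by
  obtain ⟨o, v⟩ := x
  simp only [coords, mem_filter, mem_univ, true_and, blockSwap] at hx ⊢
  refine ⟨hx.1, ?_⟩
  rcases hb : b v with _ | m
  · rw [hb] at hx
    simpa using hx.2
  · rw [hb] at hx
    rw [activeBlock_some]
    by_cases hm : m ∈ S
    · rcases hx.2 with rfl | rfl <;> simp [hm]
    · simpa [hm] using hx.2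

/-- An exchange only permutes the copies of each node, so the nodes, and hence their blocks, are
unchanged. -/
lemma Touched.of_blockSwap [Fintype ι] {B : Finset (Fin n)} {b : Fin n → Option ι} {S : Finset ι}
    {ζ : Option ι × Fin n → Fin n} {l : ι} (h : Touched B b (ζ ∘ blockSwap b S) l) :
    Touched B b ζ l := by
  obtain ⟨x, hx, y, hy, h1, h2, h3⟩ := h
  exact ⟨_, blockSwap_mem_coords B b S hx, _, blockSwap_mem_coords B b S hy, h1, h2, h3⟩

/-- Inside the block `l`, both copies are injective and trade places. Across blocks, an untouched
`l` shares no value with any other block, so no collision can be created. -/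
lemma BlockInj.blockSwap_singleton [Fintype ι] {B : Finset (Fin n)} {b : Fin n → Option ι}
    (hb : ∀ v, b v ≠ none → v ∈ B) {ζ : Option ι × Fin n → Fin n} {l : ι} (hl : ¬ Touched B b ζ l)
    (h : BlockInj B b ζ) : BlockInj B b (ζ ∘ blockSwap b {l}) := by
  have hno : ∀ v w, v ∈ B → w ∈ B → b v = some l → b w ≠ some l → ζ (some l, v) ≠ ζ (none, w) := by
    intro v w hv hw hbv hbw he
    exact hl ⟨(some l, v), by simp [coords, hv, hbv], (none, w), by simp [coords, hw], hbv, hbw,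
      he.symm⟩
  have e1 : ∀ v, b v = some l → blockSwap b {l} (none, v) = (some l, v) := by
    intro v hv; simp [blockSwap, hv, activeBlock_some]
  have e2 : ∀ o v, b v ≠ some l → blockSwap b {l} (o, v) = (o, v) := by
    intro o v hv
    rcases hb : b v with _ | m
    · simp [blockSwap, hb]
    · have : m ≠ l := fun h => hv (by rw [hb, h])
      simp [blockSwap, hb, activeBlock_some, this]
  have e3 : ∀ v, b v = some l → blockSwap b {l} (some l, v) = (none, v) := by
    intro v hv; simp [blockSwap, hv, activeBlock_some]
  refine ⟨?_, ?_⟩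
  · intro v hv w hw hvw
    simp only [Function.comp] at hvw
    by_cases h1 : b v = some l <;> by_cases h2 : b w = some l
    · rw [e1 v h1, e1 w h2] at hvw
      exact h.2 l h1 h2 hvw
    · rw [e1 v h1, e2 _ w h2] at hvw
      exact absurd hvw (hno v w hv hw h1 h2)
    · rw [e2 _ v h1, e1 w h2] at hvw
      exact absurd hvw.symm (hno w v hw hv h2 h1)
    · rw [e2 _ v h1, e2 _ w h2] at hvw
      exact h.1 hv hw hvw
  · intro m v hv w hw hvw
    simp only [Function.comp] at hvw
    by_cases hm : m = l
    · subst hm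
      rw [e3 v hv, e3 w hw] at hvw
      have hv' : b v = some m := hv
      have hw' : b w = some m := hw
      exact h.1 (hb v (by simp [hv'])) (hb w (by simp [hw'])) hvw
    · have h1 : ∀ u ∈ {v | b v = some m}, b u ≠ some l := by
        intro u hu hu'
        have : b u = some m := hu
        rw [this] at hu'
        exact hm (Option.some_injective _ hu')
      rw [e2 _ v (h1 v hv), e2 _ w (h1 w hw)] at hvw
      exact h.2 m hv hw hvw

open scoped Classical in
/-- The alternating sum over the exchanges vanishes as soon as some block is untouched. -/
lemma sum_blockSwap_eq_zero [Fintype ι] {B : Finset (Fin n)} {b : Fin n → Option ι}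
    (hb : ∀ v, b v ≠ none → v ∈ B) {ζ : Option ι × Fin n → Fin n} {l : ι}
    (hl : ¬ Touched B b ζ l) :
    ∑ S ∈ (univ : Finset ι).powerset,
      (-1 : ℝ) ^ S.card * (if BlockInj B b (ζ ∘ blockSwap b S) then 1 else 0) = 0 := by
  have hiff : ∀ S : Finset ι, BlockInj B b (ζ ∘ blockSwap b (S ∆ {l})) ↔
      BlockInj B b (ζ ∘ blockSwap b S) := by
    have key : ∀ S : Finset ι, BlockInj B b (ζ ∘ blockSwap b S) →
        BlockInj B b (ζ ∘ blockSwap b (S ∆ {l})) := by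
      intro S h
      have := BlockInj.blockSwap_singleton hb (fun h' => hl h'.of_blockSwap) h
      have he : (ζ ∘ blockSwap b S) ∘ blockSwap b {l} = ζ ∘ blockSwap b (S ∆ {l}) := by
        funext x
        simp [blockSwap_symmDiff]
      rwa [he] at this
    intro S
    refine ⟨fun h => ?_, key S⟩
    have := key _ h
    rwa [symmDiff_symmDiff_cancel_right] at this
  have hcard : ∀ S : Finset ι, (-1 : ℝ) ^ (S ∆ {l}).card = - (-1 : ℝ) ^ S.card := by
    intro S
    by_cases h : l ∈ S
    · have : S ∆ {l} = S.erase l := by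
        ext x; simp only [mem_symmDiff, mem_singleton, mem_erase]
        constructor
        · rintro (⟨h1, h2⟩ | ⟨rfl, h2⟩)
          · exact ⟨h2, h1⟩
          · exact absurd h h2
        · rintro ⟨h1, h2⟩; exact Or.inl ⟨h2, h1⟩
      rw [this, ← insert_erase h, card_insert_of_notMem (notMem_erase l S), erase_insert_eq_erase,
        erase_idem, pow_succ]
      ring
    · have : S ∆ {l} = insert l S := by
        ext x; simp only [mem_symmDiff, mem_singleton, mem_insert]
        constructor
        · rintro (⟨h1, h2⟩ | ⟨rfl, h2⟩)
          · exact Or.inr h1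
          · exact Or.inl rfl
        · rintro (rfl | h1)
          · exact Or.inr ⟨rfl, h⟩
          · exact Or.inl ⟨h1, fun h2 => h (h2 ▸ h1)⟩
      rw [this, card_insert_of_notMem h, pow_succ]
      ring
  -- Toggling the untouched block `l` in `S` flips the sign and preserves the indicator.
  refine sum_involution (fun S _ => S ∆ {l}) ?_ ?_ ?_ ?_
  · intro S _
    rw [hcard, if_congr (hiff S) rfl rfl]
    ring
  · intro S _ _ h
    have := congrArg card h
    have h1 := hcard S
    rw [this] at h1
    have : (-1 : ℝ) ^ S.card ≠ 0 := pow_ne_zero _ (by norm_num)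
    apply this
    linarith
  · intro S _; simp
  · intro S _; exact symmDiff_symmDiff_cancel_right _ _

open scoped Classical in
lemma abs_sum_blockSwap_le [Fintype ι] {B : Finset (Fin n)} {b : Fin n → Option ι}
    (hb : ∀ v, b v ≠ none → v ∈ B) (ζ : Option ι × Fin n → Fin n) :
    |∑ S ∈ (univ : Finset ι).powerset,
      (-1 : ℝ) ^ S.card * (if BlockInj B b (ζ ∘ blockSwap b S) then 1 else 0)| ≤
      2 ^ Fintype.card ι * (if ∀ l, Touched B b ζ l then 1 else 0) := by
  split_ifs with h
  · refine (abs_sum_le_sum_abs _ _).trans ?_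
    refine (sum_le_card_nsmul _ _ 1 fun S _ => ?_).trans ?_
    · rw [abs_mul, abs_pow, abs_neg, abs_one, one_pow, one_mul]
      split_ifs <;> simp
    · simp
  · push Not at h
    obtain ⟨l, hl⟩ := h
    rw [sum_blockSwap_eq_zero hb hl]
    simp

open scoped Classical in
/-- The second-order decoupling identity for a product of centred functions of disjoint blocks of
a uniform permutation. -/
lemma decoupling [Fintype ι] {B : Finset (Fin n)} {b : Fin n → Option ι}
    (hb : ∀ v, b v ≠ none → v ∈ B) (g : (Fin n → Fin n) → ℝ) (f : ι → (Fin n → Fin n) → ℝ)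
    (hg : ∀ z z', (∀ v ∈ B, b v = none → z v = z' v) → g z = g z')
    (hf : ∀ l z z', (∀ v, b v = some l → z v = z' v) → f l z = f l z') :
    injCount B * (∏ l, injCount (univ.filter fun v => b v = some l)) *
        lat .permutation (fun z => g z * ∏ l, (f l z - lat .permutation (f l))) =
      ∑ ζ : Option ι × Fin n → Fin n,
        (g (fun v => ζ (none, v)) * ∏ l, f l (fun v => ζ (none, v))) *
        ∑ S ∈ (univ : Finset ι).powerset,
          (-1 : ℝ) ^ S.card * (if BlockInj B b (ζ ∘ blockSwap b S) then 1 else 0) := by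
  set c : ι → ℝ := fun l => injCount (univ.filter fun v => b v = some l) with hc
  -- The permutation mean of `f l` is its average over functions `z'` injective on the block, so
  -- centring amounts to a difference with a fresh copy.
  have hcl : ∀ l z, c l * (f l z - lat .permutation (f l)) = ∑ z' : Fin n → Fin n,
      (if Set.InjOn z' {v | b v = some l} then 1 else 0) * (f l z - f l z') := by
    intro l z
    have h1 := sum_injOn_mul (univ.filter fun v => b v = some l) (f l)
      (fun z z' h => hf l z z' fun v hv => h v (by simpa using hv))
    simp only [mul_sub, sum_sub_distrib, ← sum_mul]
    simp only [coe_filter, mem_univ, true_and] at h1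
    rw [h1]
    congr 2
    rw [hc]
    simp [injCount]
  have h2 := sum_injOn_mul B (fun z => g z * ∏ l, (f l z - lat .permutation (f l))) (by
    intro z z' h
    rw [hg z z' fun v hv _ => h v hv]
    congr 1
    refine prod_congr rfl fun l _ => ?_
    rw [hf l z z' fun v hv => h v (hb v (by simp [hv]))])
  rw [mul_right_comm, ← h2, sum_mul]
  have h3 : ∀ z : Fin n → Fin n, (if Set.InjOn z (B : Set (Fin n)) then (1 : ℝ) else 0) *
      (g z * ∏ l, (f l z - lat .permutation (f l))) * ∏ l, c l =
      ∑ Z : ι → Fin n → Fin n, (if Set.InjOn z (B : Set (Fin n)) then (1 : ℝ) else 0) * g z *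
        ∏ l, ((if Set.InjOn (Z l) {v | b v = some l} then 1 else 0) * (f l z - f l (Z l))) := by
    intro z
    rw [← mul_sum, ← Fintype.prod_sum fun l (z' : Fin n → Fin n) =>
      (if Set.InjOn z' {v | b v = some l} then (1 : ℝ) else 0) * (f l z - f l z')]
    simp only [← hcl]
    rw [prod_mul_distrib]
    ring
  rw [sum_congr rfl fun z _ => h3 z]
  -- The assignment and its fresh copies, one per block, are packed into a single function on
  -- `Option ι × Fin n`, the index `none` being the original.
  have h4 := Equiv.sum_comp ((Equiv.curry (Option ι) (Fin n) (Fin n)).trans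
    (Equiv.piOptionEquivProd (β := fun _ => Fin n → Fin n)))
    (fun p : (Fin n → Fin n) × (ι → Fin n → Fin n) =>
      (if Set.InjOn p.1 (B : Set (Fin n)) then (1 : ℝ) else 0) * g p.1 *
        ∏ l, ((if Set.InjOn (p.2 l) {v | b v = some l} then 1 else 0) * (f l p.1 - f l (p.2 l))))
  rw [Fintype.sum_prod_type] at h4
  rw [← h4]
  have h5 : ∀ ζ : Option ι × Fin n → Fin n,
      (if Set.InjOn (fun v => ζ (none, v)) (B : Set (Fin n)) then (1 : ℝ) else 0) *
        g (fun v => ζ (none, v)) *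
        ∏ l, ((if Set.InjOn (fun v => ζ (some l, v)) {v | b v = some l} then 1 else 0) *
          (f l (fun v => ζ (none, v)) - f l (fun v => ζ (some l, v)))) =
      ∑ S ∈ (univ : Finset ι).powerset, (-1 : ℝ) ^ S.card * ((if BlockInj B b ζ then 1 else 0) *
        (g (fun v => ζ (none, v)) * ∏ l, if l ∈ S then f l (fun v => ζ (some l, v)) else
          f l (fun v => ζ (none, v)))) := by
    intro ζ
    rw [prod_mul_distrib, prod_sub]
    have e1 : (if BlockInj B b ζ then (1 : ℝ) else 0) =
        (if Set.InjOn (fun v => ζ (none, v)) (B : Set (Fin n)) then (1 : ℝ) else 0) *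
        ∏ l, (if Set.InjOn (fun v => ζ (some l, v)) {v | b v = some l} then 1 else 0) := by
      rw [prod_ite_zero]
      by_cases h1 : Set.InjOn (fun v => ζ (none, v)) (B : Set (Fin n)) <;>
        by_cases h2 : ∀ l, Set.InjOn (fun v => ζ (some l, v)) {v | b v = some l} <;>
        simp [BlockInj, h1, h2]
    rw [e1, mul_sum, mul_sum]
    refine sum_congr rfl fun S _ => ?_
    have e2 : (∏ l, if l ∈ S then f l (fun v => ζ (some l, v)) else f l (fun v => ζ (none, v))) =
        (∏ l ∈ univ \ S, f l (fun v => ζ (none, v))) * ∏ l ∈ S, f l (fun v => ζ (some l, v)) := by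
      rw [prod_ite, mul_comm]
      congr 1
      · congr 1; ext; simp
      · congr 1; ext; simp
    rw [e2]
    ring
  -- Change of variables by the exchange for `S`: the selected fresh copies return to the original
  -- coordinates, so the product of the `f l` no longer depends on `S` and the signs bear on the
  -- indicator alone.
  have h6 : ∀ S : Finset ι, ∑ ζ : Option ι × Fin n → Fin n, (if BlockInj B b ζ then (1 : ℝ) else 0) *
        (g (fun v => ζ (none, v)) * ∏ l, if l ∈ S then f l (fun v => ζ (some l, v)) else
          f l (fun v => ζ (none, v))) =
      ∑ ζ : Option ι × Fin n → Fin n, (if BlockInj B b (ζ ∘ blockSwap b S) then (1 : ℝ) else 0) *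
        (g (fun v => ζ (none, v)) * ∏ l, f l (fun v => ζ (none, v))) := by
    intro S
    rw [← Equiv.sum_comp ((blockSwap_involutive b S).toPerm.arrowCongr (Equiv.refl (Fin n)))]
    refine sum_congr rfl fun ζ _ => ?_
    have e0 : ((blockSwap_involutive b S).toPerm.arrowCongr (Equiv.refl (Fin n))) ζ =
        ζ ∘ blockSwap b S := rfl
    rw [e0]
    congr 2
    · refine hg _ _ fun v _ hv => ?_
      simp [blockSwap, hv]
    · refine prod_congr rfl fun l _ => ?_
      split_ifs with hl
      · refine hf l _ _ fun v hv => ?_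
        simp [blockSwap, hv, activeBlock_some, hl]
      · refine hf l _ _ fun v hv => ?_
        simp [blockSwap, hv, activeBlock_some, hl]
  calc _ = ∑ ζ : Option ι × Fin n → Fin n, ∑ S ∈ (univ : Finset ι).powerset,
        (-1 : ℝ) ^ S.card * ((if BlockInj B b ζ then 1 else 0) *
        (g (fun v => ζ (none, v)) * ∏ l, if l ∈ S then f l (fun v => ζ (some l, v)) else
          f l (fun v => ζ (none, v)))) := sum_congr rfl fun ζ _ => h5 ζ
    _ = _ := by
      simp only [mul_sum]
      rw [sum_comm]
      simp only [← mul_sum, h6]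
      simp only [mul_sum]
      rw [sum_comm]
      refine sum_congr rfl fun ζ _ => sum_congr rfl fun S _ => ?_
      ring

end Decoupling

/-! ### Centred block products under permutation sampling. -/

section PermutationCore

open Finset

variable {n : ℕ}

lemma symVal_mem {Θ : Matrix (Fin n) (Fin n) ℝ} {lam : ℝ} (h : ∀ i j, Θ i j ∈ Set.Icc 0 lam)
    (e : Sym2 (Fin n)) : 0 ≤ symVal Θ e ∧ symVal Θ e ≤ lam := h _ _

lemma thProd_nonneg {Θ : Matrix (Fin n) (Fin n) ℝ} {lam : ℝ} (h : ∀ i j, Θ i j ∈ Set.Icc 0 lam)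
    (F : Finset (Sym2 (Fin n))) (z : Fin n → Fin n) : 0 ≤ thProd Θ F z :=
  prod_nonneg fun _ _ => (symVal_mem h _).1

/-- Relabelling the nodes of a product of connection parameters by a non-injective map. -/
lemma exists_thProd_comp_le {Θ : Matrix (Fin n) (Fin n) ℝ} {lam : ℝ}
    (hlam : 0 ≤ lam) (h : ∀ i j, Θ i j ∈ Set.Icc 0 lam) (F : Finset (Sym2 (Fin n))) (ζ : Fin n → Fin n) :
    ∃ F' ⊆ allEdges n, F'.card ≤ F.card ∧ edgeGraph F' = (edgeGraph F).map ζ ∧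
      ∀ z : Fin n → Fin n, thProd Θ F (z ∘ ζ) ≤ lam ^ (F.card - F'.card) * thProd Θ F' z := by
  classical
  set F' := (F.image (Sym2.map ζ)).filter fun e => ¬ e.IsDiag with hF'
  -- One preimage is kept for each edge of the image. The remaining edges, which became loops or
  -- duplicates, are each bounded by `lam`.
  have hsec : ∀ e' : Sym2 (Fin n), ∃ e, e' ∈ F' → e ∈ F ∧ e.map ζ = e' := by
    intro e'
    by_cases he : e' ∈ F'
    · obtain ⟨e, h1, h2⟩ := mem_image.1 (mem_filter.1 he).1
      exact ⟨e, fun _ => ⟨h1, h2⟩⟩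
    · exact ⟨e', fun h => absurd h he⟩
  choose σ hσ using hsec
  have hinj : Set.InjOn σ F' := by
    intro a ha b hb hab
    rw [← (hσ a ha).2, ← (hσ b hb).2, hab]
  have hsub : F'.image σ ⊆ F := by
    intro e he
    obtain ⟨e', h1, rfl⟩ := mem_image.1 he
    exact (hσ e' h1).1
  have hcard : (F'.image σ).card = F'.card := card_image_of_injOn hinj
  refine ⟨F', ?_, ?_, ?_, ?_⟩
  · intro e he
    simpa [allEdges] using (mem_filter.1 he).2
  · rw [← hcard]; exact card_le_card hsub
  · ext u v
    rw [SimpleGraph.fromEdgeSet_adj, SimpleGraph.map_adj']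
    constructor
    · rintro ⟨h1, hne⟩
      refine ⟨hne, ?_⟩
      obtain ⟨e, h2, h3⟩ := mem_image.1 (mem_filter.1 (mem_coe.1 h1)).1
      induction e using Sym2.ind with
      | _ a b =>
        rw [Sym2.map_mk] at h3
        rcases Sym2.eq_iff.1 h3 with ⟨rfl, rfl⟩ | ⟨rfl, rfl⟩
        · exact ⟨a, b, (SimpleGraph.fromEdgeSet_adj _).2 ⟨h2, fun h => hne (h ▸ rfl)⟩, rfl, rfl⟩
        · refine ⟨b, a, (SimpleGraph.fromEdgeSet_adj _).2 ⟨?_, fun h => hne (h ▸ rfl)⟩, rfl, rfl⟩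
          rw [Sym2.eq_swap]; exact h2
    · rintro ⟨hne, a, b, hab, rfl, rfl⟩
      refine ⟨?_, hne⟩
      rw [mem_coe, hF', mem_filter]
      refine ⟨mem_image.2 ⟨s(a, b), mem_coe.1 ((SimpleGraph.fromEdgeSet_adj _).1 hab).1, rfl⟩, ?_⟩
      simpa using hne
  · intro z
    have h1 : thProd Θ F (z ∘ ζ) =
        (∏ e ∈ F \ F'.image σ, symVal Θ (e.map (z ∘ ζ))) *
        ∏ e ∈ F'.image σ, symVal Θ (e.map (z ∘ ζ)) := by
      rw [thProd, prod_sdiff hsub]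
    rw [h1]
    refine mul_le_mul ?_ (le_of_eq ?_) (prod_nonneg fun e _ => (symVal_mem h _).1)
      (pow_nonneg hlam _)
    · have : (F \ F'.image σ).card = F.card - F'.card := by
        rw [card_sdiff_of_subset hsub, hcard]
      rw [← this, ← prod_const]
      exact prod_le_prod (fun e _ => (symVal_mem h _).1) fun e _ => (symVal_mem h _).2
    · rw [prod_image hinj, thProd]
      refine prod_congr rfl fun e he => ?_
      rw [← (hσ e he).2, Sym2.map_map, (hσ e he).2]

/-- Edges of `G` stay inside blocks, so a touched block has a coordinate that `ζ` identifies with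
one outside its component. The merging bound is applied to `GW`, the copy of `G` on the original
coordinates, in which the fresh copies are isolated. With j collisions and r blocks, the rank drops
by at most j - r/2, and j ≥ r/2. -/
lemma grank_add_card_le_of_touched {ι : Type*} [DecidableEq ι] [Fintype ι] {B : Finset (Fin n)}
    {b : Fin n → Option ι} {G : SimpleGraph (Fin n)}
    (hG : ∀ u v, G.Adj u v → u ∈ B ∧ b u = b v) {ζ : Option ι × Fin n → Fin n}
    (ht : ∀ l, Touched B b ζ l) :
    2 * grank G + Fintype.card ι + 2 * ((coords B b).image ζ).card ≤
      2 * grank (G.map fun v => ζ (none, v)) + 2 * (coords B b).card ∧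
    Fintype.card ι + 2 * ((coords B b).image ζ).card ≤ 2 * (coords B b).card := by
  classical
  let W := {x // x ∈ coords B b}
  let GW : SimpleGraph W :=
    { Adj := fun x y => x.1.1 = none ∧ y.1.1 = none ∧ G.Adj x.1.2 y.1.2
      symm := ⟨fun x y h => ⟨h.2.1, h.1, h.2.2.symm⟩⟩
      loopless := ⟨fun x h => G.loopless.irrefl _ h.2.2⟩ }
  let f : W → Fin n := fun x => ζ x.1
  have hmem : ∀ u ∈ B, ((none, u) : Option ι × Fin n) ∈ coords B b := by
    intro u hu; simp [coords, hu]
  have hmap : GW.map f = G.map fun v => ζ (none, v) := by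
    ext u v
    rw [SimpleGraph.map_adj', SimpleGraph.map_adj']
    refine and_congr_right fun hne => ?_
    constructor
    · rintro ⟨⟨⟨o, x⟩, hx⟩, ⟨⟨o', y⟩, hy⟩, ⟨h1, h2, h3⟩, rfl, rfl⟩
      simp only at h1 h2 h3
      subst h1 h2
      exact ⟨x, y, h3, rfl, rfl⟩
    · rintro ⟨x, y, h3, rfl, rfl⟩
      exact ⟨⟨(none, x), hmem x (hG x y h3).1⟩, ⟨(none, y), hmem y (hG y x h3.symm).1⟩,
        ⟨rfl, rfl, h3⟩, rfl, rfl⟩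
  have hmap2 : GW.map (fun x => x.1.2) = G := by
    ext u v
    rw [SimpleGraph.map_adj']
    constructor
    · rintro ⟨hne, ⟨⟨o, x⟩, hx⟩, ⟨⟨o', y⟩, hy⟩, ⟨h1, h2, h3⟩, rfl, rfl⟩
      exact h3
    · intro h3
      exact ⟨h3.ne, ⟨(none, u), hmem u (hG u v h3).1⟩, ⟨(none, v), hmem v (hG v u h3.symm).1⟩,
        ⟨rfl, rfl, h3⟩, rfl, rfl⟩
  have hr : grank G ≤ grank GW := by
    conv_lhs => rw [← hmap2]
    exact grank_map_le _ _
  have hreach : ∀ x y : W, GW.Reachable x y → b x.1.2 = b y.1.2 := by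
    rintro x y ⟨p⟩
    induction p with
    | nil => rfl
    | cons h p ih => exact (hG _ _ h.2.2).2.trans ih
  choose x hx y hy h1 h2 h3 using ht
  have hcard : Fintype.card W = (coords B b).card := Fintype.card_coe _
  have himg : univ.image f = (coords B b).image ζ := by
    ext u
    simp only [mem_image, mem_univ, true_and]
    constructor
    · rintro ⟨w, rfl⟩; exact ⟨w.1, w.2, rfl⟩
    · rintro ⟨w, hw, rfl⟩; exact ⟨⟨w, hw⟩, rfl⟩
  have hA := grank_add_card_le_grank_map GW f (fun l => (⟨x l, hx l⟩ : W))
    (fun i j hij => by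
      have := hreach _ _ hij
      simp only [h1] at this
      exact Option.some_injective _ this)
    (fun l => ⟨⟨y l, hy l⟩, fun hre => h2 l (by
      have := hreach _ _ hre
      rw [this]; exact h1 l), h3 l⟩)
  have hB := card_image_add_card_le f (fun l => (⟨x l, hx l⟩ : W))
    (fun i j hij => by
      have : x i = x j := congrArg Subtype.val hij
      have h4 := h1 i
      rw [this, h1 j] at h4
      exact (Option.some_injective _ h4).symm)
    (fun l => ⟨⟨y l, hy l⟩, fun he => h2 l (by
      have : y l = x l := congrArg Subtype.val he
      rw [this]; exact h1 l), h3 l⟩)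
  rw [hmap, himg, hcard] at hA
  rw [himg, hcard] at hB
  constructor <;> omega

/-- A lost unit of rank costs 1/y ≤ Q, and at most j - r/2 units are lost. The factor Q^j on the
right is later summed against the probability of j collisions, which leaves the gain Q^(-r/2). -/
lemma pow_grank_le {y Q : ℝ} (hy : y ≤ 1) (hQ : 1 ≤ Q) (hyQ : 1 / Q ≤ y) {R r R' j : ℕ}
    (h1 : 2 * R + r ≤ 2 * R' + 2 * j) (h2 : r ≤ 2 * j) :
    y ^ R' ≤ y ^ R * Q ^ j * (1 / √Q) ^ r := by
  have hQ0 : 0 < Q := by linarith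
  have hy0 : 0 < y := lt_of_lt_of_le (by positivity) hyQ
  have hs : 1 ≤ √Q := Real.one_le_sqrt.2 hQ
  have hs0 : 0 < √Q := by linarith
  have hQj : Q ^ j * (1 / √Q) ^ r = √Q ^ (2 * j - r) := by
    rw [one_div, inv_pow, ← div_eq_mul_inv, div_eq_iff (by positivity), ← pow_add,
      Nat.sub_add_cancel h2, pow_mul, Real.sq_sqrt hQ0.le]
  rw [mul_assoc, hQj]
  rcases le_total R R' with h | h
  · calc y ^ R' ≤ y ^ R * 1 := by rw [mul_one]; exact pow_le_pow_of_le_one hy0.le hy h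
      _ ≤ _ := by gcongr; exact one_le_pow₀ hs
  · obtain ⟨d, rfl⟩ := Nat.exists_eq_add_of_le h
    have h3 : 1 ≤ y * Q := by
      rw [div_le_iff₀ hQ0] at hyQ; exact hyQ
    calc y ^ R' ≤ y ^ R' * (y * Q) ^ d := le_mul_of_one_le_right (by positivity) (one_le_pow₀ h3)
      _ = y ^ (R' + d) * √Q ^ (2 * d) := by
          rw [pow_mul (√Q), Real.sq_sqrt hQ0.le, mul_pow, pow_add]; ring
      _ ≤ _ := by gcongr; omega

open scoped Classical in
/-- Bound on the expectation under permutation sampling of a product of centred functions of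
disjoint blocks. -/
lemma abs_lat_permutation_le {ι : Type*} [DecidableEq ι] [Fintype ι] {B : Finset (Fin n)}
    {b : Fin n → Option ι} (hb : ∀ v, b v ≠ none → v ∈ B)
    (g : (Fin n → Fin n) → ℝ) (f : ι → (Fin n → Fin n) → ℝ)
    (hg : ∀ z z', (∀ v ∈ B, b v = none → z v = z' v) → g z = g z')
    (hf : ∀ l z z', (∀ v, b v = some l → z v = z' v) → f l z = f l z')
    (hg0 : ∀ z, 0 ≤ g z) (hf0 : ∀ l z, 0 ≤ f l z)
    {Θ : Matrix (Fin n) (Fin n) ℝ} {lam Lam A y Cg : ℝ} (hΘ : ∀ i j, Θ i j ∈ Set.Icc 0 lam)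
    (hlam : 0 ≤ lam) (hLam : lam ≤ Lam) (hA : 1 ≤ A) (hAn : 6 * A ≤ n)
    (hBA : (2 * B.card : ℝ) ^ 2 ≤ A) (hy : y ≤ 1) (hyA : A / n ≤ y) (hCg : 0 ≤ Cg)
    (F : Finset (Sym2 (Fin n)))
    (hFB : ∀ u v, (edgeGraph F).Adj u v → u ∈ B ∧ b u = b v)
    (hgf : ∀ z, g z * ∏ l, f l z ≤ Cg * thProd Θ F z)
    (hstar : ∀ F' ⊆ allEdges n, F'.card ≤ F.card →
      lat .permutation (thProd Θ F') ≤ Lam ^ F'.card * y ^ grank (edgeGraph F')) :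
    |lat .permutation (fun z => g z * ∏ l, (f l z - lat .permutation (f l)))| ≤
      Cg * (6 * 4 ^ Fintype.card ι) * Lam ^ F.card * y ^ grank (edgeGraph F) *
        √(A / n) ^ Fintype.card ι := by
  set r := Fintype.card ι with hr
  have hA0 : (0 : ℝ) < A := by linarith
  have hn0 : (0 : ℝ) < n := by linarith
  have hLam0 : 0 ≤ Lam := hlam.trans hLam
  have hy0 : 0 < y := lt_of_lt_of_le (by positivity) hyA
  set Q : ℝ := n / A with hQ
  have hQ1 : 1 ≤ Q := (one_le_div hA0).2 (by linarith)
  set N : ℝ := (n : ℝ) ^ n with hN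
  have hN0 : 0 < N := by positivity
  have hcB : N / 2 ≤ injCount B :=
    half_le_injCount hA hAn B (le_trans (by nlinarith [Nat.cast_nonneg (α := ℝ) B.card]) hBA)
  have hcl : ∀ l, N / 2 ≤ injCount (univ.filter fun v => b v = some l) := by
    intro l
    refine half_le_injCount hA hAn _ (le_trans ?_ hBA)
    have : ((univ.filter fun v => b v = some l).card : ℝ) ≤ B.card := by
      exact_mod_cast card_le_card fun v hv => hb v (by simp [(mem_filter.1 hv).2])
    have h0 : (0 : ℝ) ≤ (univ.filter fun v => b v = some l).card := Nat.cast_nonneg _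
    nlinarith
  set c := injCount B * ∏ l, injCount (univ.filter fun v => b v = some l) with hc
  have hcN : (N / 2) ^ (r + 1) ≤ c := by
    rw [pow_succ', hc]
    refine mul_le_mul hcB ?_ (by positivity) (by linarith [half_pos hN0])
    rw [hr, ← card_univ, ← prod_const]
    exact prod_le_prod (fun _ _ => by positivity) fun l _ => hcl l
  have hc0 : 0 < c := lt_of_lt_of_le (by positivity) hcN
  have hcoord : ((coords B b).card : ℝ) ^ 2 ≤ A := by
    refine le_trans ?_ hBA
    have h1 : coords B b ⊆ (B.image fun v => (none, v)) ∪ B.image fun v => (b v, v) := by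
      rintro ⟨o, v⟩ hx
      simp only [coords, mem_filter, mem_univ, true_and] at hx
      rcases hx.2 with rfl | rfl
      · exact mem_union_left _ (mem_image.2 ⟨v, hx.1, rfl⟩)
      · exact mem_union_right _ (mem_image.2 ⟨v, hx.1, rfl⟩)
    have h2 : (coords B b).card ≤ 2 * B.card := by
      refine (card_le_card h1).trans ((card_union_le _ _).trans ?_)
      have h3 := card_image_le (s := B) (f := fun v => ((none, v) : Option ι × Fin n))
      have h4 := card_image_le (s := B) (f := fun v => (b v, v))
      omega
    have h3 : ((coords B b).card : ℝ) ≤ 2 * B.card := by exact_mod_cast h2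
    gcongr
  have hdec := decoupling hb g f hg hf
  -- Being touched depends only on coincidences of values, so `sum_eq_lat_perm` inserts a uniform
  -- permutation, and `hstar` then applies to the merged edge set.
  let I : (Option ι × Fin n → Fin n) → ℝ := fun ζ => if ∀ l, Touched B b ζ l then 1 else 0
  have hI : ∀ (τ : Equiv.Perm (Fin n)) ζ, I (τ ∘ ζ) = I ζ := by
    intro τ ζ
    have : ∀ l, Touched B b (τ ∘ ζ) l ↔ Touched B b ζ l := by
      intro l
      simp [Touched]
    simp only [I, this]
  have hI0 : ∀ ζ, 0 ≤ I ζ := fun ζ => by simp only [I]; split_ifs <;> norm_num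
  have hterm : ∀ ζ, I ζ * lat .permutation (fun σ => thProd Θ F (fun v => (σ ∘ ζ) (none, v))) ≤
      Lam ^ F.card * y ^ grank (edgeGraph F) * √(A / n) ^ r *
        Q ^ ((coords B b).card - ((coords B b).image ζ).card) := by
    intro ζ
    by_cases ht : ∀ l, Touched B b ζ l
    · have hIζ : I ζ = 1 := if_pos ht
      rw [hIζ, one_mul]
      obtain ⟨F', hF', hc', hG', hle⟩ := exists_thProd_comp_le hlam hΘ F fun v => ζ (none, v)
      obtain ⟨h1, h2⟩ := grank_add_card_le_of_touched hFB ht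
      have hci : ((coords B b).image ζ).card ≤ (coords B b).card := card_image_le
      rw [← hG', ← hr] at h1
      calc lat .permutation (fun σ => thProd Θ F (fun v => (σ ∘ ζ) (none, v)))
          ≤ lat .permutation (fun σ => lam ^ (F.card - F'.card) * thProd Θ F' σ) :=
            lat_mono _ fun σ => hle σ
        _ = lam ^ (F.card - F'.card) * lat .permutation (thProd Θ F') := lat_const_mul _ _ _
        _ ≤ Lam ^ (F.card - F'.card) * (Lam ^ F'.card * y ^ grank (edgeGraph F')) := by
            gcongr
            · exact lat_nonneg _ fun z => thProd_nonneg hΘ _ _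
            · exact hstar F' hF' hc'
        _ = Lam ^ F.card * y ^ grank (edgeGraph F') := by
            rw [← mul_assoc, ← pow_add, Nat.sub_add_cancel hc']
        _ ≤ Lam ^ F.card * (y ^ grank (edgeGraph F) *
              Q ^ ((coords B b).card - ((coords B b).image ζ).card) * (1 / √Q) ^ r) := by
            gcongr
            refine pow_grank_le hy hQ1 (by rw [hQ, one_div_div]; exact hyA) ?_ ?_ <;> omega
        _ = _ := by
            rw [hQ, ← Real.sqrt_one, ← Real.sqrt_div zero_le_one, one_div_div]; ring
    · have hIζ : I ζ = 0 := if_neg ht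
      rw [hIζ, zero_mul]
      positivity
  have hsum : ∑ ζ : Option ι × Fin n → Fin n, I ζ * thProd Θ F (fun v => ζ (none, v)) ≤
      Lam ^ F.card * y ^ grank (edgeGraph F) * √(A / n) ^ r * (N ^ (r + 1) * 3) := by
    rw [sum_eq_lat_perm I hI fun ζ => thProd Θ F fun v => ζ (none, v)]
    refine (sum_le_sum fun ζ _ => hterm ζ).trans ?_
    rw [← mul_sum]
    gcongr
    refine (sum_pow_collisions_le_three hA (by linarith) (coords B b) hcoord).trans (le_of_eq ?_)
    rw [Fintype.card_prod, Fintype.card_option, Fintype.card_fin, hN, ← pow_mul, mul_comm n]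
  have habs : c * |lat .permutation (fun z => g z * ∏ l, (f l z - lat .permutation (f l)))| ≤
      2 ^ r * Cg * (Lam ^ F.card * y ^ grank (edgeGraph F) * √(A / n) ^ r * (N ^ (r + 1) * 3)) := by
    rw [← abs_of_pos hc0, ← abs_mul, hdec]
    refine (abs_sum_le_sum_abs _ _).trans ?_
    calc _ ≤ ∑ ζ : Option ι × Fin n → Fin n,
          2 ^ r * Cg * (I ζ * thProd Θ F (fun v => ζ (none, v))) := by
          refine sum_le_sum fun ζ _ => ?_
          have h0 : 0 ≤ g (fun v => ζ (none, v)) * ∏ l, f l (fun v => ζ (none, v)) :=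
            mul_nonneg (hg0 _) (prod_nonneg fun l _ => hf0 l _)
          rw [abs_mul, abs_of_nonneg h0]
          calc _ ≤ (Cg * thProd Θ F (fun v => ζ (none, v))) * (2 ^ r * I ζ) :=
                mul_le_mul (hgf _) (abs_sum_blockSwap_le hb ζ) (abs_nonneg _)
                  (mul_nonneg hCg (thProd_nonneg hΘ _ _))
            _ = _ := by ring
      _ ≤ _ := by rw [← mul_sum]; gcongr
  -- The constant 6 * 4^r is 3 from the collision sum, 2^r from the alternating sum and 2^(r+1) from
  -- the r + 1 injectivity counts, each at least half of n^n.
  have h1 : (N / 2) ^ (r + 1) *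
      |lat .permutation (fun z => g z * ∏ l, (f l z - lat .permutation (f l)))| ≤
      (N / 2) ^ (r + 1) * (Cg * (6 * 4 ^ r) * Lam ^ F.card * y ^ grank (edgeGraph F) *
        √(A / n) ^ r) := by
    refine ((mul_le_mul_of_nonneg_right hcN (abs_nonneg _)).trans habs).trans (le_of_eq ?_)
    have : (4 : ℝ) ^ r = 2 ^ r * 2 ^ r := by rw [← mul_pow]; norm_num
    rw [div_pow, this, pow_succ (2 : ℝ) r]
    field_simp
    ring
  exact le_of_mul_le_mul_left h1 (by positivity)

end PermutationCore

/-! ### The quantitative regime and systems of edge sets, for both sampling schemes. -/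

section Systems

open Finset

variable {n : ℕ}

/-- Independence of disjoint sets of coordinates: two independent assignments exchange their
coordinates outside `p`, which is an involution. -/
lemma sum_mul_sum_of_dependsOn (p : Fin n → Prop) (f h : (Fin n → Fin n) → ℝ)
    (hf : ∀ z z', (∀ v, p v → z v = z' v) → f z = f z')
    (hh : ∀ z z', (∀ v, ¬ p v → z v = z' v) → h z = h z') :
    (∑ z, f z) * ∑ z, h z = (Fintype.card (Fin n → Fin n) : ℝ) * ∑ z, f z * h z := by
  classical
  let m : (Fin n → Fin n) × (Fin n → Fin n) → (Fin n → Fin n) × (Fin n → Fin n) := fun w =>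
    (fun v => if p v then w.1 v else w.2 v, fun v => if p v then w.2 v else w.1 v)
  have hm : Function.Involutive m := by
    rintro ⟨z, z'⟩
    refine Prod.ext (funext fun v => ?_) (funext fun v => ?_) <;> by_cases hv : p v <;> simp [m, hv]
  have h1 := Equiv.sum_comp (Function.Involutive.toPerm m hm) fun w => f w.1 * h w.2
  rw [Fintype.sum_prod_type, Fintype.sum_prod_type] at h1
  rw [sum_mul_sum, ← h1]
  have h2 : ∀ z z' : Fin n → Fin n, f (m (z, z')).1 * h (m (z, z')).2 =
      f z * h z := by
    intro z z'
    congr 1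
    · refine hf _ _ fun v hv => ?_
      simp [m, hv]
    · refine hh _ _ fun v hv => ?_
      simp [m, hv]
  simp only [Function.Involutive.coe_toPerm, h2, sum_const, card_univ, nsmul_eq_mul, mul_sum]

/-- Centred functions of blocks are orthogonal to everything else under independent sampling. -/
lemma lat_independent_eq_zero {ι : Type*} [DecidableEq ι] [Fintype ι] {B : Finset (Fin n)}
    {b : Fin n → Option ι} (hn : n ≠ 0)
    (g : (Fin n → Fin n) → ℝ) (f : ι → (Fin n → Fin n) → ℝ)
    (hg : ∀ z z', (∀ v ∈ B, b v = none → z v = z' v) → g z = g z')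
    (hf : ∀ l z z', (∀ v, b v = some l → z v = z' v) → f l z = f l z') (l : ι) :
    lat .independent (fun z => g z * ∏ l, (f l z - lat .independent (f l))) = 0 := by
  set μ : ι → ℝ := fun l => lat .independent (f l) with hμ
  have hn0 : (n : ℝ) ≠ 0 := by exact_mod_cast hn
  have h1 := sum_mul_sum_of_dependsOn (fun v => b v = some l) (f l)
    (fun z => g z * ∏ m ∈ univ.erase l, (f m z - μ m)) (hf l) (by
      intro z z' h
      congr 1
      · exact hg z z' fun v _ hv => h v (by simp [hv])
      · refine prod_congr rfl fun m hm => ?_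
        rw [hf m z z' fun v hv => h v ?_]
        rw [hv]
        exact fun h' => (mem_erase.1 hm).1 (Option.some_injective _ h'))
  have h2 : ∑ z, f l z = (n : ℝ) ^ n * μ l := by
    rw [hμ]
    simp only [lat_independent]
    field_simp
  have hc : (Fintype.card (Fin n → Fin n) : ℝ) = (n : ℝ) ^ n := by simp
  rw [h2, hc, mul_assoc] at h1
  have h3 := mul_left_cancel₀ (pow_ne_zero n hn0) h1
  rw [lat_independent]
  have h4 : ∀ z, g z * ∏ m, (f m z - μ m) =
      f l z * (g z * ∏ m ∈ univ.erase l, (f m z - μ m)) -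
        μ l * (g z * ∏ m ∈ univ.erase l, (f m z - μ m)) := by
    intro z
    rw [← mul_prod_erase univ _ (mem_univ l)]
    ring
  rw [sum_congr rfl fun z _ => h4 z, sum_sub_distrib, ← mul_sum, ← h3]
  simp

/-- Quantitative form of the conditions: `A` is a power of `D`, and `ξ` is small. -/
structure Regime (n : ℕ) (s : Sampling) (q lam : ℝ) (Θ : Matrix (Fin n) (Fin n) ℝ) (D k : ℕ)
    (A ξ : ℝ) : Prop where
  symm : Θ.IsSymm
  mem : ∀ i j, Θ i j ∈ Set.Icc 0 lam
  q_pos : 0 < q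
  q_le : q ≤ 1 / 2
  lam_nonneg : 0 ≤ lam
  k_pos : 1 ≤ k
  D_pos : 1 ≤ D
  A_ge : (8 * D : ℝ) ^ 2 ≤ A
  A_le : 6 * A ≤ n
  y_le : A * ((k : ℝ) / n) ≤ 1
  star : ∀ F ⊆ allEdges n, F.card ≤ 2 * D → lat s (thProd Θ F) ≤
    (A * lam) ^ F.card * (A * ((k : ℝ) / n)) ^ grank (edgeGraph F)
  lam_le : (1 + 2 * (lam / q)) ^ (2 * D) ≤ 1 + ξ
  ξ_pos : 0 < ξ
  ξ_le : 4 * D * ξ ≤ 1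
  -- Each edge carrying λ pays for √q̄ ξ², also when it raises the rank and brings A k/√n, the rest
  -- of A k/n once 1/√n is set aside. One ξ serves the symmetric difference, the other the sum over
  -- expanded factors; 4A absorbs the constants of the centred blocks.
  edge_le : 4 * A * (A * lam) ≤ √(qBar q) * ξ ^ 2
  rank_le : 4 * A * (A * lam) * (A * k / √n) ≤ √(qBar q) * ξ ^ 2

/-- A family of sets of edges, split in two sides, in each of which they are node-disjoint, with a
subfamily `P` of sets that are node-disjoint from all the others. -/
structure EdgeSystem (n : ℕ) (I : Type*) where
  T : I → Finset (Sym2 (Fin n))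
  nodes : I → Finset (Fin n)
  side : I → Bool
  P : Finset I
  sub : ∀ i, T i ⊆ allEdges n
  nonempty : ∀ i, (T i).Nonempty
  mem_nodes : ∀ i, ∀ e ∈ T i, ∀ v ∈ e, v ∈ nodes i
  cover : ∀ i, ∀ v ∈ nodes i, ∃ e ∈ T i, v ∈ e
  disj_side : ∀ i j, i ≠ j → side i = side j → Disjoint (nodes i) (nodes j)
  disj_pure : ∀ l ∈ P, ∀ i, i ≠ l → Disjoint (nodes l) (nodes i)

namespace Regime

variable {s : Sampling} {q lam : ℝ} {Θ : Matrix (Fin n) (Fin n) ℝ} {D k : ℕ} {A ξ : ℝ}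

lemma one_le_A (h : Regime n s q lam Θ D k A ξ) : 1 ≤ A := by
  have := h.A_ge
  have h1 : (1 : ℝ) ≤ D := by exact_mod_cast h.D_pos
  nlinarith

lemma n_pos (h : Regime n s q lam Θ D k A ξ) : (0 : ℝ) < n := by
  linarith [h.one_le_A, h.A_le]

lemma n_ne_zero (h : Regime n s q lam Θ D k A ξ) : n ≠ 0 := by
  have := h.n_pos
  rintro rfl
  simp at this

lemma ξ_le_one (h : Regime n s q lam Θ D k A ξ) : ξ ≤ 1 := by
  have h1 : (1 : ℝ) ≤ D := by exact_mod_cast h.D_pos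
  nlinarith [h.ξ_le, h.ξ_pos]

lemma qBar_pos (h : Regime n s q lam Θ D k A ξ) : 0 < qBar q :=
  mul_pos h.q_pos (by linarith [h.q_le])

-- From here on both schemes are treated alike. Under independent sampling the left side vanishes as
-- soon as there is a block, and `star` is the bound when there is none; under permutation sampling
-- this is `abs_lat_permutation_le`.
open scoped Classical in
lemma abs_lat_le (h : Regime n s q lam Θ D k A ξ) {ι : Type*} [Fintype ι]
    {B : Finset (Fin n)} {b : Fin n → Option ι} (hb : ∀ v, b v ≠ none → v ∈ B)
    (g : (Fin n → Fin n) → ℝ) (f : ι → (Fin n → Fin n) → ℝ)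
    (hg : ∀ z z', (∀ v ∈ B, b v = none → z v = z' v) → g z = g z')
    (hf : ∀ l z z', (∀ v, b v = some l → z v = z' v) → f l z = f l z')
    (hg0 : ∀ z, 0 ≤ g z) (hf0 : ∀ l z, 0 ≤ f l z) (hBD : B.card ≤ 4 * D) {Cg : ℝ} (hCg : 0 ≤ Cg)
    (F : Finset (Sym2 (Fin n))) (hF : F ⊆ allEdges n) (hFD : F.card ≤ 2 * D)
    (hFB : ∀ u v, (edgeGraph F).Adj u v → u ∈ B ∧ b u = b v)
    (hgf : ∀ z, g z * ∏ l, f l z ≤ Cg * thProd Θ F z) :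
    |lat s (fun z => g z * ∏ l, (f l z - lat s (f l)))| ≤
      Cg * (6 * 4 ^ Fintype.card ι) * (A * lam) ^ F.card *
        (A * ((k : ℝ) / n)) ^ grank (edgeGraph F) * √(A / n) ^ Fintype.card ι := by
  have hA := h.one_le_A
  have hn := h.n_pos
  have hlam := h.lam_nonneg
  have hk : (1 : ℝ) ≤ k := by exact_mod_cast h.k_pos
  cases s with
  | permutation =>
    refine abs_lat_permutation_le hb g f hg hf hg0 hf0 h.mem hlam ?_ hA h.A_le ?_ h.y_le ?_ hCg F
      hFB hgf fun F' hF' hc => h.star F' hF' (hc.trans hFD)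
    · nlinarith
    · refine le_trans ?_ h.A_ge
      have : (B.card : ℝ) ≤ 4 * D := by exact_mod_cast hBD
      have h0 : (0 : ℝ) ≤ B.card := Nat.cast_nonneg _
      nlinarith
    · rw [mul_div_assoc']
      gcongr
      nlinarith
  | independent =>
    rcases isEmpty_or_nonempty ι with hι | ⟨⟨l⟩⟩
    · simp only [Finset.univ_eq_empty, prod_empty, mul_one, Fintype.card_eq_zero, pow_zero] at hgf ⊢
      rw [abs_of_nonneg (lat_nonneg _ hg0)]
      calc lat .independent g ≤ lat .independent (fun z => Cg * thProd Θ F z) := lat_mono _ hgf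
        _ = Cg * lat .independent (thProd Θ F) := lat_const_mul _ _ _
        _ ≤ Cg * ((A * lam) ^ F.card * (A * ((k : ℝ) / n)) ^ grank (edgeGraph F)) := by
            gcongr
            exact h.star F hF hFD
        _ ≤ Cg * 6 * ((A * lam) ^ F.card * (A * ((k : ℝ) / n)) ^ grank (edgeGraph F)) := by
            gcongr
            linarith
        _ = _ := by ring
    · rw [lat_independent_eq_zero h.n_ne_zero g f hg hf l, abs_zero]
      positivity

end Regime

namespace EdgeSystem

variable {I : Type*} (E : EdgeSystem n I)

lemma eq_of_mem_of_side {i j : I} {e : Sym2 (Fin n)} (hi : e ∈ E.T i) (hj : e ∈ E.T j)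
    (hs : E.side i = E.side j) : i = j := by
  by_contra hne
  have := E.disj_side i j hne hs
  induction e using Sym2.ind with
  | _ a b =>
    exact Finset.disjoint_left.1 this (E.mem_nodes i _ hi a (Sym2.mem_mk_left a b))
      (E.mem_nodes j _ hj a (Sym2.mem_mk_left a b))

lemma disjoint_of_pure {l i : I} (hl : l ∈ E.P) (hne : i ≠ l) : Disjoint (E.T l) (E.T i) := by
  rw [Finset.disjoint_left]
  intro e hel hei
  induction e using Sym2.ind with
  | _ a b =>
    exact Finset.disjoint_left.1 (E.disj_pure l hl i hne)
      (E.mem_nodes l _ hel a (Sym2.mem_mk_left a b)) (E.mem_nodes i _ hei a (Sym2.mem_mk_left a b))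

lemma edgeMult_le_two (K : Finset I) (e : Sym2 (Fin n)) : edgeMult E.T K e ≤ 2 := by
  classical
  rw [edgeMult]
  have := Finset.card_le_card_of_injOn (s := K.filter fun i => e ∈ E.T i) (t := Finset.univ) E.side
    (fun _ _ => by simp) (by
      intro i hi j hj hij
      exact E.eq_of_mem_of_side (mem_filter.1 (mem_coe.1 hi)).2 (mem_filter.1 (mem_coe.1 hj)).2 hij)
  simpa using this

/-- The edges that lie in exactly `j` sets of the subfamily `K`. -/
def level (K : Finset I) (j : ℕ) : Finset (Sym2 (Fin n)) :=
  (allEdges n).filter fun e => edgeMult E.T K e = j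

lemma sum_card_eq (K : Finset I) :
    ∑ i ∈ K, (E.T i).card = (E.level K 1).card + 2 * (E.level K 2).card := by
  classical
  have h1 : ∀ i ∈ K, (E.T i).card = ∑ e ∈ allEdges n, if e ∈ E.T i then 1 else 0 := by
    intro i _
    rw [← sum_filter, sum_const, smul_eq_mul, mul_one, filter_mem_eq_inter,
      inter_eq_right.2 (E.sub i)]
  rw [sum_congr rfl h1, sum_comm, level, level, card_filter, card_filter, mul_sum,
    ← sum_add_distrib]
  refine sum_congr rfl fun e _ => ?_
  have h2 : ∑ i ∈ K, (if e ∈ E.T i then 1 else 0) = edgeMult E.T K e := by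
    rw [edgeMult, card_filter]
  have h3 := E.edgeMult_le_two K e
  rw [h2]
  generalize edgeMult E.T K e = m at *
  interval_cases m <;> simp

lemma mem_level_one_iff {K : Finset I} {e : Sym2 (Fin n)} :
    e ∈ E.level K 1 → ∃ i ∈ K, e ∈ E.T i := by
  classical
  intro h
  have := (mem_filter.1 h).2
  rw [edgeMult] at this
  obtain ⟨i, hi⟩ := card_pos.1 (by omega : 0 < (K.filter fun i => e ∈ E.T i).card)
  exact ⟨i, mem_filter.1 hi⟩

end EdgeSystem

end Systems

/-! ### Bound on one term of the expansion. -/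

section TermBound

open Finset

variable {n : ℕ} {s : Sampling} {q lam : ℝ} {Θ : Matrix (Fin n) (Fin n) ℝ} {D k : ℕ} {A ξ : ℝ}

/-- A doubled edge has second moment q̄ + (1 - 2q)θ, and q̄ · 2λ/q = 2(1 - q)λ ≥ λ because q ≤ 1/2.
-/
lemma bernMoment_le (h : Regime n s q lam Θ D k A ξ) {m : ℕ} (hm : m ≤ 2) {θ : ℝ} (h0 : 0 ≤ θ)
    (h1 : θ ≤ lam) :
    0 ≤ bernMoment q m θ ∧ bernMoment q m θ ≤
      (if m = 2 then qBar q * (1 + 2 * (lam / q)) else 1) * (if m = 1 then θ else 1) := by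
  have hq := h.q_pos
  have hq2 := h.q_le
  interval_cases m
  · simp
  · simp [h0]
  · rw [bernMoment_two]
    have hqb := h.qBar_pos
    refine ⟨by nlinarith, ?_⟩
    simp only [if_true, show (2 : ℕ) ≠ 1 by norm_num, if_false, mul_one]
    have h2 : lam ≤ qBar q * (2 * (lam / q)) := by
      have : qBar q * (2 * (lam / q)) = 2 * (1 - q) * lam := by
        rw [qBar]; field_simp
      rw [this]
      nlinarith [h.lam_nonneg]
    nlinarith

namespace EdgeSystem

variable {I : Type*} (E : EdgeSystem n I)

lemma card_nodes_le (i : I) : (E.nodes i).card ≤ (E.T i).card * 2 := by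
  classical
  have h1 : E.nodes i ⊆ (E.T i).biUnion Sym2.toFinset := by
    intro v hv
    obtain ⟨e, he, hve⟩ := E.cover i v hv
    exact mem_biUnion.2 ⟨e, he, by simpa using hve⟩
  refine (card_le_card h1).trans (card_biUnion_le_card_mul _ _ _ fun e _ => ?_)
  rw [Sym2.card_toFinset]
  split_ifs <;> omega

lemma condE_nonneg (h : Regime n s q lam Θ D k A ξ) (K : Finset I) (z : Fin n → Fin n) :
    0 ≤ condE q Θ z (fun A => ∏ i ∈ K, edgeMonomial q (E.T i) A) := by
  rw [condE_prod_edgeMonomial h.symm q z E.T K fun i _ => E.sub i]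
  exact prod_nonneg fun e _ => (bernMoment_le h (E.edgeMult_le_two K e) (symVal_mem h.mem _).1
    (symVal_mem h.mem _).2).1

lemma condE_le (h : Regime n s q lam Θ D k A ξ) (K : Finset I) (z : Fin n → Fin n) :
    condE q Θ z (fun A => ∏ i ∈ K, edgeMonomial q (E.T i) A) ≤
      (qBar q * (1 + 2 * (lam / q))) ^ (E.level K 2).card * thProd Θ (E.level K 1) z := by
  classical
  rw [condE_prod_edgeMonomial h.symm q z E.T K fun i _ => E.sub i]
  have h1 : (qBar q * (1 + 2 * (lam / q))) ^ (E.level K 2).card =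
      ∏ e ∈ allEdges n, if edgeMult E.T K e = 2 then qBar q * (1 + 2 * (lam / q)) else 1 := by
    rw [prod_ite, prod_const_one, mul_one, prod_const, level]
  have h2 : thProd Θ (E.level K 1) z =
      ∏ e ∈ allEdges n, if edgeMult E.T K e = 1 then symVal Θ (e.map z) else 1 := by
    rw [prod_ite, prod_const_one, mul_one, level, thProd]
  rw [h1, h2, ← prod_mul_distrib]
  refine prod_le_prod (fun e _ => ?_) fun e _ => ?_
  · exact (bernMoment_le h (E.edgeMult_le_two K e) (symVal_mem h.mem _).1 (symVal_mem h.mem _).2).1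
  · exact (bernMoment_le h (E.edgeMult_le_two K e) (symVal_mem h.mem _).1 (symVal_mem h.mem _).2).2

lemma le_condE (h : Regime n s q lam Θ D k A ξ) (K : Finset I) (hK : E.level K 1 = ∅)
    (z : Fin n → Fin n) :
    qBar q ^ (E.level K 2).card ≤ condE q Θ z (fun A => ∏ i ∈ K, edgeMonomial q (E.T i) A) := by
  classical
  rw [condE_prod_edgeMonomial h.symm q z E.T K fun i _ => E.sub i]
  have h1 : qBar q ^ (E.level K 2).card =
      ∏ e ∈ allEdges n, if edgeMult E.T K e = 2 then qBar q else 1 := by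
    rw [prod_ite, prod_const_one, mul_one, prod_const, level]
  rw [h1]
  refine prod_le_prod (fun e _ => ?_) fun e he => ?_
  · split_ifs
    · exact h.qBar_pos.le
    · norm_num
  · have h2 := E.edgeMult_le_two K e
    have h3 : edgeMult E.T K e ≠ 1 := by
      intro h3
      have : e ∈ E.level K 1 := mem_filter.2 ⟨he, h3⟩
      rw [hK] at this
      simp at this
    have h4 := (symVal_mem h.mem (e.map z)).1
    generalize edgeMult E.T K e = m at *
    interval_cases m
    · simp
    · exact absurd rfl h3
    · rw [bernMoment_two]
      simp only [if_true]
      nlinarith [h.q_le, h.q_pos]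

open scoped Classical in
/-- The block of a node: the member of the subfamily `P` that contains it. -/
def blockOf (v : Fin n) : Option {l // l ∈ E.P} :=
  if h : ∃ l : {l // l ∈ E.P}, v ∈ E.nodes l.1 then some h.choose else none

lemma blockOf_eq_some {v : Fin n} {l : {l // l ∈ E.P}} :
    E.blockOf v = some l ↔ v ∈ E.nodes l.1 := by
  unfold blockOf
  constructor
  · intro h
    split_ifs at h with h'
    have := h'.choose_spec
    rwa [Option.some_injective _ h] at this
  · intro h
    have h' : ∃ l : {l // l ∈ E.P}, v ∈ E.nodes l.1 := ⟨l, h⟩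
    rw [dif_pos h']
    congr 1
    by_contra hne
    exact Finset.disjoint_left.1 (E.disj_pure l.1 l.2 h'.choose.1 fun he => hne (Subtype.ext he)) h
      h'.choose_spec

lemma blockOf_eq_none {i : I} (hi : i ∉ E.P) {v : Fin n} (hv : v ∈ E.nodes i) :
    E.blockOf v = none := by
  unfold blockOf
  rw [dif_neg]
  rintro ⟨l, hl⟩
  exact Finset.disjoint_left.1 (E.disj_pure l.1 l.2 i fun h => hi (h ▸ l.2)) hl hv

lemma pairwiseDisjoint_pure : (E.P : Set I).PairwiseDisjoint E.T :=
  fun _ hi _ _ hne => E.disjoint_of_pure hi hne.symm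

/-- The edges that appear once in the product of the sets in `K` and in `P`. -/
def singleEdges (K : Finset I) : Finset (Sym2 (Fin n)) := E.level K 1 ∪ E.P.biUnion E.T

lemma disjoint_level_biUnion {K : Finset I} (hK : Disjoint K E.P) :
    Disjoint (E.level K 1) (E.P.biUnion E.T) := by
  rw [Finset.disjoint_left]
  intro e he he'
  obtain ⟨i, hi, hei⟩ := E.mem_level_one_iff he
  obtain ⟨l, hl, hel⟩ := mem_biUnion.1 he'
  exact Finset.disjoint_left.1 (E.disjoint_of_pure hl (by
    rintro rfl
    exact Finset.disjoint_left.1 hK hi hl)) hel hei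

lemma card_singleEdges {K : Finset I} (hK : Disjoint K E.P) :
    (E.singleEdges K).card = (E.level K 1).card + ∑ l ∈ E.P, (E.T l).card := by
  rw [singleEdges, card_union_of_disjoint (E.disjoint_level_biUnion hK),
    card_biUnion E.pairwiseDisjoint_pure]

variable [Fintype I] [DecidableEq I]

lemma sum_card_split {K : Finset I} (hK : K ⊆ E.Pᶜ) :
    ∑ i, (E.T i).card = (E.singleEdges K).card + ∑ i ∈ E.Pᶜ \ K, (E.T i).card +
      2 * (E.level K 2).card := by
  have hd : Disjoint K E.P := (disjoint_compl_left (a := E.P)).mono_left hK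
  have h1 := E.sum_card_eq K
  rw [E.card_singleEdges hd, ← sum_add_sum_compl E.P, ← sum_sdiff hK]
  omega

/-- Bound on the contribution of the expansion in which the factors outside `K` and `P` are
replaced by their expectations. -/
lemma abs_lat_condE_le (h : Regime n s q lam Θ D k A ξ) (htot : ∑ i, (E.T i).card ≤ 2 * D)
    {K : Finset I} (hK : K ⊆ E.Pᶜ) :
    |lat s (fun z => condE q Θ z (fun A => ∏ i ∈ K, edgeMonomial q (E.T i) A) *
        ∏ l ∈ E.P, (thProd Θ (E.T l) z - lat s (thProd Θ (E.T l))))| ≤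
      2 * qBar q ^ (E.level K 2).card * (6 * 4 ^ E.P.card) * (A * lam) ^ (E.singleEdges K).card *
        (A * ((k : ℝ) / n)) ^ grank (edgeGraph (E.singleEdges K)) * √(A / n) ^ E.P.card := by
  have hd : Disjoint K E.P := (disjoint_compl_left (a := E.P)).mono_left hK
  have hsplit := E.sum_card_split hK
  have hF : E.singleEdges K ⊆ allEdges n := by
    refine union_subset (filter_subset _ _) (biUnion_subset.2 fun l _ => E.sub l)
  have hBD : (univ.biUnion E.nodes).card ≤ 4 * D := by
    refine card_biUnion_le.trans ((sum_le_sum fun i _ => E.card_nodes_le i).trans ?_)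
    rw [← sum_mul]
    omega
  have hqb := h.qBar_pos
  have hratio : 0 ≤ lam / q := div_nonneg h.lam_nonneg h.q_pos.le
  -- The blocks are the sets of `P`, and the function of the other nodes is the conditional moment
  -- over `K`. Doubled edges give q̄ up to a total factor (1 + 2λ/q)^(2D) ≤ 2, whence the 2 in `Cg`.
  have key := h.abs_lat_le (B := univ.biUnion E.nodes) (b := E.blockOf)
    (fun v hv => by
      obtain ⟨l, hl⟩ := Option.ne_none_iff_exists'.1 hv
      exact mem_biUnion.2 ⟨l.1, mem_univ _, E.blockOf_eq_some.1 hl⟩)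
    (fun z => condE q Θ z (fun A => ∏ i ∈ K, edgeMonomial q (E.T i) A))
    (fun l z => thProd Θ (E.T l.1) z) ?_ ?_ (fun z => E.condE_nonneg h K z)
    (fun l z => thProd_nonneg h.mem _ _) hBD (Cg := 2 * qBar q ^ (E.level K 2).card) (by positivity)
    (E.singleEdges K) hF (by omega) ?_ ?_
  · have e1 : ∀ z, ∏ l : {l // l ∈ E.P}, (thProd Θ (E.T l.1) z - lat s (thProd Θ (E.T l.1))) =
        ∏ l ∈ E.P, (thProd Θ (E.T l) z - lat s (thProd Θ (E.T l))) := fun z =>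
      prod_coe_sort E.P fun l => thProd Θ (E.T l) z - lat s (thProd Θ (E.T l))
    simp only [e1, Fintype.card_coe] at key
    exact key
  · intro z z' hzz
    simp only [condE_prod_edgeMonomial h.symm q _ E.T K fun i _ => E.sub i]
    refine prod_congr rfl fun e _ => ?_
    by_cases h0 : edgeMult E.T K e = 0
    · simp [h0]
    · classical
      rw [edgeMult] at h0
      obtain ⟨i, hi⟩ := card_pos.1 (Nat.pos_of_ne_zero h0)
      obtain ⟨hiK, hei⟩ := mem_filter.1 hi
      congr 2
      refine Sym2.map_congr fun v hv => ?_
      have hv' := E.mem_nodes i e hei v hv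
      exact hzz v (mem_biUnion.2 ⟨i, mem_univ _, hv'⟩)
        (E.blockOf_eq_none (Finset.disjoint_left.1 hd hiK) hv')
  · intro l z z' hzz
    refine prod_congr rfl fun e he => ?_
    congr 1
    exact Sym2.map_congr fun v hv => hzz v (E.blockOf_eq_some.2 (E.mem_nodes _ e he v hv))
  · intro u v huv
    have he : s(u, v) ∈ E.singleEdges K := by simpa using huv.1
    rcases mem_union.1 he with he | he
    · obtain ⟨i, hi, hei⟩ := E.mem_level_one_iff he
      have hu := E.mem_nodes i _ hei u (Sym2.mem_mk_left u v)
      have hv := E.mem_nodes i _ hei v (Sym2.mem_mk_right u v)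
      have hiP := Finset.disjoint_left.1 hd hi
      exact ⟨mem_biUnion.2 ⟨i, mem_univ _, hu⟩, by
        rw [E.blockOf_eq_none hiP hu, E.blockOf_eq_none hiP hv]⟩
    · obtain ⟨l, hl, hel⟩ := mem_biUnion.1 he
      have hu := E.mem_nodes l _ hel u (Sym2.mem_mk_left u v)
      have hv := E.mem_nodes l _ hel v (Sym2.mem_mk_right u v)
      exact ⟨mem_biUnion.2 ⟨l, mem_univ _, hu⟩, by
        rw [E.blockOf_eq_some (l := ⟨l, hl⟩) |>.2 hu, E.blockOf_eq_some (l := ⟨l, hl⟩) |>.2 hv]⟩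
  · intro z
    have e1 : ∏ l : {l // l ∈ E.P}, thProd Θ (E.T l.1) z = ∏ l ∈ E.P, thProd Θ (E.T l) z :=
      prod_coe_sort E.P fun l => thProd Θ (E.T l) z
    have e2 : thProd Θ (E.singleEdges K) z =
        thProd Θ (E.level K 1) z * ∏ l ∈ E.P, thProd Θ (E.T l) z := by
      rw [thProd, singleEdges, prod_union (E.disjoint_level_biUnion hd),
        prod_biUnion E.pairwiseDisjoint_pure]
      rfl
    rw [e1, e2, ← mul_assoc]
    refine mul_le_mul_of_nonneg_right ((E.condE_le h K z).trans ?_)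
      (prod_nonneg fun l _ => thProd_nonneg h.mem _ _)
    refine mul_le_mul_of_nonneg_right ?_ (thProd_nonneg h.mem _ _)
    rw [mul_pow, mul_comm]
    refine mul_le_mul_of_nonneg_right ?_ (by positivity)
    calc (1 + 2 * (lam / q)) ^ (E.level K 2).card ≤ (1 + 2 * (lam / q)) ^ (2 * D) :=
          pow_le_pow_right₀ (by linarith) (by omega)
      _ ≤ 2 := by linarith [h.lam_le, h.ξ_le_one]

end EdgeSystem

end TermBound

/-! ### Correlation of products of centred monomials. -/

section ProductBound

open Finset

variable {n : ℕ} {s : Sampling} {q lam : ℝ} {Θ : Matrix (Fin n) (Fin n) ℝ} {D k : ℕ} {A ξ : ℝ}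

lemma edgeGraph_union {V : Type*} [DecidableEq V] (F F' : Finset (Sym2 V)) :
    edgeGraph (F ∪ F') = edgeGraph F ⊔ edgeGraph F' := by
  rw [edgeGraph, coe_union, SimpleGraph.fromEdgeSet_union]

lemma edgeGraph_mono {V : Type*} {F F' : Finset (Sym2 V)} (h : F ⊆ F') :
    edgeGraph F ≤ edgeGraph F' := SimpleGraph.fromEdgeSet_mono (by exact_mod_cast h)

lemma grank_biUnion_le {V ι : Type*} [Finite V] [DecidableEq V] [DecidableEq ι] (S : Finset ι)
    (T : ι → Finset (Sym2 V)) :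
    grank (edgeGraph (S.biUnion T)) ≤ ∑ i ∈ S, grank (edgeGraph (T i)) := by
  induction S using Finset.induction_on with
  | empty => exact grank_edgeGraph_le_card _
  | insert i S hi ih =>
    rw [biUnion_insert, sum_insert hi, edgeGraph_union]
    exact (grank_sup_le _ _).trans (Nat.add_le_add_left ih _)

/-- Every unit of rank is charged to its own edge through `rank_le`, using k/n = (k/√n)(1/√n); the
other edges are paid by `edge_le`. As r ≤ e, the factors 4^r and √A^r fit into (4A)^e. -/
lemma Regime.numeric (h : Regime n s q lam Θ D k A ξ) {e R R₀ r m : ℕ} (hR : R ≤ e) (hr : r ≤ e)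
    (hR₀ : R₀ ≤ R) :
    2 * qBar q ^ m * (6 * 4 ^ r) * (A * lam) ^ e * (A * ((k : ℝ) / n)) ^ R * √(A / n) ^ r ≤
      12 * √(qBar q) ^ (e + 2 * m) * (ξ ^ 2) ^ e * (1 / √n) ^ (R₀ + r) := by
  have hA := h.one_le_A
  have hn := h.n_pos
  have hqb := h.qBar_pos
  have hlam := h.lam_nonneg
  have hn1 : (1 : ℝ) ≤ n := by linarith [h.A_le]
  have hsn : 1 ≤ √(n : ℝ) := Real.one_le_sqrt.2 hn1
  have hsn0 : 0 < √(n : ℝ) := by linarith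
  have hinv : 1 / √(n : ℝ) ≤ 1 := (div_le_one hsn0).2 hsn
  have h4 : (4 : ℝ) ^ r * √A ^ r ≤ (4 * A) ^ e := by
    rw [← mul_pow]
    calc (4 * √A) ^ r ≤ (4 * A) ^ r := by
          gcongr
          exact Real.sqrt_le_iff.2 ⟨by linarith, by nlinarith⟩
      _ ≤ _ := pow_le_pow_right₀ (by linarith) hr
  have h5 : (4 * A * (A * lam)) ^ e * (A * k / √n) ^ R ≤ (√(qBar q) * ξ ^ 2) ^ e := by
    obtain ⟨d, rfl⟩ := Nat.exists_eq_add_of_le hR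
    calc (4 * A * (A * lam)) ^ (R + d) * (A * k / √n) ^ R =
          (4 * A * (A * lam) * (A * k / √n)) ^ R * (4 * A * (A * lam)) ^ d := by
          rw [pow_add, mul_pow (4 * A * (A * lam)) (A * k / √n)]; ring
      _ ≤ (√(qBar q) * ξ ^ 2) ^ R * (√(qBar q) * ξ ^ 2) ^ d := by
          have hk : 0 ≤ A * k / √n := by positivity
          exact mul_le_mul (pow_le_pow_left₀ (by positivity) h.rank_le R)
            (pow_le_pow_left₀ (by positivity) h.edge_le d) (by positivity) (by positivity)
      _ = _ := (pow_add _ _ _).symm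
  have hy : A * ((k : ℝ) / n) = A * k / √n * (1 / √n) := by
    rw [div_mul_div_comm, Real.mul_self_sqrt hn.le]; ring
  have hAn : √(A / n) = √A * (1 / √n) := by
    rw [Real.sqrt_div (by linarith)]; ring
  rw [hy, hAn, mul_pow (A * k / √n), mul_pow √A, pow_add √(qBar q), pow_mul √(qBar q) 2,
    Real.sq_sqrt hqb.le, pow_add (1 / √(n : ℝ))]
  calc _ = 12 * qBar q ^ m * (1 / √(n : ℝ)) ^ r * (1 / √(n : ℝ)) ^ R *
        (((4 : ℝ) ^ r * √A ^ r) * (A * lam) ^ e * (A * k / √n) ^ R) := by ring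
    _ ≤ 12 * qBar q ^ m * (1 / √(n : ℝ)) ^ r * (1 / √(n : ℝ)) ^ R₀ *
        ((4 * A) ^ e * (A * lam) ^ e * (A * k / √n) ^ R) := by
        gcongr ?_ * ?_
        · gcongr 12 * qBar q ^ m * (1 / √(n : ℝ)) ^ r * ?_
          exact pow_le_pow_of_le_one (by positivity) hinv hR₀
        · gcongr
    _ ≤ 12 * qBar q ^ m * (1 / √(n : ℝ)) ^ r * (1 / √(n : ℝ)) ^ R₀ * (√(qBar q) * ξ ^ 2) ^ e := by
        rw [← mul_pow]
        gcongr
    _ = _ := by rw [mul_pow]; ring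

namespace EdgeSystem

variable {I : Type*} [Fintype I] [DecidableEq I] (E : EdgeSystem n I)

/-- Only the factors outside `P` are expanded. Edges of a set in `P` occur nowhere else, so
conditioning on `z` turns its factor into a centred function of its own block, and the gain from
centring survives. -/
lemma expect_prod_sub (h : Regime n s q lam Θ D k A ξ) :
    expect s q Θ (fun _ A => ∏ i, (edgeMonomial q (E.T i) A - lat s (thProd Θ (E.T i)))) =
      ∑ K ∈ E.Pᶜ.powerset, (∏ i ∈ E.Pᶜ \ K, -lat s (thProd Θ (E.T i))) *
        lat s (fun z => condE q Θ z (fun A => ∏ i ∈ K, edgeMonomial q (E.T i) A) *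
        ∏ l ∈ E.P, (thProd Θ (E.T l) z - lat s (thProd Θ (E.T l)))) := by
  rw [expect_eq_lat]
  simp only [← lat_const_mul]
  rw [← lat_sum]
  congr 1
  funext z
  have h1 : ∀ A, ∏ i, (edgeMonomial q (E.T i) A - lat s (thProd Θ (E.T i))) =
      ∑ K ∈ E.Pᶜ.powerset, (∏ i ∈ E.Pᶜ \ K, -lat s (thProd Θ (E.T i))) *
        ((∏ i ∈ K, edgeMonomial q (E.T i) A) *
          ∏ l ∈ E.P, (edgeMonomial q (E.T l) A - lat s (thProd Θ (E.T l)))) := by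
    intro A
    rw [← prod_mul_prod_compl E.P, mul_comm]
    simp only [sub_eq_add_neg]
    rw [prod_add, sum_mul]
    refine sum_congr rfl fun K _ => ?_
    ring
  simp only [h1]
  rw [condE_sum]
  refine sum_congr rfl fun K hK => ?_
  have hd : Disjoint E.P K := (disjoint_compl_right (a := E.P)).mono_right (mem_powerset.1 hK)
  rw [condE_const_mul, condE_prod_sub h.symm q z E.T E.sub _ E.P K hd]
  intro l hl i _ hne
  exact E.disjoint_of_pure hl hne

/-- Here e counts the edges carrying λ: those simple in `K` or `P`, and those of the factors
replaced by their means. Together they cover the edges of multiplicity one, so by subadditivity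
their ranks dominate the rank required. -/
lemma abs_term_le (h : Regime n s q lam Θ D k A ξ) (htot : ∑ i, (E.T i).card ≤ 2 * D)
    {K : Finset I} (hK : K ⊆ E.Pᶜ) :
    ∃ e : ℕ, (E.level univ 1).card ≤ e ∧ (E.Pᶜ \ K).card ≤ e ∧
      |(∏ i ∈ E.Pᶜ \ K, -lat s (thProd Θ (E.T i))) *
        lat s (fun z => condE q Θ z (fun A => ∏ i ∈ K, edgeMonomial q (E.T i) A) *
        ∏ l ∈ E.P, (thProd Θ (E.T l) z - lat s (thProd Θ (E.T l))))| ≤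
      12 * √(qBar q) ^ (∑ i, (E.T i).card) * (ξ ^ 2) ^ e *
        (1 / √n) ^ (grank (edgeGraph (E.level univ 1)) + E.P.card) := by
  have hd : Disjoint K E.P := (disjoint_compl_left (a := E.P)).mono_left hK
  have hsplit := E.sum_card_split hK
  have hcover : E.level univ 1 ⊆ E.singleEdges K ∪ (E.Pᶜ \ K).biUnion E.T := by
    intro e he
    obtain ⟨i, -, hi⟩ := E.mem_level_one_iff he
    by_cases hP : i ∈ E.P
    · exact mem_union_left _ (mem_union_right _ (mem_biUnion.2 ⟨i, hP, hi⟩))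
    by_cases hiK : i ∈ K
    · refine mem_union_left _ (mem_union_left _ (mem_filter.2 ⟨(mem_filter.1 he).1, ?_⟩))
      have h1 := (mem_filter.1 he).2
      classical
      rw [edgeMult] at h1 ⊢
      have h2 : (K.filter fun i => e ∈ E.T i).card ≤ (univ.filter fun i => e ∈ E.T i).card :=
        card_le_card (filter_subset_filter _ (subset_univ _))
      have h3 : 0 < (K.filter fun i => e ∈ E.T i).card :=
        card_pos.2 ⟨i, mem_filter.2 ⟨hiK, hi⟩⟩
      omega
    · exact mem_union_right _ (mem_biUnion.2 ⟨i, by simp [hP, hiK], hi⟩)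
  have hcardrem : (E.Pᶜ \ K).card ≤ ∑ i ∈ E.Pᶜ \ K, (E.T i).card := by
    rw [card_eq_sum_ones]
    exact sum_le_sum fun i _ => card_pos.2 (E.nonempty i)
  have hcardP : E.P.card ≤ ∑ i ∈ E.P, (E.T i).card := by
    rw [card_eq_sum_ones]
    exact sum_le_sum fun i _ => card_pos.2 (E.nonempty i)
  have hse := E.card_singleEdges hd
  refine ⟨(E.singleEdges K).card + ∑ i ∈ E.Pᶜ \ K, (E.T i).card, ?_, by omega, ?_⟩
  · exact (card_le_card hcover).trans ((card_union_le _ _).trans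
      (Nat.add_le_add_left card_biUnion_le _))
  have hmu : ∀ i, 0 ≤ lat s (thProd Θ (E.T i)) ∧ lat s (thProd Θ (E.T i)) ≤
      (A * lam) ^ (E.T i).card * (A * ((k : ℝ) / n)) ^ grank (edgeGraph (E.T i)) := by
    intro i
    refine ⟨lat_nonneg _ fun z => thProd_nonneg h.mem _ _, h.star _ (E.sub i) ?_⟩
    exact (single_le_sum (f := fun i => (E.T i).card) (fun _ _ => Nat.zero_le _)
      (mem_univ i)).trans htot
  have hprod : |∏ i ∈ E.Pᶜ \ K, -lat s (thProd Θ (E.T i))| ≤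
      (A * lam) ^ (∑ i ∈ E.Pᶜ \ K, (E.T i).card) *
        (A * ((k : ℝ) / n)) ^ (∑ i ∈ E.Pᶜ \ K, grank (edgeGraph (E.T i))) := by
    rw [abs_prod, ← prod_pow_eq_pow_sum, ← prod_pow_eq_pow_sum, ← prod_mul_distrib]
    refine prod_le_prod (fun i _ => abs_nonneg _) fun i _ => ?_
    rw [abs_neg, abs_of_nonneg (hmu i).1]
    exact (hmu i).2
  have hA := h.one_le_A
  have hlam := h.lam_nonneg
  rw [abs_mul]
  refine (mul_le_mul hprod (E.abs_lat_condE_le h htot hK) (abs_nonneg _) (by positivity)).trans ?_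
  have hnum := h.numeric (e := (E.singleEdges K).card + ∑ i ∈ E.Pᶜ \ K, (E.T i).card)
    (R := grank (edgeGraph (E.singleEdges K)) + ∑ i ∈ E.Pᶜ \ K, grank (edgeGraph (E.T i)))
    (R₀ := grank (edgeGraph (E.level univ 1))) (r := E.P.card) (m := (E.level K 2).card)
    (Nat.add_le_add (grank_edgeGraph_le_card _)
      (sum_le_sum fun i _ => grank_edgeGraph_le_card _))
    (by omega) (by
      refine (grank_mono (edgeGraph_mono hcover)).trans ?_
      rw [edgeGraph_union]
      exact (grank_sup_le _ _).trans (Nat.add_le_add_left (grank_biUnion_le _ _) _))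
  rw [hsplit]
  refine le_trans (le_of_eq ?_) hnum
  ring

lemma sum_powerset_le (h : Regime n s q lam Θ D k A ξ) (htot : ∑ i, (E.T i).card ≤ 2 * D)
    (S : Finset I) : ∑ K ∈ S.powerset, ξ ^ (S \ K).card ≤ 2 := by
  have h1 : ∑ K ∈ S.powerset, ξ ^ (S \ K).card = (1 + ξ) ^ S.card := by
    rw [← sum_pow_mul_eq_add_pow]
    refine sum_congr rfl fun K hK => ?_
    rw [one_pow, one_mul, card_sdiff_of_subset (mem_powerset.1 hK)]
  have hS : S.card ≤ 2 * D := by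
    refine le_trans (card_le_univ S) (le_trans ?_ htot)
    rw [← card_univ, card_eq_sum_ones]
    exact sum_le_sum fun i _ => card_pos.2 (E.nonempty i)
  have hξ := h.ξ_pos
  rw [h1]
  calc (1 + ξ) ^ S.card ≤ (1 + ξ) ^ (2 * D) := pow_le_pow_right₀ (by linarith) hS
    _ ≤ (Real.exp ξ) ^ (2 * D) := by
        gcongr
        rw [add_comm]; exact Real.add_one_le_exp ξ
    _ = Real.exp (2 * D * ξ) := by rw [← Real.exp_nat_mul]; push_cast; rfl
    _ ≤ Real.exp (1 / 2) := Real.exp_le_exp.2 (by linarith [h.ξ_le])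
    _ ≤ 2 := by
        rw [← Real.le_log_iff_exp_le (by norm_num)]
        linarith [Real.log_two_gt_d9]

/-- Correlation bound for products of centred monomials. -/
lemma abs_expect_prod_sub_le (h : Regime n s q lam Θ D k A ξ) (htot : ∑ i, (E.T i).card ≤ 2 * D)
    {u : ℕ} (hu : u ≤ grank (edgeGraph (E.level univ 1)) + E.P.card) :
    |expect s q Θ (fun _ A => ∏ i, (edgeMonomial q (E.T i) A - lat s (thProd Θ (E.T i))))| ≤
      24 * √(qBar q) ^ (∑ i, (E.T i).card) * ξ ^ (E.level univ 1).card * (1 / √n) ^ u := by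
  have hξ := h.ξ_pos
  have hn1 : (1 : ℝ) ≤ n := by linarith [h.A_le, h.one_le_A]
  have hsn : 1 ≤ √(n : ℝ) := Real.one_le_sqrt.2 hn1
  have hinv : 1 / √(n : ℝ) ≤ 1 := (div_le_one (by linarith)).2 hsn
  rw [E.expect_prod_sub h]
  refine (abs_sum_le_sum_abs _ _).trans ?_
  calc _ ≤ ∑ K ∈ E.Pᶜ.powerset, 12 * √(qBar q) ^ (∑ i, (E.T i).card) *
        ξ ^ (E.level univ 1).card * (1 / √n) ^ u * ξ ^ (E.Pᶜ \ K).card := by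
        refine sum_le_sum fun K hK => ?_
        obtain ⟨e, h1, h2, h3⟩ := E.abs_term_le h htot (mem_powerset.1 hK)
        refine h3.trans ?_
        have h4 : (ξ ^ 2) ^ e ≤ ξ ^ (E.level univ 1).card * ξ ^ (E.Pᶜ \ K).card := by
          rw [← pow_add, ← pow_mul]
          exact pow_le_pow_of_le_one hξ.le h.ξ_le_one (by omega)
        calc _ ≤ 12 * √(qBar q) ^ (∑ i, (E.T i).card) *
              (ξ ^ (E.level univ 1).card * ξ ^ (E.Pᶜ \ K).card) * (1 / √n) ^ u := by
              gcongr ?_ * ?_ * ?_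
              exact pow_le_pow_of_le_one (by positivity) hinv hu
          _ = _ := by ring
    _ ≤ 12 * √(qBar q) ^ (∑ i, (E.T i).card) *
        ξ ^ (E.level univ 1).card * (1 / √n) ^ u * 2 := by
        rw [← mul_sum]
        gcongr
        exact E.sum_powerset_le h htot _
    _ = _ := by ring

/-- Variance bound for products of centred monomials in which every edge appears twice. -/
lemma abs_expect_prod_sub_sub_le (h : Regime n s q lam Θ D k A ξ)
    (htot : ∑ i, (E.T i).card ≤ 2 * D) (hP : E.P = ∅) (hl : E.level univ 1 = ∅) {m : ℕ}
    (hm : ∑ i, (E.T i).card = 2 * m) :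
    |expect s q Θ (fun _ A => ∏ i, (edgeMonomial q (E.T i) A - lat s (thProd Θ (E.T i)))) -
      qBar q ^ m| ≤ 25 * ξ * qBar q ^ m := by
  have hξ := h.ξ_pos
  have hqb := h.qBar_pos
  have hratio : 0 ≤ lam / q := div_nonneg h.lam_nonneg h.q_pos.le
  have hn1 : (1 : ℝ) ≤ n := by linarith [h.A_le, h.one_le_A]
  have hsn : 1 ≤ √(n : ℝ) := Real.one_le_sqrt.2 hn1
  have hinv : 1 / √(n : ℝ) ≤ 1 := (div_le_one (by linarith)).2 hsn
  have hm2 : (E.level univ 2).card = m := by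
    have := E.sum_card_eq univ
    rw [hl, card_empty] at this
    omega
  have hsq : √(qBar q) ^ (∑ i, (E.T i).card) = qBar q ^ m := by
    rw [hm, pow_mul, Real.sq_sqrt hqb.le]
  -- The term K = univ is the uncentred moment, within a relative error ξ of q̄^m. Every other term
  -- replaces at least one factor, hence e ≥ 1 and one ξ is left over after the sum over `K`. The
  -- constant is 25 = 24 + 1.
  rw [E.expect_prod_sub h, hP, compl_empty, ← sum_erase_add _ _ (mem_powerset_self univ)]
  set X := ∑ K ∈ (univ : Finset I).powerset.erase univ,
    (∏ i ∈ univ \ K, -lat s (thProd Θ (E.T i))) *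
        lat s (fun z => condE q Θ z (fun A => ∏ i ∈ K, edgeMonomial q (E.T i) A) *
        ∏ l ∈ (∅ : Finset I), (thProd Θ (E.T l) z - lat s (thProd Θ (E.T l)))) with hX
  have hXle : |X| ≤ 24 * ξ * qBar q ^ m := by
    refine (abs_sum_le_sum_abs _ _).trans ?_
    calc _ ≤ ∑ K ∈ (univ : Finset I).powerset.erase univ,
          12 * qBar q ^ m * ξ * ξ ^ (univ \ K).card := by
          refine sum_le_sum fun K hK => ?_
          have hKu : (univ \ K).card ≠ 0 := by
            intro h0
            rw [card_eq_zero, sdiff_eq_empty_iff_subset, univ_subset_iff] at h0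
            exact (mem_erase.1 hK).1 h0
          obtain ⟨e, h1, h2, h3⟩ := E.abs_term_le h htot (K := K) (by rw [hP]; simp)
          rw [hP, compl_empty] at h2 h3
          refine h3.trans ?_
          rw [hsq]
          have h4 : (ξ ^ 2) ^ e ≤ ξ * ξ ^ (univ \ K).card := by
            rw [← pow_succ', ← pow_mul]
            exact pow_le_pow_of_le_one hξ.le h.ξ_le_one (by omega)
          calc _ ≤ 12 * qBar q ^ m * (ξ * ξ ^ (univ \ K).card) * 1 := by
                gcongr
                exact pow_le_one₀ (by positivity) hinv
            _ = _ := by ring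
      _ ≤ ∑ K ∈ (univ : Finset I).powerset, 12 * qBar q ^ m * ξ * ξ ^ (univ \ K).card :=
          sum_le_sum_of_subset_of_nonneg (erase_subset _ _) fun _ _ _ => by positivity
      _ ≤ 12 * qBar q ^ m * ξ * 2 := by
          rw [← mul_sum]
          gcongr
          exact E.sum_powerset_le h htot _
      _ = _ := by ring
  have hmain : |lat s (fun z => condE q Θ z (fun A => ∏ i, edgeMonomial q (E.T i) A)) -
      qBar q ^ m| ≤ ξ * qBar q ^ m := by
    have hc : ∀ c : ℝ, lat s (fun _ : Fin n → Fin n => c) = c := by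
      intro c
      have := lat_const_mul (n := n) s c fun _ => 1
      simpa [lat_one h.n_ne_zero] using this
    have hlo : qBar q ^ m ≤ lat s (fun z => condE q Θ z (fun A => ∏ i, edgeMonomial q (E.T i) A)) := by
      rw [← hc (qBar q ^ m)]
      refine lat_mono _ fun z => ?_
      rw [← hm2]
      exact E.le_condE h univ hl z
    have hhi : lat s (fun z => condE q Θ z (fun A => ∏ i, edgeMonomial q (E.T i) A)) ≤
        qBar q ^ m * (1 + ξ) := by
      rw [← hc (qBar q ^ m * (1 + ξ))]
      refine lat_mono _ fun z => (E.condE_le h univ z).trans ?_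
      rw [hl, thProd, prod_empty, mul_one, mul_pow, hm2]
      gcongr
      refine le_trans (pow_le_pow_right₀ (by linarith) ?_) h.lam_le
      omega
    rw [abs_le]
    constructor <;> nlinarith
  simp only [prod_empty, one_mul, mul_one, Finset.sdiff_self]
  calc _ = |X + (lat s (fun z => condE q Θ z (fun A => ∏ i, edgeMonomial q (E.T i) A)) -
        qBar q ^ m)| := by rw [add_sub_assoc]
    _ ≤ |X| + _ := abs_add_le _ _
    _ ≤ 24 * ξ * qBar q ^ m + ξ * qBar q ^ m := add_le_add hXle hmain
    _ = _ := by ring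

end EdgeSystem

end ProductBound

/-! ### Connected components of pairs of labelled graphs. -/

section ComponentSystem

open Finset
open scoped Classical

variable {n : ℕ} {s : Sampling} {q lam : ℝ} {Θ : Matrix (Fin n) (Fin n) ℝ} {D k : ℕ} {A ξ : ℝ}

/-- The connected components that contain an edge. -/
abbrev NontrivialComp {V : Type*} (H : SimpleGraph V) : Type _ :=
  {c : H.ConnectedComponent // c.supp.Nontrivial}

/-- The edges of a component. -/
def compEdges (H : SimpleGraph (Fin n)) (c : H.ConnectedComponent) : Finset (Sym2 (Fin n)) :=
  H.edgeFinset.filter fun e => ∀ v ∈ e, v ∈ c.supp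

lemma mk_mem_compEdges {H : SimpleGraph (Fin n)} {c : H.ConnectedComponent} {a b : Fin n} :
    s(a, b) ∈ compEdges H c ↔ H.Adj a b ∧ H.connectedComponentMk a = c := by
  rw [compEdges, mem_filter, SimpleGraph.mem_edgeFinset, SimpleGraph.mem_edgeSet]
  refine and_congr_right fun hab => ?_
  simp only [Sym2.mem_iff, forall_eq_or_imp, forall_eq, SimpleGraph.ConnectedComponent.mem_supp_iff]
  have : H.connectedComponentMk a = H.connectedComponentMk b :=
    SimpleGraph.ConnectedComponent.sound hab.reachable
  rw [← this]
  tauto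

lemma compEdges_subset (H : SimpleGraph (Fin n)) (c : H.ConnectedComponent) :
    compEdges H c ⊆ allEdges n := by
  intro e he
  rw [allEdges, mem_filter]
  exact ⟨mem_univ _, H.not_isDiag_of_mem_edgeSet
    (SimpleGraph.mem_edgeFinset.1 (mem_filter.1 he).1)⟩

lemma exists_adj_of_nontrivial {V : Type*} {H : SimpleGraph V} {c : H.ConnectedComponent}
    (hc : c.supp.Nontrivial) {v : V} (hv : v ∈ c.supp) : ∃ w, H.Adj v w := by
  obtain ⟨w, hw, hne⟩ := hc.exists_ne v
  have hr : H.Reachable v w := SimpleGraph.ConnectedComponent.exact (hv.trans hw.symm)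
  obtain ⟨p⟩ := hr
  cases p with
  | nil => exact absurd rfl hne
  | cons h _ => exact ⟨_, h⟩

lemma nontrivial_of_adj {V : Type*} {H : SimpleGraph V} {a b : V} (h : H.Adj a b) :
    (H.connectedComponentMk a).supp.Nontrivial :=
  ⟨a, rfl, b, (SimpleGraph.ConnectedComponent.sound h.reachable).symm, h.ne⟩

lemma card_filter_mem_compEdges (H : SimpleGraph (Fin n)) (e : Sym2 (Fin n)) :
    ((univ : Finset (NontrivialComp H)).filter fun c => e ∈ compEdges H c.1).card =
      if e ∈ H.edgeFinset then 1 else 0 := by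
  induction e with
  | _ a b =>
    simp only [mk_mem_compEdges, SimpleGraph.mem_edgeFinset, SimpleGraph.mem_edgeSet]
    split_ifs with h
    · rw [card_eq_one]
      refine ⟨⟨_, nontrivial_of_adj h⟩, ?_⟩
      ext c
      simp only [mem_filter, mem_univ, true_and, mem_singleton, h, Subtype.ext_iff]
      exact eq_comm
    · simp [h]

lemma sum_card_compEdges (H : SimpleGraph (Fin n)) :
    ∑ c : NontrivialComp H, (compEdges H c.1).card = H.edgeFinset.card := by
  have h1 : ∀ c : NontrivialComp H, (compEdges H c.1).card =
      ∑ e : Sym2 (Fin n), if e ∈ compEdges H c.1 then 1 else 0 := fun c => by simp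
  simp only [h1]
  rw [sum_comm]
  simp only [← card_filter, card_filter_mem_compEdges]
  rw [filter_mem_eq_inter, univ_inter]

/-- The product of the centred monomials of the components of a labelled graph. -/
def centeredProd (s : Sampling) (q : ℝ) (Θ : Matrix (Fin n) (Fin n) ℝ) (H A : SimpleGraph (Fin n)) :
    ℝ :=
  ∏ c : NontrivialComp H,
    (edgeMonomial q (compEdges H c.1) A - lat s (thProd Θ (compEdges H c.1)))

lemma disjoint_toFinset_supp {V : Type*} {H : SimpleGraph V} {c c' : H.ConnectedComponent}
    [Fintype c.supp] [Fintype c'.supp] (h : c ≠ c') : Disjoint c.supp.toFinset c'.supp.toFinset := by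
  rw [disjoint_left]
  intro v h1 h2
  rw [Set.mem_toFinset, SimpleGraph.ConnectedComponent.mem_supp_iff] at h1 h2
  exact h (h1.symm.trans h2)

/-- The edge system of the components of two labelled graphs. The distinguished components are those
that avoid the other graph. -/
def pairSystem (H H' : SimpleGraph (Fin n)) : EdgeSystem n (NontrivialComp H ⊕ NontrivialComp H') where
  T := Sum.elim (fun c => compEdges H c.1) fun c => compEdges H' c.1
  nodes := Sum.elim (fun c => c.1.supp.toFinset) fun c => c.1.supp.toFinset
  side := Sum.isLeft
  P := univ.filter fun i => Sum.elim (fun c => Disjoint c.1.supp H'.support)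
    (fun c => Disjoint c.1.supp H.support) i
  sub := by
    rintro (c | c)
    · exact compEdges_subset _ _
    · exact compEdges_subset _ _
  nonempty := by
    rintro (⟨c, hc⟩ | ⟨c, hc⟩) <;>
    · obtain ⟨v, hv⟩ := hc.nonempty
      obtain ⟨w, hw⟩ := exists_adj_of_nontrivial hc hv
      exact ⟨s(v, w), mk_mem_compEdges.2 ⟨hw, hv⟩⟩
  mem_nodes := by
    rintro (c | c) e he v hv <;>
    · exact Set.mem_toFinset.2 ((mem_filter.1 he).2 v hv)
  cover := by
    rintro (⟨c, hc⟩ | ⟨c, hc⟩) v hv <;>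
    · have hv' := Set.mem_toFinset.1 hv
      obtain ⟨w, hw⟩ := exists_adj_of_nontrivial hc hv'
      exact ⟨s(v, w), mk_mem_compEdges.2 ⟨hw, hv'⟩, Sym2.mem_mk_left _ _⟩
  disj_side := by
    rintro (c | c) (c' | c') hne hs
    · exact disjoint_toFinset_supp (c := c.1) (c' := c'.1) fun h => hne (by rw [Subtype.ext h])
    · exact Bool.noConfusion hs
    · exact Bool.noConfusion hs
    · exact disjoint_toFinset_supp (c := c.1) (c' := c'.1) fun h => hne (by rw [Subtype.ext h])
  disj_pure := by
    rintro (c | c) hl (c' | c') hne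
    · exact disjoint_toFinset_supp (c := c.1) (c' := c'.1) fun h => hne (by rw [Subtype.ext h])
    · have hd : Disjoint c.1.supp H'.support := (mem_filter.1 hl).2
      refine disjoint_left.2 fun v h1 h2 => Set.disjoint_left.1 hd (Set.mem_toFinset.1 h1) ?_
      exact exists_adj_of_nontrivial c'.2 (Set.mem_toFinset.1 h2)
    · have hd : Disjoint c.1.supp H.support := (mem_filter.1 hl).2
      refine disjoint_left.2 fun v h1 h2 => Set.disjoint_left.1 hd (Set.mem_toFinset.1 h1) ?_
      exact exists_adj_of_nontrivial c'.2 (Set.mem_toFinset.1 h2)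
    · exact disjoint_toFinset_supp (c := c.1) (c' := c'.1) fun h => hne (by rw [Subtype.ext h])

lemma prod_pairSystem (H H' A : SimpleGraph (Fin n)) :
    ∏ i, (edgeMonomial q ((pairSystem H H').T i) A - lat s (thProd Θ ((pairSystem H H').T i))) =
      centeredProd s q Θ H A * centeredProd s q Θ H' A := by
  rw [Fintype.prod_sum_type]
  rfl

lemma sum_card_pairSystem (H H' : SimpleGraph (Fin n)) :
    ∑ i, ((pairSystem H H').T i).card = H.edgeFinset.card + H'.edgeFinset.card := by
  rw [Fintype.sum_sum_type, ← sum_card_compEdges H, ← sum_card_compEdges H']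
  rfl

lemma level_one_pairSystem (H H' : SimpleGraph (Fin n)) :
    (pairSystem H H').level univ 1 = H.edgeFinset ∆ H'.edgeFinset := by
  ext e
  have h1 : edgeMult (pairSystem H H').T univ e =
      (if e ∈ H.edgeFinset then 1 else 0) + if e ∈ H'.edgeFinset then 1 else 0 := by
    rw [edgeMult, card_filter, Fintype.sum_sum_type, ← card_filter_mem_compEdges,
      ← card_filter_mem_compEdges, card_filter, card_filter]
    rfl
  rw [EdgeSystem.level, mem_filter, h1, mem_symmDiff]
  have h2 : ∀ K : SimpleGraph (Fin n), e ∈ K.edgeFinset → e ∈ allEdges n := fun K hK =>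
    mem_filter.2 ⟨mem_univ _, K.not_isDiag_of_mem_edgeSet (SimpleGraph.mem_edgeFinset.1 hK)⟩
  have h3 := h2 H
  have h4 := h2 H'
  by_cases ha : e ∈ H.edgeFinset <;> by_cases hb : e ∈ H'.edgeFinset <;> simp_all

lemma edgeGraph_symmDiff (H H' : SimpleGraph (Fin n)) :
    edgeGraph (H.edgeFinset ∆ H'.edgeFinset) = H ∆ H' := by
  ext a b
  rw [edgeGraph, SimpleGraph.fromEdgeSet_adj, mem_coe, mem_symmDiff]
  simp only [SimpleGraph.mem_edgeFinset, SimpleGraph.mem_edgeSet, symmDiff, SimpleGraph.sup_adj,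
    SimpleGraph.sdiff_adj]
  constructor
  · exact fun h => h.1
  · rintro h
    refine ⟨h, ?_⟩
    rcases h with h | h
    · exact h.1.ne
    · exact h.1.ne

/-- Starting from a node of `H` outside `H'`, either the symmetric difference leads to a node that
is in both graphs or in none, or the component in `H` avoids `H'` and is kept. -/
lemma exists_reachable_or_forall {H H' : SimpleGraph (Fin n)} {v : Fin n} (hv' : v ∉ H'.support) :
    (∃ x, x ∉ H.support ∆ H'.support ∧ (H ∆ H').Reachable v x) ∨
      ∀ w, H.Reachable v w → w ∉ H'.support ∧ (H ∆ H').Reachable v w := by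
  refine or_iff_not_imp_left.2 fun hno w hw => ?_
  push Not at hno
  rw [SimpleGraph.reachable_iff_reflTransGen] at hw
  induction hw with
  | refl => exact ⟨hv', SimpleGraph.Reachable.refl _⟩
  | @tail b c _ hbc ih =>
    have hadj : (H ∆ H').Adj b c := Or.inl ⟨hbc, fun h => ih.1 ⟨_, h⟩⟩
    have hr := ih.2.trans hadj.reachable
    refine ⟨fun hc => hno c ?_ hr, hr⟩
    rw [Set.mem_symmDiff]
    have : c ∈ H.support := ⟨_, hbc.symm⟩
    tauto

/-- The rank of H Δ H' is n minus its number of components. Each component contains a node outside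
V(H) Δ V(H') or comes from a component of one graph that avoids the other, by
`exists_reachable_or_forall`. So there are at most n - |V(H) Δ V(H')| + |P| of them. -/
lemma card_symmDiff_support_le (H H' : SimpleGraph (Fin n)) :
    (H.support ∆ H'.support).ncard ≤
      grank (edgeGraph ((pairSystem H H').level univ 1)) + (pairSystem H H').P.card := by
  rw [level_one_pairSystem, edgeGraph_symmDiff]
  have hrank := grank_add_card (H ∆ H')
  let φ : ↥(H.support ∆ H'.support)ᶜ ⊕ {i // i ∈ (pairSystem H H').P} →
      (H ∆ H').ConnectedComponent := fun x => (H ∆ H').connectedComponentMk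
    (Sum.elim (fun v => v.1) (fun i => Sum.elim (fun c => c.2.nonempty.choose)
      (fun c => c.2.nonempty.choose) i.1) x)
  have hφ : Function.Surjective φ := by
    intro d
    induction d using SimpleGraph.ConnectedComponent.ind with
    | _ v =>
    by_cases hv : v ∈ H.support ∆ H'.support
    · rcases hv with ⟨h1, h2⟩ | ⟨h1, h2⟩
      · rcases exists_reachable_or_forall h2 with ⟨x, hx, hr⟩ | h
        · exact ⟨Sum.inl ⟨x, hx⟩, SimpleGraph.ConnectedComponent.sound hr.symm⟩
        · obtain ⟨w, hw⟩ := h1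
          have hc := nontrivial_of_adj hw
          refine ⟨Sum.inr ⟨Sum.inl ⟨_, hc⟩, ?_⟩, ?_⟩
          · refine mem_filter.2 ⟨mem_univ _, Set.disjoint_left.2 fun x hx => (h x ?_).1⟩
            exact SimpleGraph.ConnectedComponent.exact hx.symm
          · refine SimpleGraph.ConnectedComponent.sound (h _ ?_).2.symm
            exact SimpleGraph.ConnectedComponent.exact hc.nonempty.choose_spec.symm
      · rcases exists_reachable_or_forall h2 with ⟨x, hx, hr⟩ | h
        · rw [symmDiff_comm] at hx hr
          exact ⟨Sum.inl ⟨x, hx⟩, SimpleGraph.ConnectedComponent.sound hr.symm⟩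
        · obtain ⟨w, hw⟩ := h1
          have hc := nontrivial_of_adj hw
          rw [symmDiff_comm] at h
          refine ⟨Sum.inr ⟨Sum.inr ⟨_, hc⟩, ?_⟩, ?_⟩
          · refine mem_filter.2 ⟨mem_univ _, Set.disjoint_left.2 fun x hx => (h x ?_).1⟩
            exact SimpleGraph.ConnectedComponent.exact hx.symm
          · refine SimpleGraph.ConnectedComponent.sound (h _ ?_).2.symm
            exact SimpleGraph.ConnectedComponent.exact hc.nonempty.choose_spec.symm
    · exact ⟨Sum.inl ⟨v, hv⟩, rfl⟩
  have hcard := Fintype.card_le_of_surjective φ hφ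
  rw [Fintype.card_sum, Fintype.card_coe, ← Nat.card_eq_fintype_card (α := ↥(_ : Set (Fin n))),
    Nat.card_coe_set_eq, ← Nat.card_eq_fintype_card] at hcard
  have hcompl := Set.ncard_add_ncard_compl (H.support ∆ H'.support)
  rw [Nat.card_eq_fintype_card] at hcompl
  omega

/-- Correlation bound for two distinct labelled graphs. -/
lemma abs_expect_centeredProd_mul_le (h : Regime n s q lam Θ D k A ξ) {H H' : SimpleGraph (Fin n)}
    (hH : H.edgeFinset.card ≤ D) (hH' : H'.edgeFinset.card ≤ D) :
    |expect s q Θ (fun _ A => centeredProd s q Θ H A * centeredProd s q Θ H' A)| ≤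
      24 * √(qBar q) ^ (H.edgeFinset.card + H'.edgeFinset.card) *
        ξ ^ (H.edgeFinset ∆ H'.edgeFinset).card *
        (1 / √n) ^ (H.support ∆ H'.support).ncard := by
  have := (pairSystem H H').abs_expect_prod_sub_le h (by rw [sum_card_pairSystem]; omega)
    (card_symmDiff_support_le H H')
  simpa only [prod_pairSystem, sum_card_pairSystem, level_one_pairSystem] using this

/-- Variance of the product of the centred monomials of a labelled graph. -/
lemma abs_expect_centeredProd_sq_sub_le (h : Regime n s q lam Θ D k A ξ) {H : SimpleGraph (Fin n)}
    (hH : H.edgeFinset.card ≤ D) :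
    |expect s q Θ (fun _ A => centeredProd s q Θ H A * centeredProd s q Θ H A) -
      qBar q ^ H.edgeFinset.card| ≤ 25 * ξ * qBar q ^ H.edgeFinset.card := by
  have hP : (pairSystem H H).P = ∅ := by
    refine filter_false_of_mem ?_
    rintro (⟨c, hc⟩ | ⟨c, hc⟩) - hd <;>
    · obtain ⟨v, hv⟩ := hc.nonempty
      exact Set.disjoint_left.1 hd hv (exists_adj_of_nontrivial hc hv)
  have := (pairSystem H H).abs_expect_prod_sub_sub_le h (by rw [sum_card_pairSystem]; omega)
    hP (by rw [level_one_pairSystem, symmDiff_self]; rfl) (m := H.edgeFinset.card)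
    (by rw [sum_card_pairSystem]; omega)
  simpa only [prod_pairSystem] using this

end ComponentSystem

/-! ### Weighted Schur test. -/

section Schur

open Finset

/-- Weighted Schur test for a perturbation of the identity. -/
lemma abs_quadratic_sub_le {ι : Type*} [DecidableEq ι] (S : Finset ι) (M : ι → ι → ℝ) (w : ι → ℝ)
    (hw : ∀ i, 0 < w i) (hsymm : ∀ i j, M i j = M j i) {δ ε : ℝ}
    (hdiag : ∀ i ∈ S, |M i i - 1| ≤ δ)
    (hoff : ∀ i ∈ S, ∑ j ∈ S.erase i, |M i j| * (w i / w j) ≤ ε) (β : ι → ℝ) :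
    |∑ i ∈ S, ∑ j ∈ S, β i * β j * M i j - ∑ i ∈ S, β i ^ 2| ≤ (δ + ε) * ∑ i ∈ S, β i ^ 2 := by
  have hpair : ∀ i j, |β i * β j * M i j| ≤
      1 / 2 * (β i ^ 2 * (|M i j| * (w i / w j))) + 1 / 2 * (β j ^ 2 * (|M j i| * (w j / w i))) := by
    intro i j
    -- Weighted AM-GM; after summation the two halves coincide by symmetry of `M`, so only the
    -- weighted row sums matter.
    have h1 : |β i * β j| ≤ 1 / 2 * (β i ^ 2 * (w i / w j)) + 1 / 2 * (β j ^ 2 * (w j / w i)) := by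
      have hi := hw i
      have hj := hw j
      have h2 : 1 / 2 * (β i ^ 2 * (w i / w j)) + 1 / 2 * (β j ^ 2 * (w j / w i)) - |β i * β j| =
          1 / 2 * (|β i| * w i - |β j| * w j) ^ 2 / (w i * w j) := by
        rw [abs_mul, ← sq_abs (β i), ← sq_abs (β j)]
        field_simp
        ring
      have h3 : 0 ≤ 1 / 2 * (|β i| * w i - |β j| * w j) ^ 2 / (w i * w j) := by positivity
      linarith
    rw [abs_mul, hsymm j i]
    calc |β i * β j| * |M i j| ≤ (1 / 2 * (β i ^ 2 * (w i / w j)) +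
          1 / 2 * (β j ^ 2 * (w j / w i))) * |M i j| := by gcongr
      _ = _ := by ring
  have hsplit : ∑ i ∈ S, ∑ j ∈ S, β i * β j * M i j - ∑ i ∈ S, β i ^ 2 =
      ∑ i ∈ S, β i ^ 2 * (M i i - 1) + ∑ i ∈ S, ∑ j ∈ S.erase i, β i * β j * M i j := by
    rw [← sum_sub_distrib, ← sum_add_distrib]
    refine sum_congr rfl fun i hi => ?_
    rw [← add_sum_erase _ _ hi]
    ring
  have herase : ∀ f : ι → ι → ℝ, ∑ i ∈ S, ∑ j ∈ S.erase i, f i j =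
      ∑ j ∈ S, ∑ i ∈ S.erase j, f i j := by
    intro f
    refine sum_comm' fun x y => ?_
    simp only [mem_erase]
    tauto
  rw [hsplit]
  refine (abs_add_le _ _).trans ?_
  rw [add_mul]
  refine add_le_add ?_ ?_
  · refine (abs_sum_le_sum_abs _ _).trans ?_
    rw [mul_sum]
    refine sum_le_sum fun i hi => ?_
    rw [abs_mul, abs_of_nonneg (sq_nonneg _), mul_comm]
    exact mul_le_mul_of_nonneg_right (hdiag i hi) (sq_nonneg _)
  · calc _ ≤ ∑ i ∈ S, ∑ j ∈ S.erase i, |β i * β j * M i j| :=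
          (abs_sum_le_sum_abs _ _).trans (sum_le_sum fun i _ => abs_sum_le_sum_abs _ _)
      _ ≤ ∑ i ∈ S, ∑ j ∈ S.erase i, (1 / 2 * (β i ^ 2 * (|M i j| * (w i / w j))) +
          1 / 2 * (β j ^ 2 * (|M j i| * (w j / w i)))) :=
          sum_le_sum fun i _ => sum_le_sum fun j _ => hpair i j
      _ = ∑ i ∈ S, ∑ j ∈ S.erase i, β i ^ 2 * (|M i j| * (w i / w j)) := by
          simp only [sum_add_distrib, ← mul_sum]
          rw [herase fun i j => β j ^ 2 * (|M j i| * (w j / w i))]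
          simp only [← mul_sum]
          ring
      _ ≤ ∑ i ∈ S, β i ^ 2 * ε := by
          refine sum_le_sum fun i hi => ?_
          rw [← mul_sum]
          exact mul_le_mul_of_nonneg_left (hoff i hi) (sq_nonneg _)
      _ = _ := by rw [← sum_mul, mul_comm]

end Schur

/-! ### Counting edge sets by their new nodes. -/

section Count

open Finset
open scoped Classical

variable {n : ℕ}

/-- The endpoints of a set of edges. -/
def edgeNodes (F : Finset (Sym2 (Fin n))) : Finset (Fin n) := univ.filter fun v => ∃ e ∈ F, v ∈ e

lemma edgeNodes_insert (a b : Fin n) (F : Finset (Sym2 (Fin n))) :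
    edgeNodes (insert s(a, b) F) = {a, b} ∪ edgeNodes F := by
  ext v
  simp [edgeNodes, or_assoc]

lemma card_edgeNodes_le (F : Finset (Sym2 (Fin n))) : (edgeNodes F).card ≤ 2 * F.card := by
  induction F using Finset.induction_on with
  | empty => simp [edgeNodes]
  | insert e F he ih =>
    induction e with
    | _ a b =>
      rw [edgeNodes_insert, card_insert_of_notMem he]
      have h1 := card_union_le {a, b} (edgeNodes F)
      have h2 : ({a, b} : Finset (Fin n)).card ≤ 2 := card_le_two
      omega

/-- Each endpoint of the added edge is either one of the |U| nodes already present or a new one,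
with at most n choices of weight 1/n: a total of |U| + 1 per endpoint. -/
lemma sum_insert_edge_le (F : Finset (Sym2 (Fin n))) (V₀ : Finset (Fin n)) :
    ∑ p ∈ (univ : Finset (Fin n)).offDiag,
        (1 / n : ℝ) ^ (edgeNodes (insert s(p.1, p.2) F) \ V₀).card ≤
      ((V₀ ∪ edgeNodes F).card + 1) ^ 2 * (1 / n : ℝ) ^ (edgeNodes F \ V₀).card := by
  set U := V₀ ∪ edgeNodes F
  have h1 : ∀ p ∈ (univ : Finset (Fin n)).offDiag,
      (1 / n : ℝ) ^ (edgeNodes (insert s(p.1, p.2) F) \ V₀).card =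
      (if p.1 ∈ U then (1 : ℝ) else 1 / n) * (if p.2 ∈ U then (1 : ℝ) else 1 / n) *
        (1 / n : ℝ) ^ (edgeNodes F \ V₀).card := by
    rintro ⟨a, b⟩ hab
    have hne : a ≠ b := (mem_offDiag.1 hab).2.2
    have h2 : edgeNodes (insert s(a, b) F) \ V₀ = ({a, b} \ U) ∪ (edgeNodes F \ V₀) := by
      rw [edgeNodes_insert]
      ext v
      simp only [mem_sdiff, mem_union, U]
      tauto
    have h3 : Disjoint ({a, b} \ U) (edgeNodes F \ V₀) := by
      refine disjoint_left.2 fun v hv hv' => (mem_sdiff.1 hv).2 ?_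
      exact mem_union_right _ (mem_sdiff.1 hv').1
    rw [h2, card_union_of_disjoint h3, pow_add]
    congr 1
    have h4 : ({a, b} \ U).card = (if a ∈ U then 0 else 1) + if b ∈ U then 0 else 1 := by
      rw [sdiff_eq_filter, card_filter, sum_pair hne]
      simp only [ite_not]
    rw [h4, pow_add]
    congr 1 <;> split_ifs <;> simp
  rw [sum_congr rfl h1, ← sum_mul]
  gcongr
  have h5 : ∑ a : Fin n, (if a ∈ U then (1 : ℝ) else 1 / n) ≤ U.card + 1 := by
    rw [sum_ite, sum_const, sum_const, nsmul_eq_mul, nsmul_eq_mul, mul_one, filter_mem_eq_inter,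
      univ_inter]
    gcongr
    calc ((univ.filter (· ∉ U)).card : ℝ) * (1 / n) ≤ n * (1 / n) := by
          gcongr
          exact_mod_cast (card_le_univ _).trans_eq (Fintype.card_fin n)
      _ ≤ 1 := by rw [mul_one_div]; exact div_self_le_one _
  have h0 : ∀ a : Fin n, 0 ≤ (if a ∈ U then (1 : ℝ) else 1 / n) := fun a => by
    split_ifs <;> positivity
  calc _ ≤ ∑ p : Fin n × Fin n, (if p.1 ∈ U then (1 : ℝ) else 1 / n) *
        (if p.2 ∈ U then (1 : ℝ) else 1 / n) :=
        sum_le_sum_of_subset_of_nonneg (subset_univ _) fun p _ _ => mul_nonneg (h0 _) (h0 _)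
    _ = (∑ a : Fin n, (if a ∈ U then (1 : ℝ) else 1 / n)) ^ 2 := by
        rw [Fintype.sum_prod_type, sq, sum_mul_sum]
    _ ≤ _ := pow_le_pow_left₀ (sum_nonneg fun a _ => h0 a) h5 2

/-- Number of sets of `m` edges, each new node costing a factor `1 / n`. -/
lemma sum_powersetCard_edges_le {D : ℕ} (hD : 1 ≤ D) (V₀ : Finset (Fin n)) (hV : V₀.card ≤ 2 * D)
    {m : ℕ} (hm : m ≤ 2 * D) :
    ∑ F ∈ (allEdges n).powersetCard m, (1 / n : ℝ) ^ (edgeNodes F \ V₀).card ≤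
      ((8 * D : ℝ) ^ 2) ^ m := by
  induction m with
  | zero => simp [edgeNodes]
  | succ m ih =>
    -- Edge sets are built by adding one ordered pair at a time; the overcounting is harmless for an
    -- upper bound.
    have hsub : (allEdges n).powersetCard (m + 1) ⊆
        (((allEdges n).powersetCard m) ×ˢ (univ : Finset (Fin n)).offDiag).image
          fun p => insert s(p.2.1, p.2.2) p.1 := by
      intro F hF
      rw [mem_powersetCard] at hF
      obtain ⟨e, he⟩ : F.Nonempty := card_pos.1 (by omega)
      have hed := (mem_filter.1 (hF.1 he)).2
      induction e with
      | _ a b =>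
        refine mem_image.2 ⟨(F.erase s(a, b), (a, b)), mem_product.2 ⟨mem_powersetCard.2
          ⟨(erase_subset _ _).trans hF.1, by rw [card_erase_of_mem he]; omega⟩, ?_⟩,
          insert_erase he⟩
        simpa using hed
    calc _ ≤ ∑ F ∈ (((allEdges n).powersetCard m) ×ˢ (univ : Finset (Fin n)).offDiag).image
          (fun p => insert s(p.2.1, p.2.2) p.1), (1 / n : ℝ) ^ (edgeNodes F \ V₀).card :=
          sum_le_sum_of_subset_of_nonneg hsub fun _ _ _ => by positivity
      _ ≤ ∑ p ∈ ((allEdges n).powersetCard m) ×ˢ (univ : Finset (Fin n)).offDiag,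
          (1 / n : ℝ) ^ (edgeNodes (insert s(p.2.1, p.2.2) p.1) \ V₀).card :=
          sum_image_le_of_nonneg (g := fun p : Finset (Sym2 (Fin n)) × Fin n × Fin n =>
            insert s(p.2.1, p.2.2) p.1)
            (f := fun F => (1 / n : ℝ) ^ (edgeNodes F \ V₀).card) fun _ _ => by positivity
      _ = ∑ F ∈ (allEdges n).powersetCard m, ∑ p ∈ (univ : Finset (Fin n)).offDiag,
          (1 / n : ℝ) ^ (edgeNodes (insert s(p.1, p.2) F) \ V₀).card := sum_product _ _ _
      _ ≤ ∑ F ∈ (allEdges n).powersetCard m,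
          (8 * D : ℝ) ^ 2 * (1 / n : ℝ) ^ (edgeNodes F \ V₀).card := by
          refine sum_le_sum fun F hF => (sum_insert_edge_le F V₀).trans ?_
          gcongr
          have h1 := card_union_le V₀ (edgeNodes F)
          have h2 := card_edgeNodes_le F
          rw [(mem_powersetCard.1 hF).2] at h2
          have h3 : (V₀ ∪ edgeNodes F).card + 1 ≤ 8 * D := by omega
          exact_mod_cast h3
      _ ≤ (8 * D : ℝ) ^ 2 * ((8 * D : ℝ) ^ 2) ^ m := by
          rw [← mul_sum]
          exact mul_le_mul_of_nonneg_left (ih (by omega)) (by positivity)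
      _ = _ := (pow_succ' _ _).symm

end Count

/-! ### Near-orthonormality over all small labelled graphs. -/

section NearOrthonormal

open Finset
open scoped Classical

variable {n : ℕ} {s : Sampling} {q lam : ℝ} {Θ : Matrix (Fin n) (Fin n) ℝ} {D k : ℕ} {A ξ : ℝ}

lemma expect_sum {ι : Type*} (s : Sampling) (q : ℝ) (Θ : Matrix (Fin n) (Fin n) ℝ) (S : Finset ι)
    (f : ι → SimpleGraph (Fin n) → ℝ) :
    expect s q Θ (fun _ A => ∑ i ∈ S, f i A) = ∑ i ∈ S, expect s q Θ (fun _ A => f i A) := by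
  simp only [expect_eq_lat, condE_sum, lat_sum]

lemma expect_const_mul (s : Sampling) (q : ℝ) (Θ : Matrix (Fin n) (Fin n) ℝ) (c : ℝ)
    (f : SimpleGraph (Fin n) → ℝ) :
    expect s q Θ (fun _ A => c * f A) = c * expect s q Θ (fun _ A => f A) := by
  simp only [expect_eq_lat, condE_const_mul, lat_const_mul]

/-- The labelled graphs with at most `D` edges. -/
def smallGraphs (n D : ℕ) : Finset (SimpleGraph (Fin n)) :=
  univ.filter fun H => H.edgeFinset.card ≤ D

/-- The normalized product of the centred monomials of the components of a labelled graph. -/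
def normProd (s : Sampling) (q : ℝ) (Θ : Matrix (Fin n) (Fin n) ℝ) (H A : SimpleGraph (Fin n)) : ℝ :=
  (√(qBar q) ^ H.edgeFinset.card)⁻¹ * centeredProd s q Θ H A

lemma card_support_le (H : SimpleGraph (Fin n)) :
    H.support.toFinset.card ≤ 2 * H.edgeFinset.card := by
  refine le_trans (card_le_card fun v hv => ?_) (card_edgeNodes_le H.edgeFinset)
  obtain ⟨w, hw⟩ := Set.mem_toFinset.1 hv
  exact mem_filter.2 ⟨mem_univ _, s(v, w), SimpleGraph.mem_edgeFinset.2 hw, Sym2.mem_mk_left _ _⟩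

/-- At a node outside the support of `H`, only edges of `H'` are present and none of them is
cancelled. -/
lemma edgeNodes_symmDiff_sdiff (H H' : SimpleGraph (Fin n)) :
    edgeNodes (H.edgeFinset ∆ H'.edgeFinset) \ H.support.toFinset =
      H'.support.toFinset \ H.support.toFinset := by
  ext v
  simp only [mem_sdiff, Set.mem_toFinset]
  refine and_congr_left fun hv => ?_
  rw [edgeNodes, mem_filter]
  constructor
  · rintro ⟨-, e, he, hve⟩
    obtain ⟨w, rfl⟩ := Sym2.mem_iff_exists.1 hve
    simp only [mem_symmDiff, SimpleGraph.mem_edgeFinset, SimpleGraph.mem_edgeSet] at he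
    rcases he with he | he
    · exact absurd ⟨w, he.1⟩ hv
    · exact ⟨w, he.1⟩
  · rintro ⟨w, hw⟩
    refine ⟨mem_univ _, s(v, w), ?_, Sym2.mem_mk_left _ _⟩
    simp only [mem_symmDiff, SimpleGraph.mem_edgeFinset, SimpleGraph.mem_edgeSet]
    exact Or.inr ⟨hw, fun h => hv ⟨w, h⟩⟩

lemma expect_normProd_mul (H H' : SimpleGraph (Fin n)) :
    expect s q Θ (fun _ A => normProd s q Θ H A * normProd s q Θ H' A) =
      (√(qBar q) ^ (H.edgeFinset.card + H'.edgeFinset.card))⁻¹ *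
        expect s q Θ (fun _ A => centeredProd s q Θ H A * centeredProd s q Θ H' A) := by
  rw [← expect_const_mul]
  congr 1
  funext _ A
  rw [normProd, normProd, pow_add, mul_inv]
  ring

/-- The weight ratio is √n^(|V \ V'| - |V' \ V|). It removes the decay in V \ V' and doubles that in
V' \ V, which matches the number of choices for the new nodes of `H'` when `H` is fixed. -/
lemma abs_expect_normProd_mul_weight_le (h : Regime n s q lam Θ D k A ξ)
    {H H' : SimpleGraph (Fin n)} (hH : H.edgeFinset.card ≤ D) (hH' : H'.edgeFinset.card ≤ D) :
    |expect s q Θ (fun _ A => normProd s q Θ H A * normProd s q Θ H' A)| *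
        (√n ^ H.support.toFinset.card / √n ^ H'.support.toFinset.card) ≤
      24 * ξ ^ (H.edgeFinset ∆ H'.edgeFinset).card *
        (1 / n : ℝ) ^ (edgeNodes (H.edgeFinset ∆ H'.edgeFinset) \ H.support.toFinset).card := by
  have hn := h.n_pos
  have hsn : 0 < √(n : ℝ) := Real.sqrt_pos.2 hn
  have hqb : 0 < √(qBar q) := Real.sqrt_pos.2 h.qBar_pos
  rw [expect_normProd_mul, abs_mul, abs_of_nonneg (by positivity), edgeNodes_symmDiff_sdiff]
  set V := H.support.toFinset
  set V' := H'.support.toFinset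
  have hU : (H.support ∆ H'.support).ncard = (V \ V').card + (V' \ V).card := by
    rw [← card_union_of_disjoint (disjoint_sdiff_sdiff), ← Set.ncard_coe_finset]
    congr 1
    ext v
    simp [V, V', Set.mem_symmDiff]
  have h1 := abs_expect_centeredProd_mul_le h hH hH'
  rw [hU] at h1
  have h2 : V.card = (V \ V').card + (V ∩ V').card := (card_sdiff_add_card_inter _ _).symm
  have h3 : V'.card = (V' \ V).card + (V ∩ V').card := by
    rw [inter_comm, card_sdiff_add_card_inter]
  have h4 : (1 / √n) ^ ((V \ V').card + (V' \ V).card) * (√n ^ V.card / √n ^ V'.card) =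
      (1 / n : ℝ) ^ (V' \ V).card := by
    rw [h2, h3]
    have h5 : (n : ℝ) = √n * √n := (Real.mul_self_sqrt hn.le).symm
    conv_rhs => rw [h5]
    simp only [one_div, inv_pow, pow_add, mul_pow]
    field_simp
  calc _ ≤ (√(qBar q) ^ (H.edgeFinset.card + H'.edgeFinset.card))⁻¹ *
        (24 * √(qBar q) ^ (H.edgeFinset.card + H'.edgeFinset.card) *
          ξ ^ (H.edgeFinset ∆ H'.edgeFinset).card *
          (1 / √n) ^ ((V \ V').card + (V' \ V).card)) * (√n ^ V.card / √n ^ V'.card) := by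
        gcongr
    _ = 24 * ξ ^ (H.edgeFinset ∆ H'.edgeFinset).card *
        ((1 / √n) ^ ((V \ V').card + (V' \ V).card) * (√n ^ V.card / √n ^ V'.card)) := by
        field_simp
    _ = _ := by rw [h4]

/-- For fixed `H`, the graph `H'` is determined by the set of differing edges. Summing over these
sets by cardinality gives a geometric series of ratio ξA ≤ 1/2, whence 48 = 24 · 2. -/
lemma sum_symmDiff_le (h : Regime n s q lam Θ D k A ξ) (hξA : ξ * A ≤ 1 / 2)
    {H : SimpleGraph (Fin n)} (hH : H.edgeFinset.card ≤ D) :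
    ∑ H' ∈ (smallGraphs n D).erase H, 24 * ξ ^ (H.edgeFinset ∆ H'.edgeFinset).card *
        (1 / n : ℝ) ^ (edgeNodes (H.edgeFinset ∆ H'.edgeFinset) \ H.support.toFinset).card ≤
      48 * ξ * A := by
  have hξ := h.ξ_pos
  have hA := h.one_le_A
  have hinj : Set.InjOn (fun H' : SimpleGraph (Fin n) => H.edgeFinset ∆ H'.edgeFinset)
      ((smallGraphs n D).erase H) := by
    intro H₁ _ H₂ _ he
    exact SimpleGraph.edgeFinset_inj.1 (symmDiff_right_injective _ he)
  rw [← sum_image (f := fun F => 24 * ξ ^ F.card *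
    (1 / n : ℝ) ^ (edgeNodes F \ H.support.toFinset).card) hinj]
  have hsub : ((smallGraphs n D).erase H).image
      (fun H' : SimpleGraph (Fin n) => H.edgeFinset ∆ H'.edgeFinset) ⊆
      (range (2 * D)).biUnion fun m => (allEdges n).powersetCard (m + 1) := by
    intro F hF
    obtain ⟨H', hH', rfl⟩ := mem_image.1 hF
    rw [mem_erase, smallGraphs, mem_filter] at hH'
    have h1 : (H.edgeFinset ∆ H'.edgeFinset).card ≤ 2 * D := by
      refine (card_le_card symmDiff_subset_union).trans ((card_union_le _ _).trans ?_)
      omega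
    have h2 : (H.edgeFinset ∆ H'.edgeFinset).card ≠ 0 := by
      rw [card_ne_zero, nonempty_iff_ne_empty]
      intro h0
      exact hH'.1 (SimpleGraph.edgeFinset_inj.1 (symmDiff_eq_bot.1 h0)).symm
    refine mem_biUnion.2 ⟨(H.edgeFinset ∆ H'.edgeFinset).card - 1, mem_range.2 (by omega),
      mem_powersetCard.2 ⟨fun e he => mem_filter.2 ⟨mem_univ _, ?_⟩, by omega⟩⟩
    rcases mem_symmDiff.1 he with he | he
    · exact H.not_isDiag_of_mem_edgeSet (SimpleGraph.mem_edgeFinset.1 he.1)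
    · exact H'.not_isDiag_of_mem_edgeSet (SimpleGraph.mem_edgeFinset.1 he.1)
  have hV : H.support.toFinset.card ≤ 2 * D := (card_support_le H).trans (by omega)
  calc _ ≤ ∑ F ∈ (range (2 * D)).biUnion fun m => (allEdges n).powersetCard (m + 1),
        24 * ξ ^ F.card * (1 / n : ℝ) ^ (edgeNodes F \ H.support.toFinset).card :=
        sum_le_sum_of_subset_of_nonneg hsub fun _ _ _ => by positivity
    _ = ∑ m ∈ range (2 * D), ∑ F ∈ (allEdges n).powersetCard (m + 1),
        24 * ξ ^ F.card * (1 / n : ℝ) ^ (edgeNodes F \ H.support.toFinset).card := by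
        refine sum_biUnion fun m₁ _ m₂ _ hm => disjoint_left.2 fun F h1 h2 => hm ?_
        have := (mem_powersetCard.1 h1).2.symm.trans (mem_powersetCard.1 h2).2
        omega
    _ ≤ ∑ m ∈ range (2 * D), 24 * (ξ * A) * (1 / 2) ^ m := by
        refine sum_le_sum fun m hm => ?_
        have hm' := mem_range.1 hm
        calc _ = 24 * ξ ^ (m + 1) * ∑ F ∈ (allEdges n).powersetCard (m + 1),
              (1 / n : ℝ) ^ (edgeNodes F \ H.support.toFinset).card := by
              rw [mul_sum]
              refine sum_congr rfl fun F hF => ?_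
              rw [(mem_powersetCard.1 hF).2]
          _ ≤ 24 * ξ ^ (m + 1) * A ^ (m + 1) := by
              gcongr
              refine (sum_powersetCard_edges_le h.D_pos _ hV (by omega)).trans ?_
              exact pow_le_pow_left₀ (by positivity) h.A_ge _
          _ = 24 * (ξ * A) * (ξ * A) ^ m := by rw [mul_pow]; ring
          _ ≤ _ := by gcongr
    _ = 24 * (ξ * A) * ∑ m ∈ range (2 * D), (1 / 2 : ℝ) ^ m := by rw [mul_sum]
    _ ≤ 24 * (ξ * A) * 2 := by
        gcongr
        exact sum_geometric_two_le _
    _ = _ := by ring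

/-- The normalized products over the labelled graphs with at most `D` edges are nearly orthonormal. -/
lemma abs_expect_sum_normProd_sq_sub_le (h : Regime n s q lam Θ D k A ξ) (hξA : ξ * A ≤ 1 / 2)
    (β : SimpleGraph (Fin n) → ℝ) :
    |expect s q Θ (fun _ A => (∑ H ∈ smallGraphs n D, β H * normProd s q Θ H A) ^ 2) -
        ∑ H ∈ smallGraphs n D, β H ^ 2| ≤
      (25 * ξ + 48 * ξ * A) * ∑ H ∈ smallGraphs n D, β H ^ 2 := by
  have hsn : 0 < √(n : ℝ) := Real.sqrt_pos.2 h.n_pos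
  have hexp : expect s q Θ (fun _ A => (∑ H ∈ smallGraphs n D, β H * normProd s q Θ H A) ^ 2) =
      ∑ H ∈ smallGraphs n D, ∑ H' ∈ smallGraphs n D, β H * β H' *
        expect s q Θ (fun _ A => normProd s q Θ H A * normProd s q Θ H' A) := by
    simp only [← expect_const_mul, ← expect_sum]
    congr 1
    funext _ A
    rw [sq, sum_mul_sum]
    exact sum_congr rfl fun H _ => sum_congr rfl fun H' _ => by ring
  rw [hexp]
  refine abs_quadratic_sub_le _ _ (fun H => √(n : ℝ) ^ H.support.toFinset.card)
    (fun H => by positivity) (fun H H' => by simp only [mul_comm]) ?_ ?_ β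
  · intro H hH
    have hpos : 0 < qBar q ^ H.edgeFinset.card := pow_pos h.qBar_pos _
    have h1 := abs_expect_centeredProd_sq_sub_le h (mem_filter.1 hH).2
    rw [expect_normProd_mul, ← two_mul, pow_mul, Real.sq_sqrt h.qBar_pos.le]
    calc _ = |(qBar q ^ H.edgeFinset.card)⁻¹ *
          (expect s q Θ (fun _ A => centeredProd s q Θ H A * centeredProd s q Θ H A) -
            qBar q ^ H.edgeFinset.card)| := by
          congr 1
          field_simp
      _ ≤ (qBar q ^ H.edgeFinset.card)⁻¹ * (25 * ξ * qBar q ^ H.edgeFinset.card) := by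
          rw [abs_mul, abs_of_pos (inv_pos.2 hpos)]
          gcongr
      _ = _ := by field_simp
  · intro H hH
    have hH' := (mem_filter.1 hH).2
    refine (sum_le_sum fun H' h' => abs_expect_normProd_mul_weight_le h hH'
      (mem_filter.1 (mem_erase.1 h').2).2).trans (sum_symmDiff_le h hξA hH')

end NearOrthonormal

/-! ### Components under relabelling. -/

section Relabelling

open Finset
open scoped Classical

variable {n : ℕ} {s : Sampling} {q : ℝ} {Θ : Matrix (Fin n) (Fin n) ℝ}

lemma exists_of_reachable_map {V W : Type*} (G : SimpleGraph V) (π : V ↪ W) {a : V} {x : W}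
    (h : (G.map π).Reachable (π a) x) : ∃ b, π b = x ∧ G.Reachable a b := by
  rw [SimpleGraph.reachable_iff_reflTransGen] at h
  induction h with
  | refl => exact ⟨a, rfl, SimpleGraph.Reachable.refl _⟩
  | tail _ hxy ih =>
    obtain ⟨b, rfl, hb⟩ := ih
    obtain ⟨u, v, huv, hu, rfl⟩ := (SimpleGraph.map_adj _ _ _ _).1 hxy
    obtain rfl := π.injective hu
    exact ⟨v, rfl, hb.trans huv.reachable⟩

/-- The component of a relabelled graph that corresponds to a given component. -/
def mapComp {V W : Type*} (G : SimpleGraph V) (π : V ↪ W) (c : G.ConnectedComponent) :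
    (G.map π).ConnectedComponent :=
  c.map (SimpleGraph.Embedding.map π G).toHom

lemma mapComp_mk {V W : Type*} (G : SimpleGraph V) (π : V ↪ W) (a : V) :
    mapComp G π (G.connectedComponentMk a) = (G.map π).connectedComponentMk (π a) := rfl

lemma mk_eq_mapComp_iff {V W : Type*} (G : SimpleGraph V) (π : V ↪ W) (a : V)
    (c : G.ConnectedComponent) :
    (G.map π).connectedComponentMk (π a) = mapComp G π c ↔ G.connectedComponentMk a = c := by
  induction c using SimpleGraph.ConnectedComponent.ind with
  | _ b =>
    rw [mapComp_mk, SimpleGraph.ConnectedComponent.eq, SimpleGraph.ConnectedComponent.eq]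
    constructor
    · intro h
      obtain ⟨b', hb', h'⟩ := exists_of_reachable_map G π h
      rwa [π.injective hb'] at h'
    · intro h
      exact h.map (SimpleGraph.Embedding.map π G).toHom

lemma mapComp_injective {V W : Type*} (G : SimpleGraph V) (π : V ↪ W) :
    Function.Injective (mapComp G π) := by
  intro c c' h
  induction c using SimpleGraph.ConnectedComponent.ind with
  | _ a => exact (mk_eq_mapComp_iff G π a c').1 h

lemma nontrivial_mapComp {V W : Type*} (G : SimpleGraph V) (π : V ↪ W) {c : G.ConnectedComponent}
    (hc : c.supp.Nontrivial) : (mapComp G π c).supp.Nontrivial := by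
  obtain ⟨a, ha, b, hb, hne⟩ := hc
  exact ⟨π a, (mk_eq_mapComp_iff G π a c).2 ha, π b, (mk_eq_mapComp_iff G π b c).2 hb,
    π.injective.ne hne⟩

lemma map_nontrivialComp_bijective {V W : Type*} (G : SimpleGraph V) (π : V ↪ W) :
    Function.Bijective fun c : NontrivialComp G =>
      (⟨mapComp G π c.1, nontrivial_mapComp G π c.2⟩ : NontrivialComp (G.map π)) := by
  constructor
  · intro c c' h
    exact Subtype.ext (mapComp_injective G π (Subtype.ext_iff.1 h))
  · rintro ⟨d, hd⟩
    obtain ⟨x, hx⟩ := hd.nonempty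
    obtain ⟨y, hy⟩ := exists_adj_of_nontrivial hd hx
    obtain ⟨a, b, hab, rfl, -⟩ := (SimpleGraph.map_adj _ _ _ _).1 hy
    exact ⟨⟨G.connectedComponentMk a, nontrivial_of_adj hab⟩, Subtype.ext hx⟩

lemma edgeSet_map_induce_supp {V : Type*} (G : SimpleGraph V) (π : V ↪ Fin n)
    (c : G.ConnectedComponent) :
    ((G.induce c.supp).map ((Function.Embedding.subtype _).trans π)).edgeSet =
      compEdges (G.map π) (mapComp G π c) := by
  ext e
  induction e with
  | _ x y =>
    rw [mem_coe, mk_mem_compEdges, SimpleGraph.mem_edgeSet, SimpleGraph.map_adj, SimpleGraph.map_adj]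
    constructor
    · rintro ⟨u, v, huv, rfl, rfl⟩
      exact ⟨⟨u, v, huv, rfl, rfl⟩, (mk_eq_mapComp_iff G π u.1 c).2 u.2⟩
    · rintro ⟨⟨a, b, hab, rfl, rfl⟩, h⟩
      have ha : a ∈ c.supp := (mk_eq_mapComp_iff G π a c).1 h
      have hb : b ∈ c.supp :=
        (SimpleGraph.ConnectedComponent.sound hab.symm.reachable).trans ha
      exact ⟨⟨a, ha⟩, ⟨b, hb⟩, hab, rfl, rfl⟩

lemma monomial_induce_supp (hΘ : Θ.IsSymm) {V : Type} (G : SimpleGraph V) (π : V ↪ Fin n)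
    (c : G.ConnectedComponent) [Fintype c.supp] (A : SimpleGraph (Fin n)) :
    monomial q (G.induce c.supp) ((Function.Embedding.subtype _).trans π) A -
      expect s q Θ (fun _ B =>
        monomial q (G.induce c.supp) ((Function.Embedding.subtype _).trans π) B) =
    edgeMonomial q (compEdges (G.map π) (mapComp G π c)) A -
      lat s (thProd Θ (compEdges (G.map π) (mapComp G π c))) := by
  simp only [monomial_eq_edgeMonomial q _ _ _ (edgeSet_map_induce_supp G π c)]
  rw [expect_edgeMonomial hΘ s q _ (compEdges_subset _ _)]

lemma prod_filter_eq_prod {α β : Type*} {_ : Fintype α} {_ : Fintype β} {p : α → Prop}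
    {_ : DecidablePred p} {f : α → ℝ} {g : β → ℝ} (e : {a // p a} ≃ β)
    (h : ∀ a, f a.1 = g (e a)) : ∏ a with p a, f a = ∏ b, g b := by
  symm
  refine prod_bij (fun d _ => (e.symm d).1) (fun d _ => mem_filter.2 ⟨mem_univ _, (e.symm d).2⟩)
    ?_ ?_ ?_
  · intro d _ d' _ h
    exact e.symm.injective (Subtype.ext h)
  · intro c hc
    exact ⟨e ⟨c, (mem_filter.1 hc).2⟩, mem_univ _, by rw [e.symm_apply_apply]⟩
  · intro d _
    rw [h, e.apply_symm_apply]

/-- Components and their edges are transported by the labeling, so the centred monomial depends on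
the labelled graph alone; labelings with the same image can be grouped. -/
lemma centeredMonomial_eq_centeredProd (hΘ : Θ.IsSymm) (G : RootedTemplate)
    (π : Fin (G.m + 2) ↪ Fin n) (A : SimpleGraph (Fin n)) :
    G.centeredMonomial s q Θ π A = centeredProd s q Θ (G.graph.map π) A := by
  rw [RootedTemplate.centeredMonomial, centeredProd]
  simp only [monomial_induce_supp hΘ]
  obtain ⟨e, he⟩ : ∃ e : NontrivialComp G.graph ≃ NontrivialComp (G.graph.map π),
      ∀ c, (e c).1 = mapComp G.graph π c.1 :=
    ⟨Equiv.ofBijective _ (map_nontrivialComp_bijective G.graph π), fun _ => rfl⟩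
  refine prod_filter_eq_prod e fun c => ?_
  rw [he]

end Relabelling

/-! ### Labelled copies of a rooted template. -/

section Copies

open Finset
open scoped Classical

variable {n : ℕ} {s : Sampling} {q : ℝ} {Θ : Matrix (Fin n) (Fin n) ℝ}

namespace RootedTemplate

/-- Only roots can be isolated, and their labels are fixed, so the labelled graph determines the
range of the labeling. -/
lemma mem_range_iff {G : RootedTemplate} {π : Fin (G.m + 2) ↪ Fin n} (hπ : G.IsRooted π)
    (x : Fin n) : x ∈ Set.range π ↔ (x : ℕ) = 0 ∨ (x : ℕ) = 1 ∨ x ∈ (G.graph.map π).support := by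
  constructor
  · rintro ⟨v, rfl⟩
    by_cases h0 : v = 0
    · left; rw [h0]; exact hπ.1
    by_cases h1 : v = 1
    · right; left; rw [h1]; exact hπ.2
    · obtain ⟨w, hw⟩ := G.no_isolated v h0 h1
      exact Or.inr (Or.inr ⟨π w, (SimpleGraph.map_adj _ _ _ _).2 ⟨v, w, hw, rfl, rfl⟩⟩)
  · rintro (h | h | ⟨y, hy⟩)
    · exact ⟨0, Fin.ext (hπ.1.trans h.symm)⟩
    · exact ⟨1, Fin.ext (hπ.2.trans h.symm)⟩
    · obtain ⟨a, b, -, rfl, -⟩ := (SimpleGraph.map_adj _ _ _ _).1 hy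
      exact ⟨a, rfl⟩

/-- Rooted labelings with the same labelled graph differ by a rooted isomorphism. -/
lemma exists_iso_of_map_eq {G G' : RootedTemplate} {π : Fin (G.m + 2) ↪ Fin n}
    {π' : Fin (G'.m + 2) ↪ Fin n} (hπ : G.IsRooted π) (hπ' : G'.IsRooted π')
    (h : G.graph.map π = G'.graph.map π') :
    ∃ σ : G.graph ≃g G'.graph, (σ 0 = 0 ∧ σ 1 = 1) ∧ ∀ v, π' (σ v) = π v := by
  have hrange : Set.range π = Set.range π' := by
    ext x
    rw [mem_range_iff hπ, mem_range_iff hπ', h]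
  let e : Fin (G.m + 2) ≃ Fin (G'.m + 2) := (Equiv.ofInjective π π.injective).trans
    ((Equiv.setCongr hrange).trans (Equiv.ofInjective π' π'.injective).symm)
  have he : ∀ v, π' (e v) = π v := fun v =>
    Equiv.apply_ofInjective_symm π'.injective ((Equiv.setCongr hrange) ⟨π v, v, rfl⟩)
  refine ⟨⟨e, ?_⟩, ⟨π'.injective (Fin.ext ?_), π'.injective (Fin.ext ?_)⟩, he⟩
  · intro a b
    rw [← SimpleGraph.map_adj_apply (f := π'), he, he, ← h, SimpleGraph.map_adj_apply]
  · exact (congrArg Fin.val (he 0)).trans (hπ.1.trans hπ'.1.symm)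
  · exact (congrArg Fin.val (he 1)).trans (hπ.2.trans hπ'.2.symm)

/-- The labelled copies of a rooted template. -/
def copies (n : ℕ) (G : RootedTemplate) : Finset (SimpleGraph (Fin n)) :=
  (univ.filter fun π : Fin (G.m + 2) ↪ Fin n => G.IsRooted π).image
    fun π : Fin (G.m + 2) ↪ Fin n => G.graph.map π

lemma equivalent_of_mem_copies {G G' : RootedTemplate} {H : SimpleGraph (Fin n)}
    (hG : H ∈ G.copies n) (hG' : H ∈ G'.copies n) : G.Equivalent G' := by
  obtain ⟨π, hπ, rfl⟩ := mem_image.1 hG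
  obtain ⟨π', hπ', h⟩ := mem_image.1 hG'
  obtain ⟨σ, hσ, -⟩ := exists_iso_of_map_eq (mem_filter.1 hπ).2 (mem_filter.1 hπ').2 h.symm
  exact ⟨σ, hσ⟩

lemma finite_rootedAut (G : RootedTemplate) :
    Finite {σ : G.graph ≃g G.graph // σ 0 = 0 ∧ σ 1 = 1} :=
  haveI : Finite (G.graph ≃g G.graph) :=
    Finite.of_injective (fun σ => (σ : Fin (G.m + 2) → Fin (G.m + 2))) DFunLike.coe_injective
  inferInstance

/-- Rooted automorphisms act simply transitively, by precomposition, on the rooted labelings with a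
given labelled graph. -/
lemma card_fiber_eq_autCard {G : RootedTemplate} {π₀ : Fin (G.m + 2) ↪ Fin n}
    (h₀ : G.IsRooted π₀) :
    ((univ.filter fun π : Fin (G.m + 2) ↪ Fin n => G.IsRooted π).filter
      fun π : Fin (G.m + 2) ↪ Fin n => G.graph.map π = G.graph.map π₀).card = G.autCard := by
  have := G.finite_rootedAut
  let _ := Fintype.ofFinite {σ : G.graph ≃g G.graph // σ 0 = 0 ∧ σ 1 = 1}
  rw [autCard, Nat.card_eq_fintype_card, ← card_univ]
  symm
  refine card_bij (fun σ _ => σ.1.toEquiv.toEmbedding.trans π₀) ?_ ?_ ?_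
  · rintro ⟨σ, h0, h1⟩ -
    refine mem_filter.2 ⟨mem_filter.2 ⟨mem_univ _, ?_, ?_⟩, ?_⟩
    · exact (congrArg (fun v => (π₀ v : ℕ)) h0).trans h₀.1
    · exact (congrArg (fun v => (π₀ v : ℕ)) h1).trans h₀.2
    · ext x y
      rw [SimpleGraph.map_adj, SimpleGraph.map_adj]
      constructor
      · rintro ⟨u, v, huv, rfl, rfl⟩
        exact ⟨σ u, σ v, σ.map_adj_iff.2 huv, rfl, rfl⟩
      · rintro ⟨u, v, huv, rfl, rfl⟩
        refine ⟨σ.symm u, σ.symm v, σ.symm.map_adj_iff.2 huv, ?_, ?_⟩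
        · exact congrArg π₀ (σ.apply_symm_apply u)
        · exact congrArg π₀ (σ.apply_symm_apply v)
  · rintro ⟨σ, _⟩ _ ⟨σ', _⟩ _ h
    exact Subtype.ext (RelIso.ext fun v => π₀.injective (DFunLike.congr_fun h v))
  · intro π hπ
    obtain ⟨h1, h2⟩ := mem_filter.1 hπ
    obtain ⟨σ, hσ, hv⟩ := exists_iso_of_map_eq (mem_filter.1 h1).2 h₀ h2
    exact ⟨⟨σ, hσ⟩, mem_univ _, DFunLike.ext _ _ hv⟩

lemma sum_rooted_eq (G : RootedTemplate) (f : SimpleGraph (Fin n) → ℝ) :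
    ∑ π : Fin (G.m + 2) ↪ Fin n with G.IsRooted π, f (G.graph.map π) =
      G.autCard * ∑ H ∈ G.copies n, f H := by
  rw [sum_comp, mul_sum]
  refine sum_congr rfl fun H hH => ?_
  obtain ⟨π₀, hπ₀, rfl⟩ := mem_image.1 hH
  rw [card_fiber_eq_autCard (mem_filter.1 hπ₀).2, nsmul_eq_mul]

lemma card_rooted (m N : ℕ) :
    (univ.filter fun π : Fin (m + 2) ↪ Fin (N + 2) => (π 0 : ℕ) = 0 ∧ (π 1 : ℕ) = 1).card =
      N.descFactorial m := by
  have hcard : (univ : Finset (Fin m ↪ Fin N)).card = N.descFactorial m := by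
    rw [card_univ, Fintype.card_embedding_eq, Fintype.card_fin, Fintype.card_fin]
  rw [← hcard]
  symm
  let φ : (Fin m ↪ Fin N) → Fin (m + 2) → Fin (N + 2) := fun f =>
    Fin.cons 0 (Fin.cons 1 fun i => (f i).succ.succ)
  have hφ : ∀ f, Function.Injective (φ f) := by
    intro f
    refine Fin.cons_injective_iff.2 ⟨?_, Fin.cons_injective_iff.2 ⟨?_, ?_⟩⟩
    · rintro ⟨i, hi⟩
      refine Fin.cases (fun h => ?_) (fun j h => ?_) i hi
      · exact absurd (congrArg Fin.val h) (by simp)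
      · exact absurd (congrArg Fin.val h) (by simp)
    · rintro ⟨i, hi⟩
      exact absurd (congrArg Fin.val hi) (by simp)
    · exact fun a b h => f.injective (Fin.succ_injective _ (Fin.succ_injective _ h))
  refine card_bij (fun f _ => ⟨φ f, hφ f⟩) ?_ ?_ ?_
  · intro f _
    exact mem_filter.2 ⟨mem_univ _, rfl, rfl⟩
  · intro f _ g _ h
    ext i
    have := congrArg Fin.val (DFunLike.congr_fun h i.succ.succ)
    simpa [φ] using this
  · intro π hπ
    obtain ⟨-, h0, h1⟩ := mem_filter.1 hπ
    have hge : ∀ i : Fin m, 2 ≤ (π i.succ.succ : ℕ) := by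
      intro i
      have h2 : (π i.succ.succ : ℕ) ≠ π 0 := fun h => by
        simpa [Fin.ext_iff] using π.injective (Fin.ext h)
      have h3 : (π i.succ.succ : ℕ) ≠ π 1 := fun h => by
        simpa [Fin.ext_iff] using π.injective (Fin.ext h)
      omega
    have hlt : ∀ i : Fin m, (π i.succ.succ : ℕ) - 2 < N := fun i => by
      have := (π i.succ.succ).2
      have := hge i
      omega
    refine ⟨⟨fun i => ⟨π i.succ.succ - 2, hlt i⟩, fun a b h => ?_⟩, mem_univ _, ?_⟩
    · have h2 := Fin.ext_iff.1 h
      have h3 : (π a.succ.succ : ℕ) = π b.succ.succ := by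
        have := hge a
        have := hge b
        simp only at h2
        omega
      exact Fin.succ_injective _ (Fin.succ_injective _ (π.injective (Fin.ext h3)))
    · refine DFunLike.ext _ _ fun i => Fin.ext ?_
      refine Fin.cases h0.symm (fun j => ?_) i
      refine Fin.cases h1.symm (fun l => ?_) j
      have := hge l
      change ((π l.succ.succ : ℕ) - 2) + 1 + 1 = _
      omega

/-- Orbit counting of the (n-2)!/(n-|V|)! rooted labelings. Consequently the variance proxy is
|Aut|² · #copies · q̄^|E|, and its root cancels the multiplicity |Aut| of each copy in the basis
element. -/
lemma card_copies_mul_autCard (G : RootedTemplate) (hn : G.m + 2 ≤ n) :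
    (G.autCard : ℝ) * (G.copies n).card =
      ((n - 2).factorial : ℝ) / ((n - (G.m + 2)).factorial : ℝ) := by
  obtain ⟨N, rfl⟩ := Nat.exists_eq_add_of_le' ((Nat.le_add_left 2 G.m).trans hn)
  have h1 := G.sum_rooted_eq (n := N + 2) fun _ => 1
  have h2 : ((univ.filter fun π : Fin (G.m + 2) ↪ Fin (N + 2) => G.IsRooted π).card : ℝ) =
      N.descFactorial G.m := by
    rw [← card_rooted G.m N]
    congr!
  simp only [sum_const, nsmul_eq_mul, mul_one] at h1
  rw [← h1, h2, eq_div_iff (by positivity)]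
  have h3 : N + 2 - (G.m + 2) = N - G.m := by omega
  rw [h3, Nat.add_sub_cancel, mul_comm]
  exact_mod_cast Nat.factorial_mul_descFactorial (by omega)

lemma m_le (G : RootedTemplate) : G.m ≤ 2 * G.edges := by
  have h1 : (univ.filter fun v : Fin (G.m + 2) => v ≠ 0 ∧ v ≠ 1) ⊆ G.graph.support.toFinset := by
    intro v hv
    obtain ⟨-, h0, h1⟩ := mem_filter.1 hv
    exact Set.mem_toFinset.2 (G.no_isolated v h0 h1)
  have h2 := (card_le_card h1).trans (card_support_le G.graph)
  have h3 : (univ.filter fun v : Fin (G.m + 2) => v ≠ 0 ∧ v ≠ 1).card = G.m := by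
    have : (univ.filter fun v : Fin (G.m + 2) => v ≠ 0 ∧ v ≠ 1) = univ \ {0, 1} := by
      ext v
      simp
    rw [this, card_sdiff_of_subset (subset_univ _), card_univ, Fintype.card_fin,
      card_pair (by simp)]
    rfl
  rw [h3] at h2
  rwa [edges, ← SimpleGraph.coe_edgeFinset, Set.ncard_coe_finset]

lemma copies_nonempty (G : RootedTemplate) (hn : G.m + 2 ≤ n) : (G.copies n).Nonempty := by
  have h : G.IsRooted (Fin.castLEEmb hn) := ⟨rfl, rfl⟩
  exact ⟨_, mem_image_of_mem _ (mem_filter.2 ⟨mem_univ _, h⟩)⟩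

lemma card_edgeFinset_of_mem_copies {G : RootedTemplate} {H : SimpleGraph (Fin n)}
    (h : H ∈ G.copies n) : H.edgeFinset.card = G.edges := by
  obtain ⟨π, -, rfl⟩ := mem_image.1 h
  rw [edges, ← Set.ncard_coe_finset, SimpleGraph.coe_edgeFinset, SimpleGraph.edgeSet_map,
    Set.ncard_image_of_injective _ (Function.Embedding.injective _)]

/-- The basis elements are the normalized sums over the labelled copies. -/
lemma psi_eq (hΘ : Θ.IsSymm) (hq : 0 < qBar q) (G : RootedTemplate) (hn : G.m + 2 ≤ n)
    (A : SimpleGraph (Fin n)) :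
    G.psi s q Θ A = (√((G.copies n).card : ℝ))⁻¹ * ∑ H ∈ G.copies n, normProd s q Θ H A := by
  have haut : 0 < (G.autCard : ℝ) := by
    have : 0 < G.autCard := by
      rw [autCard, Nat.card_pos_iff]
      exact ⟨⟨⟨RelIso.refl _, rfl, rfl⟩⟩, G.finite_rootedAut⟩
    exact_mod_cast this
  have hcard : 0 < ((G.copies n).card : ℝ) := by exact_mod_cast card_pos.2 (G.copies_nonempty hn)
  have hvar : √(G.varianceProxy n q) =
      G.autCard * √((G.copies n).card : ℝ) * √(qBar q) ^ G.edges := by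
    rw [varianceProxy, ← G.card_copies_mul_autCard hn,
      show (G.autCard : ℝ) * (G.copies n).card * G.autCard * qBar q ^ G.edges =
        (G.autCard * √((G.copies n).card : ℝ) * √(qBar q) ^ G.edges) ^ 2 by
      rw [mul_pow, mul_pow, Real.sq_sqrt hcard.le, ← pow_mul, mul_comm G.edges 2, pow_mul,
        Real.sq_sqrt hq.le]
      ring]
    exact Real.sqrt_sq (by positivity)
  have hnorm : ∑ H ∈ G.copies n, normProd s q Θ H A =
      (√(qBar q) ^ G.edges)⁻¹ * ∑ H ∈ G.copies n, centeredProd s q Θ H A := by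
    rw [mul_sum]
    refine sum_congr rfl fun H hH => ?_
    rw [normProd, card_edgeFinset_of_mem_copies hH]
  rw [psi, hvar, hnorm]
  simp only [centeredMonomial_eq_centeredProd hΘ]
  rw [G.sum_rooted_eq fun H => centeredProd s q Θ H A]
  have h1 : 0 < √((G.copies n).card : ℝ) := Real.sqrt_pos.2 hcard
  have h2 : 0 < √(qBar q) := Real.sqrt_pos.2 hq
  field_simp

end RootedTemplate

end Copies

/-! ### Transfer to the rooted basis and choice of parameters. -/

section Conclusion

open Finset
open scoped Classical

variable {n : ℕ} {s : Sampling} {q lam : ℝ} {Θ : Matrix (Fin n) (Fin n) ℝ} {D k : ℕ} {A ξ : ℝ}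

lemma card_edgeFinset_bot {V : Type*} {_ : Fintype (⊥ : SimpleGraph V).edgeSet} :
    (⊥ : SimpleGraph V).edgeFinset.card = 0 := by
  rw [card_eq_zero]
  ext e
  simp

lemma normProd_bot (A : SimpleGraph (Fin n)) : normProd s q Θ ⊥ A = 1 := by
  have h : IsEmpty (NontrivialComp (⊥ : SimpleGraph (Fin n))) := by
    refine ⟨fun c => ?_⟩
    obtain ⟨v, hv⟩ := c.2.nonempty
    obtain ⟨w, hw⟩ := exists_adj_of_nontrivial c.2 hv
    exact hw
  rw [normProd, centeredProd, card_edgeFinset_bot, pow_zero, inv_one, one_mul]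
  exact prod_eq_one fun c _ => h.elim c

/-- Labelled graphs attached to an element of the basis: the empty graph for the constant. -/
def optionCopies (n : ℕ) : Option RootedTemplate → Finset (SimpleGraph (Fin n))
  | none => {⊥}
  | some G => G.copies n

lemma sum_sq_indicator {ι κ : Type*} (I : Finset ι) (S : Finset κ) (T : ι → Finset κ)
    (hsub : ∀ i ∈ I, T i ⊆ S)
    (hdisj : ∀ i ∈ I, ∀ j ∈ I, i ≠ j → Disjoint (T i) (T j)) (a : ι → ℝ) :
    ∑ x ∈ S, (∑ i ∈ I, if x ∈ T i then a i else 0) ^ 2 = ∑ i ∈ I, a i ^ 2 * (T i).card := by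
  have h1 : ∀ x ∈ S, (∑ i ∈ I, if x ∈ T i then a i else 0) ^ 2 =
      ∑ i ∈ I, if x ∈ T i then a i ^ 2 else 0 := by
    intro x _
    rw [sq, sum_mul_sum]
    refine sum_congr rfl fun i hi => ?_
    rw [sum_eq_single i]
    · split_ifs <;> ring
    · intro j hj hne
      split_ifs with h1 h2
      · exact absurd h2 (disjoint_left.1 (hdisj i hi j hj hne.symm) h1)
      all_goals simp
    · exact fun h => absurd hi h
  rw [sum_congr rfl h1, sum_comm]
  refine sum_congr rfl fun i hi => ?_
  rw [← sum_filter, sum_const, nsmul_eq_mul, filter_mem_eq_inter, inter_eq_right.2 (hsub i hi),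
    mul_comm]

/-- The coefficient of a template is spread evenly over its copies, and the constant is attached to
the empty graph, for which `normProd` is 1. Disjointness of the sets of copies makes α ↦ β
isometric. -/
lemma nearlyOrthonormal_of_regime (h : Regime n s q lam Θ D k A ξ) (hξA : ξ * A ≤ 1 / 2) {ε : ℝ}
    (hε : 25 * ξ + 48 * ξ * A ≤ ε) {C : Finset RootedTemplate} (hC : IsRootedCollection D C) :
    NearlyOrthonormal s q Θ C ε := by
  -- A template has at most 2D + 2 nodes, two of them possibly isolated roots; this makes every set
  -- of copies nonempty.
  have hDn : 2 * D + 2 ≤ n := by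
    have h1 : (2 * D + 2 : ℝ) ≤ n := by
      have h2 : (1 : ℝ) ≤ D := by exact_mod_cast h.D_pos
      nlinarith [h.A_ge, h.A_le]
    exact_mod_cast h1
  have hm : ∀ G ∈ C, G.m + 2 ≤ n := by
    intro G hG
    have h1 := G.m_le
    have h2 := (hC.edges_mem G hG).2
    omega
  intro α₀ α
  set a : Option RootedTemplate → ℝ := fun i =>
    i.elim α₀ fun G => α G * (√((G.copies n).card : ℝ))⁻¹ with ha
  set β : SimpleGraph (Fin n) → ℝ := fun H =>
    ∑ i ∈ insertNone C, if H ∈ optionCopies n i then a i else 0 with hβ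
  have hsub : ∀ i ∈ insertNone C, optionCopies n i ⊆ smallGraphs n D := by
    intro i hi H hH
    refine mem_filter.2 ⟨mem_univ _, ?_⟩
    cases i with
    | none =>
      have : H = ⊥ := mem_singleton.1 hH
      subst this
      exact card_edgeFinset_bot.trans_le (Nat.zero_le D)
    | some G =>
      rw [RootedTemplate.card_edgeFinset_of_mem_copies hH]
      exact (hC.edges_mem G (some_mem_insertNone.1 hi)).2
  have hne : ∀ G ∈ C, (⊥ : SimpleGraph (Fin n)) ∉ G.copies n := by
    intro G hG hmem
    have h1 := RootedTemplate.card_edgeFinset_of_mem_copies hmem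
    have h2 := (hC.edges_mem G hG).1
    rw [card_edgeFinset_bot] at h1
    omega
  have hdisj : ∀ i ∈ insertNone C, ∀ j ∈ insertNone C, i ≠ j →
      Disjoint (optionCopies n i) (optionCopies n j) := by
    intro i hi j hj hij
    cases i with
    | none =>
      cases j with
      | none => exact absurd rfl hij
      | some G => exact disjoint_singleton_left.2 (hne G (some_mem_insertNone.1 hj))
    | some G =>
      cases j with
      | none => exact disjoint_singleton_right.2 (hne G (some_mem_insertNone.1 hi))
      | some G' =>
        refine disjoint_left.2 fun H h1 h2 => hij ?_
        rw [hC.pairwise G (some_mem_insertNone.1 hi) G' (some_mem_insertNone.1 hj)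
          (RootedTemplate.equivalent_of_mem_copies h1 h2)]
  have hlin : ∀ A, α₀ + ∑ G ∈ C, α G * G.psi s q Θ A =
      ∑ H ∈ smallGraphs n D, β H * normProd s q Θ H A := by
    intro A
    have h1 : ∑ H ∈ smallGraphs n D, β H * normProd s q Θ H A =
        ∑ i ∈ insertNone C, a i * ∑ H ∈ optionCopies n i, normProd s q Θ H A := by
      simp only [hβ, sum_mul]
      rw [sum_comm]
      refine sum_congr rfl fun i hi => ?_
      simp only [ite_mul, zero_mul]
      rw [← sum_filter, filter_mem_eq_inter, inter_eq_right.2 (hsub i hi), mul_sum]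
    rw [h1, sum_insertNone]
    congr 1
    · simp [ha, optionCopies, normProd_bot]
    · refine sum_congr rfl fun G hG => ?_
      rw [RootedTemplate.psi_eq h.symm h.qBar_pos G (hm G hG), ← mul_assoc]
      rfl
  have hnorm : ∑ H ∈ smallGraphs n D, β H ^ 2 = α₀ ^ 2 + ∑ G ∈ C, α G ^ 2 := by
    rw [sum_sq_indicator _ _ _ hsub hdisj, sum_insertNone]
    congr 1
    · simp [ha, optionCopies]
    · refine sum_congr rfl fun G hG => ?_
      have hpos : 0 < ((G.copies n).card : ℝ) := by
        exact_mod_cast card_pos.2 (G.copies_nonempty (hm G hG))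
      change (α G * (√((G.copies n).card : ℝ))⁻¹) ^ 2 * ((G.copies n).card : ℝ) = _
      rw [mul_pow, inv_pow, Real.sq_sqrt hpos.le]
      field_simp
  have hmain := abs_expect_sum_normProd_sq_sub_le h hξA β
  simp only [hlin]
  rw [hnorm] at hmain
  have hnn : 0 ≤ α₀ ^ 2 + ∑ G ∈ C, α G ^ 2 :=
    add_nonneg (sq_nonneg _) (sum_nonneg fun _ _ => sq_nonneg _)
  have := abs_le.1 (hmain.trans (mul_le_mul_of_nonneg_right hε hnn))
  constructor <;> linarith [this.1, this.2]

/-- The conditions of the model put it in the quantitative regime. -/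
lemma regime_of_conditions {cm cv₁ cv₂ cv₃ cv₄ a cs : ℝ} (hcm : 0 ≤ cm) (hcv₁ : 0 ≤ cv₁)
    (hcv₂ : 0 ≤ cv₂) (ha : cm + cv₁ + cv₂ + 8 ≤ a) (hcs : 2 * a ≤ cs) (hD : 2 ≤ D) (hk : 1 ≤ k)
    (hkn : k ≤ n) (hq : 0 < q) (hq' : q ≤ 1 / 2) (hlam : 0 ≤ lam) (hΘ : Θ.IsSymm)
    (hs : CSignal cs D k q lam Θ) (hm : CMoment s cm D k q lam Θ)
    (hv : CVariance s cv₁ cv₂ cv₃ cv₄ D k q lam Θ) :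
    Regime n s q lam Θ D k ((D : ℝ) ^ a) ((D : ℝ) ^ (-cs)) := by
  have hD2 : (2 : ℝ) ≤ D := by exact_mod_cast hD
  have hD1 : (1 : ℝ) ≤ D := by linarith
  have hD0 : (0 : ℝ) < D := by linarith
  have hn0 : 0 < n := by omega
  have hn : (0 : ℝ) < n := by exact_mod_cast hn0
  have hk1 : (1 : ℝ) ≤ k := by exact_mod_cast hk
  have hmono : ∀ {x y : ℝ}, x ≤ y → (D : ℝ) ^ x ≤ (D : ℝ) ^ y := fun h =>
    Real.rpow_le_rpow_of_exponent_le hD1 h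
  have hone : ∀ {x : ℝ}, x ≤ 0 → (D : ℝ) ^ x ≤ 1 := fun h =>
    Real.rpow_le_one_of_one_le_of_nonpos hD1 h
  have hpow : ∀ j : ℕ, (2 : ℝ) ^ j ≤ (D : ℝ) ^ (j : ℝ) := fun j => by
    rw [Real.rpow_natCast]; exact pow_le_pow_left₀ (by norm_num) hD2 j
  have h8 : (8 : ℝ) ≤ (D : ℝ) ^ (3 : ℝ) := by have := hpow 3; norm_num at this ⊢; exact this
  have hη := hs.bound
  set η : ℝ := (D : ℝ) ^ (-(8 * cs)) with hηdef
  have hη0 : 0 < η := Real.rpow_pos_of_pos hD0 _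
  have hkη : (k : ℝ) / n ≤ η := (le_max_left _ _).trans ((le_max_left _ _).trans hη)
  have hlkη : lam * k / √((n : ℝ) * q) ≤ η := (le_max_right _ _).trans ((le_max_left _ _).trans hη)
  have hlη : lam / q ≤ η := (le_max_right _ _).trans hη
  have hA0 : 0 < (D : ℝ) ^ a := Real.rpow_pos_of_pos hD0 _
  have hy : (D : ℝ) ^ a * ((k : ℝ) / n) ≤ 1 := by
    calc (D : ℝ) ^ a * ((k : ℝ) / n) ≤ (D : ℝ) ^ a * η := by gcongr
      _ = (D : ℝ) ^ (a + -(8 * cs)) := (Real.rpow_add hD0 _ _).symm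
      _ ≤ 1 := hone (by linarith)
  have hξsq : ((D : ℝ) ^ (-cs)) ^ 2 = (D : ℝ) ^ (-(2 * cs)) := by
    rw [← Real.rpow_natCast, ← Real.rpow_mul hD0.le]
    congr 1
    push_cast
    ring
  -- Both `edge_le` and `rank_le` reduce to this. With 8 ≤ D^3 the exponents require 3 + 3a - 8cs ≤
  -- -2cs, which follows from `2 * a ≤ cs` and a ≥ 8.
  have hA3 : 8 * ((D : ℝ) ^ a) ^ 3 * η ≤ ((D : ℝ) ^ (-cs)) ^ 2 := by
    rw [hξsq]
    calc 8 * ((D : ℝ) ^ a) ^ 3 * η ≤ (D : ℝ) ^ (3 : ℝ) * ((D : ℝ) ^ a) ^ 3 * η := by gcongr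
      _ = (D : ℝ) ^ (3 + a * 3 + -(8 * cs)) := by
          rw [Real.rpow_add hD0, Real.rpow_add hD0, Real.rpow_mul hD0.le]
          rw [← Real.rpow_natCast ((D : ℝ) ^ a) 3]
          push_cast
          ring
      _ ≤ _ := hmono (by linarith)
  have hA1 : 1 ≤ (D : ℝ) ^ a := Real.one_le_rpow hD1 (by linarith)
  have hqBar : q / 2 ≤ qBar q := by rw [qBar]; nlinarith
  have hsq1 : q ≤ √(qBar q) := Real.le_sqrt_of_sq_le (by rw [qBar]; nlinarith)
  have hsq2 : √q / 2 ≤ √(qBar q) := by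
    refine Real.le_sqrt_of_sq_le ?_
    rw [div_pow, Real.sq_sqrt hq.le]
    linarith
  have hξ0 : 0 < (D : ℝ) ^ (-cs) := Real.rpow_pos_of_pos hD0 _
  refine ⟨hΘ, hs.mem_Icc, hq, hq', hlam, hk, by omega, ?_, ?_, hy, ?_, ?_, hξ0, ?_, ?_, ?_⟩
  · calc (8 * D : ℝ) ^ 2 = 2 ^ 6 * (D : ℝ) ^ (2 : ℝ) := by
          rw [Real.rpow_two]; ring
      _ ≤ (D : ℝ) ^ ((6 : ℕ) : ℝ) * (D : ℝ) ^ (2 : ℝ) := by gcongr; exact hpow 6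
      _ = (D : ℝ) ^ (((6 : ℕ) : ℝ) + 2) := (Real.rpow_add hD0 _ _).symm
      _ ≤ _ := hmono (by push_cast; linarith)
  -- Since k ≥ 1, the bound on k/n forces n to exceed a large power of `D`.
  · have h1 : 1 / (n : ℝ) ≤ η := le_trans (by gcongr) hkη
    have h2 : 8 * (D : ℝ) ^ a * η ≤ 1 := by
      calc 8 * (D : ℝ) ^ a * η ≤ (D : ℝ) ^ (3 : ℝ) * (D : ℝ) ^ a * η := by gcongr
        _ = (D : ℝ) ^ (3 + a + -(8 * cs)) := by rw [Real.rpow_add hD0, Real.rpow_add hD0]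
        _ ≤ 1 := hone (by linarith)
    have h3 : 8 * (D : ℝ) ^ a * (1 / n) ≤ 1 := le_trans (by gcongr) h2
    rw [mul_one_div, div_le_one hn] at h3
    linarith
  · intro F hF hFD
    exact lat_thProd_le hΘ hn0.ne' hD hlam hm hv hcv₂ (by linarith) (by linarith) hy F hF hFD
  · have hr0 : 0 ≤ lam / q := by positivity
    have hx : 4 * D * (lam / q) ≤ (D : ℝ) ^ (-cs) / 2 := by
      calc 4 * D * (lam / q) ≤ 4 * D * η := by gcongr
        _ = 8 * (D : ℝ) ^ (1 : ℝ) * η / 2 := by rw [Real.rpow_one]; ring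
        _ ≤ (D : ℝ) ^ (3 : ℝ) * (D : ℝ) ^ (1 : ℝ) * η / 2 := by gcongr
        _ = (D : ℝ) ^ (3 + 1 + -(8 * cs)) / 2 := by rw [Real.rpow_add hD0, Real.rpow_add hD0]
        _ ≤ _ := by gcongr; linarith
    have hx0 : 0 ≤ 4 * D * (lam / q) := by positivity
    have hx1 : 4 * D * (lam / q) ≤ 1 := by
      have : (D : ℝ) ^ (-cs) ≤ 1 := hone (by linarith)
      linarith
    calc (1 + 2 * (lam / q)) ^ (2 * D) ≤ (Real.exp (2 * (lam / q))) ^ (2 * D) := by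
          gcongr
          rw [add_comm]; exact Real.add_one_le_exp _
      _ = Real.exp (4 * D * (lam / q)) := by
          rw [← Real.exp_nat_mul]; congr 1; push_cast; ring
      _ ≤ 1 + 2 * (4 * D * (lam / q)) := by
          have h1 := Real.abs_exp_sub_one_sub_id_le (x := 4 * D * (lam / q))
            (by rw [abs_of_nonneg hx0]; exact hx1)
          have h2 := (abs_le.1 h1).2
          nlinarith
      _ ≤ _ := by linarith
  · calc 4 * D * (D : ℝ) ^ (-cs) ≤ 8 * (D : ℝ) ^ (1 : ℝ) * (D : ℝ) ^ (-cs) := by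
          rw [Real.rpow_one]; gcongr; norm_num
      _ ≤ (D : ℝ) ^ (3 : ℝ) * (D : ℝ) ^ (1 : ℝ) * (D : ℝ) ^ (-cs) := by gcongr
      _ = (D : ℝ) ^ (3 + 1 + -cs) := by rw [Real.rpow_add hD0, Real.rpow_add hD0]
      _ ≤ 1 := hone (by linarith)
  · have hl : lam ≤ q * η := by rw [div_le_iff₀ hq] at hlη; linarith
    calc 4 * (D : ℝ) ^ a * ((D : ℝ) ^ a * lam) ≤
          4 * (D : ℝ) ^ a * ((D : ℝ) ^ a * (q * η)) := by gcongr
      _ = q * (4 * ((D : ℝ) ^ a) ^ 2 * η) := by ring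
      _ ≤ √(qBar q) * (8 * ((D : ℝ) ^ a) ^ 3 * η) := by
          have h1 : ((D : ℝ) ^ a) ^ 2 ≤ ((D : ℝ) ^ a) ^ 3 := pow_le_pow_right₀ hA1 (by norm_num)
          have h2 : 4 * ((D : ℝ) ^ a) ^ 2 * η ≤ 8 * ((D : ℝ) ^ a) ^ 3 * η := by
            gcongr
            norm_num
          exact mul_le_mul hsq1 h2 (by positivity) (by positivity)
      _ ≤ _ := by gcongr
  · have hlk : lam * k / √n ≤ √q * η := by
      rw [Real.sqrt_mul hn.le, ← div_div, div_le_iff₀ (Real.sqrt_pos.2 hq)] at hlkη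
      linarith
    calc 4 * (D : ℝ) ^ a * ((D : ℝ) ^ a * lam) * ((D : ℝ) ^ a * k / √n) =
          4 * ((D : ℝ) ^ a) ^ 3 * (lam * k / √n) := by ring
      _ ≤ 4 * ((D : ℝ) ^ a) ^ 3 * (√q * η) := by gcongr
      _ = √q / 2 * (8 * ((D : ℝ) ^ a) ^ 3 * η) := by ring
      _ ≤ _ := by gcongr

/-- Parameters: A = D^a with a = cm + cv₁ + cv₂ + 8, where the 8 ensures (8D)² ≤ A, and ξ = D^(-cs).
As cs ≥ 2a, both ξ and ξA are at most D^(-cs/2), and 73 = 25 + 48. -/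
lemma nearlyOrthonormal_of_conditions {cm cv₁ cv₂ cv₃ cv₄ cs : ℝ} (hcm : 0 ≤ cm) (hcv₁ : 0 ≤ cv₁)
    (hcv₂ : 0 ≤ cv₂) (hcs : 2 * (cm + cv₁ + cv₂ + 8) ≤ cs) (hD : 2 ≤ D) (hk : 1 ≤ k)
    (hkn : k ≤ n) (hq : 0 < q) (hq' : q ≤ 1 / 2) (hlam : 0 ≤ lam) (hΘ : Θ.IsSymm)
    (hs : CSignal cs D k q lam Θ) (hm : CMoment s cm D k q lam Θ)
    (hv : CVariance s cv₁ cv₂ cv₃ cv₄ D k q lam Θ) {C : Finset RootedTemplate}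
    (hC : IsRootedCollection D C) :
    NearlyOrthonormal s q Θ C (73 * (D : ℝ) ^ (-(cs / 2))) := by
  have hreg := regime_of_conditions hcm hcv₁ hcv₂ le_rfl hcs hD hk hkn hq hq' hlam hΘ hs hm hv
  set a := cm + cv₁ + cv₂ + 8
  have ha : 8 ≤ a := by simp only [a]; linarith
  have hD2 : (2 : ℝ) ≤ D := by exact_mod_cast hD
  have hD1 : (1 : ℝ) ≤ D := by linarith
  have hD0 : (0 : ℝ) < D := by linarith
  have hprod : (D : ℝ) ^ (-cs) * (D : ℝ) ^ a = (D : ℝ) ^ (-cs + a) := (Real.rpow_add hD0 _ _).symm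
  have hA1 : 1 ≤ (D : ℝ) ^ a := Real.one_le_rpow hD1 (by linarith)
  have hξ0 : 0 < (D : ℝ) ^ (-cs) := Real.rpow_pos_of_pos hD0 _
  refine nearlyOrthonormal_of_regime hreg ?_ ?_ hC
  · rw [hprod]
    calc (D : ℝ) ^ (-cs + a) ≤ (D : ℝ) ^ (-1 : ℝ) :=
          Real.rpow_le_rpow_of_exponent_le hD1 (by linarith)
      _ = 1 / D := by rw [Real.rpow_neg_one, one_div]
      _ ≤ 1 / 2 := by gcongr
  · have h1 : (D : ℝ) ^ (-cs) ≤ (D : ℝ) ^ (-cs) * (D : ℝ) ^ a := le_mul_of_one_le_right hξ0.le hA1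
    have h2 : (D : ℝ) ^ (-cs) * (D : ℝ) ^ a ≤ (D : ℝ) ^ (-(cs / 2)) := by
      rw [hprod]
      exact Real.rpow_le_rpow_of_exponent_le hD1 (by linarith)
    nlinarith

end Conclusion

end LatentGraph

end

theorem mainTheorem7 (cm cv₁ cv₂ cv₃ cv₄ : ℝ) (hcm : 0 ≤ cm) (hcv₁ : 0 ≤ cv₁) (hcv₂ : 0 ≤ cv₂)
    (hcv₃ : 0 ≤ cv₃) (hcv₄ : 1 ≤ cv₄) :
    (∃ cs₀ c : ℝ, 1 < cs₀ ∧ 0 < c ∧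
      ∀ (cs : ℝ), cs₀ ≤ cs →
      ∀ (D n k : ℕ) (q lam : ℝ) (Θ : Matrix (Fin n) (Fin n) ℝ),
        2 ≤ D → 1 ≤ k → k ≤ n → 0 < q → q ≤ 1 / 2 → 0 ≤ lam → lam ≤ 1 - q → Θ.IsSymm →
        LatentGraph.CSignal cs D k q lam Θ →
        LatentGraph.CMoment .independent cm D k q lam Θ →
        LatentGraph.CVariance .independent cv₁ cv₂ cv₃ cv₄ D k q lam Θ →
        ∀ C : Finset LatentGraph.RootedTemplate, LatentGraph.IsRootedCollection D C →
          LatentGraph.NearlyOrthonormal .independent q Θ C (c * (D : ℝ) ^ (-(cs / 2)))) ∧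
    (∀ cvd₁ cvd₂ : ℝ, 0 ≤ cvd₁ → 0 ≤ cvd₂ →
      ∃ cs₀ c : ℝ, 1 < cs₀ ∧ 0 < c ∧
      ∀ (cs : ℝ), cs₀ ≤ cs →
      ∀ (D n k : ℕ) (q lam : ℝ) (Θ : Matrix (Fin n) (Fin n) ℝ),
        2 ≤ D → 1 ≤ k → k ≤ n → 0 < q → q ≤ 1 / 2 → 0 ≤ lam → lam ≤ 1 - q → Θ.IsSymm →
        LatentGraph.CSignal cs D k q lam Θ →
        LatentGraph.CMoment .permutation cm D k q lam Θ →
        LatentGraph.CVariance .permutation cv₁ cv₂ cv₃ cv₄ D k q lam Θ →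
        LatentGraph.CVariancePermutation cvd₁ cvd₂ D k q lam Θ →
        ∀ C : Finset LatentGraph.RootedTemplate, LatentGraph.IsRootedCollection D C →
          LatentGraph.NearlyOrthonormal .permutation q Θ C (c * (D : ℝ) ^ (-(cs / 2)))) := by
  have h16 : 1 < 2 * (cm + cv₁ + cv₂ + 8) := by linarith
  refine ⟨⟨_, 73, h16, by norm_num, ?_⟩, fun _ _ _ _ => ⟨_, 73, h16, by norm_num, ?_⟩⟩
  · intro cs hcs D n k q lam Θ hD hk hkn hq hq' hlam _ hΘ hs hm hv C hC
    exact LatentGraph.nearlyOrthonormal_of_conditions hcm hcv₁ hcv₂ hcs hD hk hkn hq hq' hlam hΘ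
      hs hm hv hC
  · intro cs hcs D n k q lam Θ hD hk hkn hq hq' hlam _ hΘ hs hm hv _ C hC
    exact LatentGraph.nearlyOrthonormal_of_conditions hcm hcv₁ hcv₂ hcs hD hk hkn hq hq' hlam hΘ
      hs hm hv hC
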